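/- Let $k$ be a commutative ring and let $(X^*,d)$ be a cochain complex of $k$-modules indexed by $\mathbb Z$ (for example, but not necessarily, a complex of free $k$-modules, or a graded $k$-module with $d=0$). Write $T^n(X^*)=(\bigoplus_i X^i)^{\otimes n}$ and $T(X^*)=\bigoplus_{n\ge 0}T^n(X^*)$, with internal degree $|x_1\otimes\cdots\otimes x_n|=\sum_i|x_i|$ and differential $d(x_1\otimes\cdots\otimes x_n)=\sum_i(-1)^{|x_1|+\cdots+|x_{i-1}|}x_1\otimes\cdots\otimes dx_i\otimes\cdots\otimes x_n$. For $\sigma\in\mathfrak S_n$ and homogeneous $x_i$ put $$\sigma(x_1\otimes\cdots\otimes x_n)=(-1)^{\ell}\,x_{\sigma^{-1}(1)}\otimes\cdots\otimes x_{\sigma^{-1}(n)},\qquad \ell=\sum_{i<j,\ \sigma(i)>\sigma(j)}|x_i||x_j| .$$ For $f\in T^m(X^*)$ and $g\in T^n(X^*)$ let $f\star g=\sum_{\sigma}\sigma(f\otimes g)$, the sum running over all $(m,n)$-shuffles, i.e. all $\sigma\in\mathfrak S_{m+n}$ with $\sigma(1)<\cdots<\sigma(m)$ and $\sigma(m+1)<\cdots<\sigma(m+n)$.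 Let $TS^n(X^*)=T^n(X^*)^{\mathfrak S_n}$, $TS(X^*)=\bigoplus_{n\ge 0} TS^n(X^*)$, $T^+(X^*)=\bigoplus_{n>0}T^n(X^*)$ and $TS^+(X^*)=\bigoplus_{n>0}TS^n(X^*)$. For a strictly graded commutative dg algebra $R$ (that is, $xy=(-1)^{|x||y|}yx$ for homogeneous $x,y$, and $x^2=0$ for homogeneous $x$ of odd degree) and a dg ideal $I\subseteq R$, let $R_{ev}$ be the sum of the even-degree components and $I_{ev}=I\cap R_{ev}$. A divided power (pd) structure on $I$ is a sequence of maps $\gamma_n$ ($n\ge 0$) on $I_{ev}$, with values in $I_{ev}$ for $n\ge 1$, such that 1. $\gamma_0(x)=1$ and $\gamma_1(x)=x$ for $x\in I_{ev}$; 2. $\gamma_n(x)\gamma_m(x)=\binom{n+m}{m}\gamma_{n+m}(x)$ for $x\in I_{ev}$; 3. $\gamma_n(ax)=a^n\gamma_n(x)$ for $a\in R_{ev}$, $x\in I_{ev}$; 4. $\gamma_n(x+y)=\sum_{i=0}^n\gamma_i(x)\gamma_{n-i}(y)$ for $x,y\in I_{ev}$; 5. $\gamma_p(\gamma_q(x))=\frac{(pq)!}{p!\,(q!)^p}\gamma_{pq}(x)$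 for $x\in I_{ev}$, $q\ge1$; 6. $\gamma_n(x)\in R_{rn}$ for $x\in I$ homogeneous of even degree $r$; 7. $\gamma_n(xy)=0$ for $n\ge2$, $x\in R$ and $y\in I$ homogeneous of odd degrees; 8. $d(\gamma_n(x))=\gamma_{n-1}(x)\,d(x)$ for $n\ge1$, $x\in I_{ev}$. Then: (a) $(T(X^*),\star)$ is a strictly graded commutative dg $k$-algebra. The tensor degree $n$ makes it $\mathbb N$-graded, compatibly with the dg structure, and it is connected: its component of tensor degree $0$ is $k$. (b) $TS(X^*)$ is a dg subalgebra of $(T(X^*),\star)$ and is itself a connected $\mathbb N$-graded strictly graded commutative dg algebra. (c) There is a pd structure $\gamma$ on the dg ideal $T^+(X^*)$ of $(T(X^*),\star)$ such that, for every $p\ge1$ and every $x\in T^p(X^*)$ of even internal degree (or a sum of such elements), $$\gamma_n(x)=\sum_\sigma\sigma(x\otimes\cdots\otimes x)\qquad(n\text{ factors}),$$ where $\sigma$ runs over the permutations in $\mathfrak S_{np}$ that preserve the order within each of the $n$ consecutive blocks of length $p$ and satisfy $\sigma(p)<\sigma(2p)<\cdots<\sigma(np)$. (d) $TS^+(X^*)$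 is a dg ideal of $TS(X^*)$, the maps $\gamma_n$ restrict to $TS^+(X^*)$, and the restrictions form a pd structure satisfying 1–8. Thus $TS(X^*)$ is a pd dg subalgebra of $(T(X^*),\star)$. -/

import Mathlib

open scoped TensorProduct DirectSum Nat

universe u v

/-! ### Dg algebras and divided powers

The predicates below are about a `k`-module `A` with a bilinear multiplication `mul`, an element
`one`, a family `gr` of submodules (the homogeneous elements of each degree) and a linear map
`d`. -/

namespace DGAlg

section

variable {k A : Type*} [CommRing k] [AddCommMonoid A] [Module k A]

/-- `A` is an associative unital differential `ℤ`-graded `k`-algebra, with a differential of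
degree `+1`. -/
structure IsDGAlgebra (mul : A →ₗ[k] A →ₗ[k] A) (one : A) (gr : ℤ → Submodule k A)
    (d : A →ₗ[k] A) : Prop where
  isInternal : DirectSum.IsInternal gr
  mul_assoc : ∀ x y z, mul (mul x y) z = mul x (mul y z)
  one_mul : ∀ x, mul one x = x
  mul_one : ∀ x, mul x one = x
  one_mem : one ∈ gr 0
  mul_mem : ∀ i j, ∀ x ∈ gr i, ∀ y ∈ gr j, mul x y ∈ gr (i + j)
  d_mem : ∀ i, ∀ x ∈ gr i, d x ∈ gr (i + 1)
  d_d : ∀ x, d (d x) = 0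
  leibniz : ∀ i, ∀ x ∈ gr i, ∀ y, d (mul x y) = mul (d x) y + ((i.negOnePow : ℤ) : k) • mul x (d y)

/-- Graded commutativity, together with `x x = 0` for homogeneous `x` of odd degree. -/
structure IsStrictlyGradedCommutative (mul : A →ₗ[k] A →ₗ[k] A) (gr : ℤ → Submodule k A) :
    Prop where
  comm : ∀ i j, ∀ x ∈ gr i, ∀ y ∈ gr j, mul x y = (((i * j).negOnePow : ℤ) : k) • mul y x
  sq_eq_zero : ∀ i, Odd i → ∀ x ∈ gr i, mul x x = 0

/-- `w` is a further `ℕ`-grading of the dg algebra by graded subcomplexes which is connected: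
its component of weight `0` is `k`. -/
structure IsConnectedNGrading (mul : A →ₗ[k] A →ₗ[k] A) (one : A) (gr : ℤ → Submodule k A)
    (d : A →ₗ[k] A) (w : ℕ → Submodule k A) : Prop where
  isInternal : DirectSum.IsInternal w
  homogeneous : ∀ n, w n ≤ ⨆ i, w n ⊓ gr i
  one_mem : one ∈ w 0
  mul_mem : ∀ m n, ∀ x ∈ w m, ∀ y ∈ w n, mul x y ∈ w (m + n)
  d_mem : ∀ n, ∀ x ∈ w n, d x ∈ w n
  smul_one_injective : Function.Injective fun a : k => a • one
  exists_smul_one : ∀ x ∈ w 0, ∃ a : k, a • one = x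

/-- `I` is a two-sided graded ideal stable under the differential. -/
structure IsDGIdeal (mul : A →ₗ[k] A →ₗ[k] A) (gr : ℤ → Submodule k A) (d : A →ₗ[k] A)
    (I : Submodule k A) : Prop where
  homogeneous : I ≤ ⨆ i, I ⊓ gr i
  mul_mem_left : ∀ a, ∀ x ∈ I, mul a x ∈ I
  mul_mem_right : ∀ a, ∀ x ∈ I, mul x a ∈ I
  d_mem : ∀ x ∈ I, d x ∈ I

/-- The sum of the components of even degree. -/
def evenPart (gr : ℤ → Submodule k A) : Submodule k A := ⨆ i, ⨆ _ : Even i, gr i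

/-- The power `aⁿ` with respect to `mul`. -/
def npow (mul : A →ₗ[k] A →ₗ[k] A) (one : A) (a : A) (n : ℕ) : A := (fun b => mul a b)^[n] one

/-- `γ` is a divided power structure on the dg ideal `I`. Only the values of `γ n` on
`I_ev = I ⊓ evenPart gr` matter. -/
structure IsPDStructure (mul : A →ₗ[k] A →ₗ[k] A) (one : A) (gr : ℤ → Submodule k A)
    (d : A →ₗ[k] A) (I : Submodule k A) (γ : ℕ → A → A) : Prop where
  isDGIdeal : IsDGIdeal mul gr d I
  gamma_mem : ∀ n, 1 ≤ n → ∀ x ∈ I ⊓ evenPart gr, γ n x ∈ I ⊓ evenPart gr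
  gamma_zero : ∀ x ∈ I ⊓ evenPart gr, γ 0 x = one
  gamma_one : ∀ x ∈ I ⊓ evenPart gr, γ 1 x = x
  gamma_mul : ∀ n m, ∀ x ∈ I ⊓ evenPart gr, mul (γ n x) (γ m x) = (n + m).choose m • γ (n + m) x
  gamma_smul : ∀ n, ∀ a ∈ evenPart gr, ∀ x ∈ I ⊓ evenPart gr,
    γ n (mul a x) = mul (npow mul one a n) (γ n x)
  gamma_add : ∀ n, ∀ x ∈ I ⊓ evenPart gr, ∀ y ∈ I ⊓ evenPart gr,
    γ n (x + y) = ∑ i ∈ Finset.range (n + 1), mul (γ i x) (γ (n - i) y)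
  gamma_comp : ∀ p q, 1 ≤ q → ∀ x ∈ I ⊓ evenPart gr,
    γ p (γ q x) = ((p * q)! / (p ! * q ! ^ p)) • γ (p * q) x
  gamma_deg : ∀ (n : ℕ) (r : ℤ), Even r → ∀ x ∈ I ⊓ gr r, γ n x ∈ gr (n * r)
  gamma_odd : ∀ n, 2 ≤ n → ∀ i j, Odd i → Odd j → ∀ x ∈ gr i, ∀ y ∈ I ⊓ gr j, γ n (mul x y) = 0
  d_gamma : ∀ n, 1 ≤ n → ∀ x ∈ I ⊓ evenPart gr, d (γ n x) = mul (γ (n - 1) x) (d x)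

/-- `S` is a dg subalgebra. -/
structure IsDGSubalgebra (mul : A →ₗ[k] A →ₗ[k] A) (one : A) (gr : ℤ → Submodule k A)
    (d : A →ₗ[k] A) (S : Submodule k A) : Prop where
  homogeneous : S ≤ ⨆ i, S ⊓ gr i
  one_mem : one ∈ S
  mul_mem : ∀ x ∈ S, ∀ y ∈ S, mul x y ∈ S
  d_mem : ∀ x ∈ S, d x ∈ S

namespace IsDGSubalgebra

variable {mul : A →ₗ[k] A →ₗ[k] A} {one : A} {gr : ℤ → Submodule k A} {d : A →ₗ[k] A}
  {S : Submodule k A}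

/-- The multiplication induced on a dg subalgebra. -/
def subMul (h : IsDGSubalgebra mul one gr d S) : S →ₗ[k] S →ₗ[k] S :=
  LinearMap.mk₂ k (fun x y => ⟨mul x y, h.mul_mem x x.2 y y.2⟩)
    (fun _ _ _ => by ext; simp) (fun _ _ _ => by ext; simp)
    (fun _ _ _ => by ext; simp) (fun _ _ _ => by ext; simp)

/-- The unit of a dg subalgebra. -/
def subOne (h : IsDGSubalgebra mul one gr d S) : S := ⟨one, h.one_mem⟩

/-- The differential induced on a dg subalgebra. -/
def subD (h : IsDGSubalgebra mul one gr d S) : S →ₗ[k] S := d.restrict h.d_mem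

end IsDGSubalgebra

/-- The family of submodules of `S` cut out by a family of submodules of `A`. -/
def subGr {ι : Type*} (gr : ι → Submodule k A) (S : Submodule k A) (i : ι) : Submodule k S :=
  (gr i).comap S.subtype

end

end DGAlg

/-! ### The shuffle algebra of a complex -/

namespace ShuffleAlg

noncomputable section

variable {k : Type u} [CommRing k] (X : CochainComplex (ModuleCat.{v} k) ℤ)

/-- The graded module `⨁ i, Xⁱ` underlying the complex. -/
abbrev Tot : Type v := ⨁ i : ℤ, X.X i

/-- The differential of `X` on `⨁ i, Xⁱ`. -/
def totD : Tot X →ₗ[k] Tot X :=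
  DirectSum.toModule k ℤ (Tot X) fun i =>
    DirectSum.lof k ℤ (fun i => X.X i) (i + 1) ∘ₗ (X.d i (i + 1)).hom

/-- The map `x ↦ (-1)^|x| x` on `⨁ i, Xⁱ`. -/
def totSign : Tot X →ₗ[k] Tot X :=
  DirectSum.toModule k ℤ (Tot X) fun i =>
    ((i.negOnePow : ℤ) : k) • DirectSum.lof k ℤ (fun i => X.X i) i

/-- The projection of `⨁ i, Xⁱ` onto its part of even (`e = 0`) or odd (`e = 1`) degree. -/
def parityProj (e : ZMod 2) : Tot X →ₗ[k] Tot X :=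
  DirectSum.toModule k ℤ (Tot X) fun i =>
    if (i : ZMod 2) = e then DirectSum.lof k ℤ (fun i => X.X i) i else 0

/-- The Koszul sign of the permutation `σ` of factors of parities `e 0, …, e (n-1)`: the product of
`(-1)^(e i * e j)` over the inversions `(i, j)` of `σ`. -/
def koszulSign {n : ℕ} (σ : Equiv.Perm (Fin n)) (e : Fin n → ZMod 2) : ℤ :=
  ∏ i, ∏ j, if i < j ∧ σ j < σ i ∧ e i = 1 ∧ e j = 1 then -1 else 1

/-- The Koszul-signed action of `σ` on `Tⁿ(X)`; on tensors of homogeneous elements it is computed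
in `permAct_tprod`. -/
def permAct {n : ℕ} (σ : Equiv.Perm (Fin n)) : (⨂[k]^n (Tot X)) →ₗ[k] (⨂[k]^n (Tot X)) :=
  ∑ e : Fin n → ZMod 2, (koszulSign σ e : k) •
    ((PiTensorProduct.reindex k (fun _ : Fin n => Tot X) σ).toLinearMap ∘ₗ
      PiTensorProduct.map fun i => parityProj X (e i))

theorem permAct_tprod {n : ℕ} (σ : Equiv.Perm (Fin n)) (deg : Fin n → ℤ)
    (x : ∀ i, X.X (deg i)) :
    permAct X σ (PiTensorProduct.tprod k fun i =>
        DirectSum.lof k ℤ (fun i => X.X i) (deg i) (x i)) =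
      ((∏ i, ∏ j, if i < j ∧ σ j < σ i then ((deg i * deg j).negOnePow : ℤ) else 1 : ℤ) : k) •
        PiTensorProduct.tprod k fun i =>
          DirectSum.lof k ℤ (fun i => X.X i) (deg (σ.symm i)) (x (σ.symm i)) := by
  have key : ∀ e : Fin n → ZMod 2, (fun i => parityProj X (e i)
      (DirectSum.lof k ℤ (fun i => X.X i) (deg i) (x i))) = fun i =>
        if (deg i : ZMod 2) = e i then DirectSum.lof k ℤ (fun i => X.X i) (deg i) (x i) else 0 := by
    intro e
    funext i
    rw [parityProj, DirectSum.toModule_lof]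
    split_ifs <;> rfl
  rw [permAct, LinearMap.sum_apply, Finset.sum_eq_single fun i => (deg i : ZMod 2)]
  · rw [LinearMap.smul_apply, LinearMap.comp_apply, PiTensorProduct.map_tprod, key]
    simp only [if_true, LinearEquiv.coe_coe, PiTensorProduct.reindex_tprod]
    congr 2
    refine Finset.prod_congr rfl fun i _ => Finset.prod_congr rfl fun j _ => ?_
    have hp : ∀ z : ℤ, (z : ZMod 2) = 1 ↔ Odd z := fun z => ZMod.intCast_eq_one_iff_odd
    simp only [hp]
    by_cases h : i < j ∧ σ j < σ i
    · by_cases h' : Odd (deg i) ∧ Odd (deg j)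
      · rw [if_pos ⟨h.1, h.2, h'⟩, if_pos h, Int.negOnePow_odd _ (h'.1.mul h'.2)]
        rfl
      · rw [if_neg fun H => h' H.2.2, if_pos h, Int.negOnePow_even]
        · rfl
        · rwa [← Int.not_odd_iff_even, Int.odd_mul]
    · rw [if_neg h, if_neg fun H => h ⟨H.1, H.2.1⟩]
  · intro e _ he
    rw [LinearMap.smul_apply, LinearMap.comp_apply, PiTensorProduct.map_tprod, key]
    obtain ⟨i, hi⟩ : ∃ i, (deg i : ZMod 2) ≠ e i := by
      by_contra! H
      exact he (funext fun i => (H i).symm)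
    rw [MultilinearMap.map_coord_zero _ i (if_neg hi), map_zero, smul_zero]
  · exact fun h => absurd (Finset.mem_univ _) h

/-- The differential `x₁ ⊗ ⋯ ⊗ xₙ ↦ ∑ i, (-1)^(|x₁| + ⋯ + |xᵢ₋₁|) x₁ ⊗ ⋯ ⊗ d xᵢ ⊗ ⋯ ⊗ xₙ` of
`Tⁿ(X)`. -/
def powD (n : ℕ) : (⨂[k]^n (Tot X)) →ₗ[k] (⨂[k]^n (Tot X)) :=
  ∑ i : Fin n, PiTensorProduct.map fun j =>
    if j < i then totSign X else if j = i then totD X else LinearMap.id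

/-- The elements of degree `r` in `Tⁿ(X)`. -/
def powGr (n : ℕ) (r : ℤ) : Submodule k (⨂[k]^n (Tot X)) :=
  Submodule.span k {t | ∃ (deg : Fin n → ℤ) (x : ∀ i, X.X (deg i)), ∑ i, deg i = r ∧
    t = PiTensorProduct.tprod k fun i => DirectSum.lof k ℤ (fun i => X.X i) (deg i) (x i)}

/-- `T(X) = ⨁ n, Tⁿ(X)`. -/
abbrev T : Type (max u v) := ⨁ n : ℕ, ⨂[k]^n (Tot X)

/-- The elements of `T(X)` of (internal) degree `r`. -/
def gr (r : ℤ) : Submodule k (T X) :=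
  ⨅ n, (powGr X n r).comap (DirectSum.component k ℕ (fun n => ⨂[k]^n (Tot X)) n)

/-- The elements of `T(X)` of tensor degree `n`. -/
def tensorGr (n : ℕ) : Submodule k (T X) :=
  LinearMap.range (DirectSum.lof k ℕ (fun n => ⨂[k]^n (Tot X)) n)

/-- The differential of `T(X)`. -/
def d : T X →ₗ[k] T X :=
  DirectSum.lmap (powD X)

/-- The `(m, n)`-shuffles. -/
def IsShuffle (m n : ℕ) (σ : Equiv.Perm (Fin (m + n))) : Prop :=
  StrictMono (fun i : Fin m => σ (Fin.castAdd n i)) ∧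
    StrictMono (fun i : Fin n => σ (Fin.natAdd m i))

open Classical in
/-- The shuffle product `f ⋆ g = ∑ σ ∈ Sh(m, n), σ (f ⊗ g)` of `f ∈ Tᵐ(X)` and `g ∈ Tⁿ(X)`. -/
def powShuffle (m n : ℕ) :
    (⨂[k]^m (Tot X)) →ₗ[k] (⨂[k]^n (Tot X)) →ₗ[k] (⨂[k]^(m + n) (Tot X)) :=
  (TensorProduct.mk k (⨂[k]^m (Tot X)) (⨂[k]^n (Tot X))).compr₂
    (∑ σ : Equiv.Perm (Fin (m + n)) with IsShuffle m n σ,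
      permAct X σ ∘ₗ TensorPower.mulEquiv.toLinearMap)

/-- The shuffle product on `T(X)`. -/
def shuffle : T X →ₗ[k] T X →ₗ[k] T X :=
  DirectSum.toModule k ℕ (T X →ₗ[k] T X) fun m =>
    (DirectSum.toModule k ℕ ((⨂[k]^m (Tot X)) →ₗ[k] T X) fun n =>
      ((powShuffle X m n).compr₂ (DirectSum.lof k ℕ (fun n => ⨂[k]^n (Tot X)) (m + n))).flip).flip

/-- The unit of `T(X)`, the empty tensor. -/
def one : T X :=
  DirectSum.lof k ℕ (fun n => ⨂[k]^n (Tot X)) 0 (PiTensorProduct.tprod k Fin.elim0)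

/-- The ideal `T⁺(X)` of elements without component in `T⁰(X)`. -/
def TPlus : Submodule k (T X) :=
  LinearMap.ker (DirectSum.component k ℕ (fun n => ⨂[k]^n (Tot X)) 0)

/-- `TSⁿ(X)`, the invariants of the Koszul-signed action of the symmetric group on `Tⁿ(X)`. -/
def powTS (n : ℕ) : Submodule k (⨂[k]^n (Tot X)) :=
  ⨅ σ : Equiv.Perm (Fin n), LinearMap.eqLocus (permAct X σ) LinearMap.id

/-- `TS(X) = ⨁ n, TSⁿ(X)` inside `T(X)`. -/
def TS : Submodule k (T X) :=
  ⨅ n, (powTS X n).comap (DirectSum.component k ℕ (fun n => ⨂[k]^n (Tot X)) n)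

/-- The ideal `TS⁺(X) = ⨁ n > 0, TSⁿ(X)` of `TS(X)`. -/
def TSPlus : Submodule k (TS X) := (TPlus X).comap (TS X).subtype

/-- The permutations of `n` consecutive blocks of size `p` that preserve the order inside every
block and the order of the last elements of the blocks; `finProdFinEquiv (a, b)` is the `b`-th
element of the `a`-th block. -/
def IsBlockShuffle (n p : ℕ) (σ : Equiv.Perm (Fin (n * p))) : Prop :=
  (∀ a : Fin n, StrictMono fun b : Fin p => σ (finProdFinEquiv (a, b))) ∧
    ∀ b : Fin p, (b : ℕ) + 1 = p → StrictMono fun a : Fin n => σ (finProdFinEquiv (a, b))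

/-- The tensor power `x ⊗ ⋯ ⊗ x ∈ Tⁿᵖ(X)` of `x ∈ Tᵖ(X)`. -/
def tensorPow (n : ℕ) {p : ℕ} (x : ⨂[k]^p (Tot X)) : ⨂[k]^(n * p) (Tot X) :=
  GradedMonoid.GMonoid.gnpow (A := fun n => ⨂[k]^n (Tot X)) n x

open Classical in
/-- `∑ σ (x ⊗ ⋯ ⊗ x)`, over all `n`-block shuffles `σ`, for `x ∈ Tᵖ(X)`. -/
def powGamma (n : ℕ) {p : ℕ} (x : ⨂[k]^p (Tot X)) : ⨂[k]^(n * p) (Tot X) :=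
  ∑ σ : Equiv.Perm (Fin (n * p)) with IsBlockShuffle n p σ, permAct X σ (tensorPow X n x)

end

end ShuffleAlg

/-! All operations are sums of the Koszul-signed action `bijAct` of bijections on tensors. The
exponent of the Koszul sign is a cocycle (`inversionSum_trans`), so this is an action; it commutes
with the differential (`bijAct_powD`), and exchanging two adjacent tensors of degrees r and s costs
(-1)^(rs) (`bijAct_finAddFlip_conc`).

The combinatorics is about cosets. For a labelling f of the positions, the permutations increasing
on the fibres of f represent, each coset once, the left cosets of the Young subgroup preserving f
(`exists_fiberMono_mul`, `fiberMono_mul_unique`). Shuffles are the case of two labels. A shuffle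
product of two such sums is again such a sum, for the disjoint union of the labels
(`shuffle_shuffleSum`). Associativity and the unit laws follow by comparing labels, commutativity by
flipping the two blocks, and the vanishing of odd squares because the flip pairs shuffles with
opposite signs. This last argument never divides by 2.

For x in tensor degree p, the n-fold product of x is the sum over all permutations increasing on n
blocks. Such a permutation is uniquely a block shuffle times a permutation of the blocks, and for x
of even degree the latter fixes the n-fold tensor power of x. Hence n! γₙ(x) = xⁿ. The maps γₙ are
extended to all of T⁺ by imposing the addition formula one tensor degree at a time, and n! γₙ(x) =
xⁿ persists by the binomial theorem, since even elements are central (`factorial_smul_gamma`).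

If T(X) has no ℤ-torsion, the identities for γ follow by cancelling factorials. A general X is a
quotient of a complex of free modules over a polynomial ring over ℤ, whose shuffle algebra is
torsion-free. Since γ is natural even for semilinear maps, and since elements of T⁺ that are
homogeneous or of even degree lift with these properties, the identities descend to X.

For symmetric tensors, summing the translates of an H-fixed tensor over representatives of the
cosets of H gives an invariant (`sum_bijAct_mem_powTS`). Shuffles represent the cosets of 𝔖ₘ × 𝔖ₙ
and block shuffles those of the wreath product of 𝔖ₚ by 𝔖ₙ, so TS is stable under ⋆ and γ, and the
axioms restrict to it. -/

namespace ShuffleAlg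

noncomputable section

/-! ### Koszul signs -/

/-- The sign `(-1)^e` of a parity `e`. -/
def paritySign (R : Type*) [Ring R] (e : ZMod 2) : R := if e = 0 then 1 else -1

section Sign

variable {R : Type*} [Ring R]

@[simp] theorem paritySign_zero : paritySign R 0 = 1 := if_pos rfl

@[simp] theorem paritySign_one : paritySign R 1 = -1 := if_neg (by decide)

theorem zmod_two_cases (a : ZMod 2) : a = 0 ∨ a = 1 := by
  revert a; decide

theorem zmod_two_add_self (a : ZMod 2) : a + a = 0 := by
  revert a; decide

theorem paritySign_add (a b : ZMod 2) :
    paritySign R (a + b) = paritySign R a * paritySign R b := by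
  rcases zmod_two_cases a with rfl | rfl <;> rcases zmod_two_cases b with rfl | rfl <;>
    simp [zmod_two_add_self]

theorem paritySign_sum {R : Type*} [CommRing R] {ι : Type*} (s : Finset ι) (f : ι → ZMod 2) :
    paritySign R (∑ i ∈ s, f i) = ∏ i ∈ s, paritySign R (f i) := by
  classical
  induction s using Finset.induction_on with
  | empty => simp
  | insert a s ha ih => rw [Finset.sum_insert ha, Finset.prod_insert ha, paritySign_add, ih]

theorem intCast_paritySign (e : ZMod 2) : ((paritySign ℤ e : ℤ) : R) = paritySign R e := by
  rcases zmod_two_cases e with rfl | rfl <;> simp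

theorem negOnePow_eq_paritySign (i : ℤ) :
    ((i.negOnePow : ℤ) : R) = paritySign R (i : ZMod 2) := by
  rcases Int.even_or_odd i with h | h
  · rw [Int.negOnePow_even i h, ZMod.intCast_eq_zero_iff_even.2 h]; simp
  · rw [Int.negOnePow_odd i h, ZMod.intCast_eq_one_iff_odd.2 h]; simp

end Sign

/-- The exponent of the Koszul sign: the sum of `e i * e j` over the inversions `(i, j)`. -/
def inversionSum {m n : ℕ} (σ : Fin m ≃ Fin n) (e : Fin m → ZMod 2) : ZMod 2 :=
  ∑ i, ∑ j, if i < j ∧ σ j < σ i then e i * e j else 0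

theorem koszulSign_eq {n : ℕ} (σ : Equiv.Perm (Fin n)) (e : Fin n → ZMod 2) :
    koszulSign σ e = paritySign ℤ (inversionSum σ e) := by
  simp only [koszulSign, inversionSum, paritySign_sum]
  refine Finset.prod_congr rfl fun i _ => Finset.prod_congr rfl fun j _ => ?_
  rcases zmod_two_cases (e i) with hi | hi <;> rcases zmod_two_cases (e j) with hj | hj <;>
    by_cases h : i < j ∧ σ j < σ i <;> simp [hi, hj, h]

/-- Off-diagonal terms cancel in pairs under the swap. The diagonal needs its own hypothesis,
because F i i + F i i = 0 does not force F i i = 0 in characteristic 2. -/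
theorem sum_sum_eq_zero_of_symm {n : ℕ} {A : Type*} [AddCommMonoid A]
    (F : Fin n → Fin n → A) (h0 : ∀ i, F i i = 0)
    (h : ∀ i j, F i j + F j i = 0) : ∑ i, ∑ j, F i j = 0 := by
  rw [← Fintype.sum_prod_type']
  refine Finset.sum_involution (fun p _ => p.swap) (fun p _ => h p.1 p.2) ?_
    (fun _ _ => Finset.mem_univ _) (fun p _ => Prod.swap_swap p)
  rintro ⟨i, j⟩ _ hne heq
  have : i = j := (congrArg Prod.snd heq :)
  subst this
  exact hne (h0 i)

/-- A pair is inverted by the composite exactly when one of the two bijections inverts it and the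
other does not; a pair inverted twice contributes 2 e i e j = 0. Such a pair appears as (i, j) for
`σ` but as (j, i) for `τ`, so the terms agree only after symmetrization. -/
theorem inversionSum_trans {l m n : ℕ} (σ : Fin l ≃ Fin m) (τ : Fin m ≃ Fin n)
    (e : Fin l → ZMod 2) :
    inversionSum (σ.trans τ) e = inversionSum σ e + inversionSum τ (e ∘ σ.symm) := by
  have h1 : inversionSum τ (e ∘ σ.symm) =
      ∑ i, ∑ j, if σ i < σ j ∧ τ (σ j) < τ (σ i) then e i * e j else 0 := by
    rw [inversionSum, ← σ.sum_comp]
    refine Finset.sum_congr rfl fun i _ => ?_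
    rw [← σ.sum_comp]
    simp
  rw [h1, inversionSum, inversionSum, ← sub_eq_zero, ← Finset.sum_add_distrib,
    ← Finset.sum_sub_distrib]
  simp_rw [← Finset.sum_add_distrib, ← Finset.sum_sub_distrib]
  refine sum_sum_eq_zero_of_symm _ (fun i => by simp) fun i j => ?_
  rcases lt_trichotomy i j with hij | rfl | hij
  · rcases lt_trichotomy (σ i) (σ j) with h | h | h
    · rcases lt_trichotomy (τ (σ i)) (τ (σ j)) with h' | h' | h'
      · simp [hij, h, h', hij.not_gt, h.not_gt, h'.not_gt]
      · exact absurd (σ.injective (τ.injective h')) hij.ne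
      · simp [hij, h, h', hij.not_gt, h.not_gt, h'.not_gt]
    · exact absurd (σ.injective h) hij.ne
    · rcases lt_trichotomy (τ (σ i)) (τ (σ j)) with h' | h' | h'
      · simp only [Equiv.trans_apply, hij, h, h', hij.not_gt, h.not_gt, h'.not_gt]
        simp [mul_comm (e j), zmod_two_add_self]
      · exact absurd (σ.injective (τ.injective h')) hij.ne
      · simp [hij, h, h', hij.not_gt, h.not_gt, h'.not_gt]
  · simp
  · rcases lt_trichotomy (σ i) (σ j) with h | h | h
    · rcases lt_trichotomy (τ (σ i)) (τ (σ j)) with h' | h' | h'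
      · simp [hij, h, h', hij.not_gt, h.not_gt, h'.not_gt]
      · exact absurd (σ.injective (τ.injective h')) hij.ne'
      · simp only [Equiv.trans_apply, hij, h, h', hij.not_gt, h.not_gt, h'.not_gt]
        simp [mul_comm (e j), zmod_two_add_self]
    · exact absurd (σ.injective h) hij.ne'
    · rcases lt_trichotomy (τ (σ i)) (τ (σ j)) with h' | h' | h'
      · simp [hij, h, h', hij.not_gt, h.not_gt, h'.not_gt]
      · exact absurd (σ.injective (τ.injective h')) hij.ne'
      · simp [hij, h, h', hij.not_gt, h.not_gt, h'.not_gt]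

theorem inversionSum_of_strictMono {m n : ℕ} {σ : Fin m ≃ Fin n} (h : StrictMono σ)
    (e : Fin m → ZMod 2) : inversionSum σ e = 0 :=
  Finset.sum_eq_zero fun _ _ => Finset.sum_eq_zero fun _ _ =>
    if_neg fun H => (h H.1).not_gt H.2

/-- Raising the parity at the position `i` changes the exponent of the Koszul sign by the parities
of all elements which form an inversion with `i`. -/
theorem inversionSum_update {m n : ℕ} (σ : Fin m ≃ Fin n) (e : Fin m → ZMod 2) (i : Fin m) :
    inversionSum σ (Function.update e i (e i + 1)) + ∑ j, (if j < i then e j else 0) =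
      inversionSum σ e + ∑ j, (if σ j < σ i then e j else 0) := by
  -- Expand the product at the raised position `i`. The quadratic term a = b = i never occurs, since
  -- an inversion has a < b.
  have key : ∀ a b, (if a < b ∧ σ b < σ a then
      Function.update e i (e i + 1) a * Function.update e i (e i + 1) b else 0) =
      (if a < b ∧ σ b < σ a then e a * e b else 0) +
        ((if a = i then (if i < b ∧ σ b < σ i then e b else 0) else 0) +
        (if b = i then (if a < i ∧ σ i < σ a then e a else 0) else 0)) := by
    intro a b
    by_cases ha : a = i
    · subst ha
      by_cases hb : b = a
      · subst hb; simp
      · simp only [Function.update_self, Function.update_of_ne hb, hb, if_true, if_false]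
        split_ifs <;> ring
    · by_cases hb : b = i
      · subst hb
        simp only [Function.update_self, Function.update_of_ne ha, ha, if_true, if_false]
        split_ifs <;> ring
      · simp [ha, hb, Function.update_of_ne]
  simp only [inversionSum, key, Finset.sum_add_distrib]
  rw [add_assoc, add_assoc]
  congr 1
  rw [Finset.sum_comm (f := fun a b => if a = i then (if i < b ∧ σ b < σ i then e b else 0) else 0)]
  simp only [Finset.sum_ite_eq', Finset.mem_univ, if_true]
  rw [← Finset.sum_add_distrib, ← Finset.sum_add_distrib]
  refine Finset.sum_congr rfl fun j _ => ?_
  -- Both sides count e j according to whether j and i form an inversion; where j precedes i before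
  -- and after, the contributions agree, and elsewhere they match modulo 2.
  rcases lt_trichotomy j i with h | rfl | h
  · rcases lt_trichotomy (σ j) (σ i) with h' | h' | h'
    · simp [h, h', h.not_gt, h'.not_gt]
    · exact absurd (σ.injective h') h.ne
    · simp [h, h', h.not_gt, h'.not_gt, zmod_two_add_self]
  · simp
  · rcases lt_trichotomy (σ j) (σ i) with h' | h' | h'
    · simp [h, h', h.not_gt, h'.not_gt]
    · exact absurd (σ.injective h') h.ne'
    · simp [h, h', h.not_gt, h'.not_gt]

/-! ### Homogeneous elements and the signed action of bijections -/

variable {k : Type u} [CommRing k] (X : CochainComplex (ModuleCat.{v} k) ℤ)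

/-- The homogeneous elements of degree `r` of `⨁ i, Xⁱ`. -/
def homog (r : ℤ) : Submodule k (Tot X) :=
  LinearMap.range (DirectSum.lof k ℤ (fun i => X.X i) r)

variable {X}

theorem lof_mem_homog (r : ℤ) (x : X.X r) :
    DirectSum.lof k ℤ (fun i => X.X i) r x ∈ homog X r := ⟨x, rfl⟩

theorem parityProj_of_mem {r : ℤ} {x : Tot X} (hx : x ∈ homog X r) (e : ZMod 2) :
    parityProj X e x = if (r : ZMod 2) = e then x else 0 := by
  obtain ⟨y, rfl⟩ := hx
  rw [parityProj, DirectSum.toModule_lof]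
  split_ifs <;> rfl

theorem totSign_of_mem {r : ℤ} {x : Tot X} (hx : x ∈ homog X r) :
    totSign X x = paritySign k (r : ZMod 2) • x := by
  obtain ⟨y, rfl⟩ := hx
  rw [totSign, DirectSum.toModule_lof, LinearMap.smul_apply, negOnePow_eq_paritySign]

theorem totD_lof (r : ℤ) (x : X.X r) :
    totD X (DirectSum.lof k ℤ (fun i => X.X i) r x) =
      DirectSum.lof k ℤ (fun i => X.X i) (r + 1) ((X.d r (r + 1)).hom x) := by
  rw [totD, DirectSum.toModule_lof]; rfl

theorem totD_mem {r : ℤ} {x : Tot X} (hx : x ∈ homog X r) : totD X x ∈ homog X (r + 1) := by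
  obtain ⟨y, rfl⟩ := hx
  rw [totD_lof]
  exact lof_mem_homog _ _

theorem totD_totD (x : Tot X) : totD X (totD X x) = 0 := by
  have : totD X ∘ₗ totD X = 0 := by
    refine DirectSum.linearMap_ext _ fun r => LinearMap.ext fun x => ?_
    simp only [LinearMap.comp_apply, totD_lof, LinearMap.zero_apply]
    have h : (X.d (r + 1) (r + 1 + 1)).hom ((X.d r (r + 1)).hom x) = 0 := by
      rw [← LinearMap.comp_apply, ← ModuleCat.hom_comp, X.d_comp_d]
      rfl
    rw [h, map_zero]
  exact LinearMap.congr_fun this x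

theorem span_homog :
    Submodule.span k (Set.range fun p : Σ r : ℤ, homog X r => (p.2 : Tot X)) = ⊤ := by
  rw [eq_top_iff]
  rintro x -
  induction x using DirectSum.induction_on with
  | zero => exact zero_mem _
  | of i x => exact Submodule.subset_span ⟨⟨i, ⟨_, lof_mem_homog i x⟩⟩, rfl⟩
  | add x y hx hy => exact add_mem hx hy

/-- Linear maps on a tensor power of `⨁ i, Xⁱ` agree if they agree on tensors of homogeneous
elements. -/
theorem ext_homog {ι : Type*} [Finite ι] {N : Type*} [AddCommMonoid N] [Module k N]
    {f g : (⨂[k] _ : ι, Tot X) →ₗ[k] N}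
    (h : ∀ (deg : ι → ℤ) (m : ι → Tot X), (∀ i, m i ∈ homog X (deg i)) →
      f (PiTensorProduct.tprod k m) = g (PiTensorProduct.tprod k m)) : f = g :=
  PiTensorProduct.ext_of_span_eq_top (g := fun _ (p : Σ r : ℤ, homog X r) => (p.2 : Tot X))
    (fun _ => span_homog) fun j => h (fun i => (j i).1) _ fun i => (j i).2.2

variable (X) in
/-- The Koszul-signed action of a bijection on tensor powers. -/
def bijAct {m n : ℕ} (σ : Fin m ≃ Fin n) : (⨂[k]^m (Tot X)) →ₗ[k] (⨂[k]^n (Tot X)) :=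
  ∑ e : Fin m → ZMod 2, paritySign k (inversionSum σ e) •
    ((PiTensorProduct.reindex k (fun _ : Fin m => Tot X) σ).toLinearMap ∘ₗ
      PiTensorProduct.map fun i => parityProj X (e i))

/-- Working with bijections between different `Fin m` and `Fin n` puts permutations, casts along m =
n and the block flip in one calculus. -/
theorem permAct_eq_bijAct {n : ℕ} (σ : Equiv.Perm (Fin n)) : permAct X σ = bijAct X σ := by
  simp only [permAct, bijAct, koszulSign_eq, intCast_paritySign]

theorem bijAct_tprod {m n : ℕ} (σ : Fin m ≃ Fin n) {deg : Fin m → ℤ} {x : Fin m → Tot X}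
    (hx : ∀ i, x i ∈ homog X (deg i)) :
    bijAct X σ (PiTensorProduct.tprod k x) =
      paritySign k (inversionSum σ fun i => (deg i : ZMod 2)) •
        PiTensorProduct.tprod k (x ∘ σ.symm) := by
  have key : ∀ e : Fin m → ZMod 2, (fun i => parityProj X (e i) (x i)) = fun i =>
        if (deg i : ZMod 2) = e i then x i else 0 :=
    fun e => funext fun i => parityProj_of_mem (hx i) _
  rw [bijAct, LinearMap.sum_apply, Finset.sum_eq_single fun i => (deg i : ZMod 2)]
  · rw [LinearMap.smul_apply, LinearMap.comp_apply, PiTensorProduct.map_tprod, key]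
    simp only [if_true, LinearEquiv.coe_coe, PiTensorProduct.reindex_tprod]
    rfl
  · intro e _ he
    rw [LinearMap.smul_apply, LinearMap.comp_apply, PiTensorProduct.map_tprod, key]
    obtain ⟨i, hi⟩ : ∃ i, (deg i : ZMod 2) ≠ e i := by
      by_contra! H
      exact he (funext fun i => (H i).symm)
    rw [MultilinearMap.map_coord_zero _ i (if_neg hi), map_zero, smul_zero]
  · exact fun h => absurd (Finset.mem_univ _) h

theorem bijAct_trans {l m n : ℕ} (σ : Fin l ≃ Fin m) (τ : Fin m ≃ Fin n) (x : ⨂[k]^l (Tot X)) :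
    bijAct X (σ.trans τ) x = bijAct X τ (bijAct X σ x) := by
  suffices bijAct X (σ.trans τ) = bijAct X τ ∘ₗ bijAct X σ from LinearMap.congr_fun this x
  refine ext_homog fun deg m hm => ?_
  rw [LinearMap.comp_apply, bijAct_tprod _ hm, bijAct_tprod _ hm, map_smul,
    bijAct_tprod (deg := deg ∘ σ.symm) (x := m ∘ σ.symm) _ (fun i => hm _),
    inversionSum_trans, paritySign_add, mul_smul]
  rfl

theorem bijAct_mul {n : ℕ} (σ τ : Equiv.Perm (Fin n)) (x : ⨂[k]^n (Tot X)) :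
    bijAct X (σ * τ) x = bijAct X σ (bijAct X τ x) := bijAct_trans τ σ x

theorem bijAct_of_strictMono {m n : ℕ} {σ : Fin m ≃ Fin n} (h : StrictMono σ) :
    bijAct X σ = (PiTensorProduct.reindex k (fun _ : Fin m => Tot X) σ).toLinearMap := by
  refine ext_homog fun deg m hm => ?_
  rw [bijAct_tprod _ hm, inversionSum_of_strictMono h, paritySign_zero, one_smul]
  exact (PiTensorProduct.reindex_tprod (R := k) (s := fun _ => Tot X) σ m).symm

theorem bijAct_one {n : ℕ} (x : ⨂[k]^n (Tot X)) : bijAct X (1 : Equiv.Perm (Fin n)) x = x := by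
  rw [bijAct_of_strictMono (σ := 1) strictMono_id]
  change PiTensorProduct.reindex k (fun _ : Fin n => Tot X) (Equiv.refl _) x = x
  rw [PiTensorProduct.reindex_refl]; rfl

theorem bijAct_finCongr {m n : ℕ} (h : m = n) (x : ⨂[k]^m (Tot X)) :
    bijAct X (finCongr h) x = TensorPower.cast k (Tot X) h x := by
  rw [bijAct_of_strictMono (σ := finCongr h) (fun _ _ h => h)]; rfl

theorem lof_cast {m n : ℕ} (h : m = n) (x : ⨂[k]^m (Tot X)) :
    DirectSum.lof k ℕ (fun n => ⨂[k]^n (Tot X)) n (TensorPower.cast k (Tot X) h x) =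
      DirectSum.lof k ℕ (fun n => ⨂[k]^n (Tot X)) m x := by
  subst h; simp

end

end ShuffleAlg

namespace ShuffleAlg

noncomputable section

variable {k : Type u} [CommRing k] {X : CochainComplex (ModuleCat.{v} k) ℤ}

/-! ### Concatenation of tensors -/

theorem castAdd_lt_castAdd {m n : ℕ} (i j : Fin m) : Fin.castAdd n i < Fin.castAdd n j ↔ i < j :=
  Iff.rfl

theorem castAdd_lt_natAdd {m n : ℕ} (i : Fin m) (j : Fin n) : Fin.castAdd n i < Fin.natAdd m j := by
  simp only [Fin.lt_def, Fin.val_castAdd, Fin.val_natAdd]; omega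

theorem not_natAdd_lt_castAdd {m n : ℕ} (i : Fin m) (j : Fin n) :
    ¬ Fin.natAdd m j < Fin.castAdd n i := (castAdd_lt_natAdd i j).not_gt

variable (X) in
/-- The tensor product `Tᵐ(X) × Tⁿ(X) → Tᵐ⁺ⁿ(X)`. -/
def conc (m n : ℕ) : (⨂[k]^m (Tot X)) →ₗ[k] (⨂[k]^n (Tot X)) →ₗ[k] (⨂[k]^(m + n) (Tot X)) :=
  (TensorProduct.mk k (⨂[k]^m (Tot X)) (⨂[k]^n (Tot X))).compr₂ TensorPower.mulEquiv.toLinearMap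

theorem conc_tprod {m n : ℕ} (a : Fin m → Tot X) (b : Fin n → Tot X) :
    conc X m n (PiTensorProduct.tprod k a) (PiTensorProduct.tprod k b) =
      PiTensorProduct.tprod k (Fin.append a b) :=
  TensorPower.tprod_mul_tprod k a b

theorem conc_assoc {l m n : ℕ} (x : ⨂[k]^l (Tot X)) (y : ⨂[k]^m (Tot X)) (z : ⨂[k]^n (Tot X)) :
    TensorPower.cast k (Tot X) (add_assoc l m n) (conc X (l + m) n (conc X l m x y) z) =
      conc X l (m + n) x (conc X m n y z) :=
  TensorPower.mul_assoc x y z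

theorem one_conc {n : ℕ} (x : ⨂[k]^n (Tot X)) :
    TensorPower.cast k (Tot X) (zero_add n)
      (conc X 0 n (PiTensorProduct.tprod k Fin.elim0) x) = x :=
  TensorPower.one_mul x

theorem conc_one {n : ℕ} (x : ⨂[k]^n (Tot X)) :
    TensorPower.cast k (Tot X) (add_zero n)
      (conc X n 0 x (PiTensorProduct.tprod k Fin.elim0)) = x :=
  TensorPower.mul_one x

theorem append_mem_homog {m n : ℕ} {deg : Fin m → ℤ} {deg' : Fin n → ℤ} {a : Fin m → Tot X}
    {b : Fin n → Tot X} (ha : ∀ i, a i ∈ homog X (deg i)) (hb : ∀ i, b i ∈ homog X (deg' i))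
    (i : Fin (m + n)) : Fin.append a b i ∈ homog X (Fin.append deg deg' i) := by
  induction i using Fin.addCases with
  | left i => simpa using ha i
  | right i => simpa using hb i

theorem ext_homog₂ {m n : ℕ} {N : Type*} [AddCommMonoid N] [Module k N]
    {f g : (⨂[k]^m (Tot X)) →ₗ[k] (⨂[k]^n (Tot X)) →ₗ[k] N}
    (h : ∀ (deg : Fin m → ℤ) (deg' : Fin n → ℤ) (a : Fin m → Tot X) (b : Fin n → Tot X),
      (∀ i, a i ∈ homog X (deg i)) → (∀ i, b i ∈ homog X (deg' i)) →
      f (PiTensorProduct.tprod k a) (PiTensorProduct.tprod k b) =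
        g (PiTensorProduct.tprod k a) (PiTensorProduct.tprod k b)) : f = g :=
  ext_homog fun deg a ha => ext_homog fun deg' b hb => h deg deg' a b ha hb

/-- The juxtaposition of two bijections. -/
def finSum {m m' n n' : ℕ} (σ : Fin m ≃ Fin m') (τ : Fin n ≃ Fin n') :
    Fin (m + n) ≃ Fin (m' + n') :=
  finSumFinEquiv.symm.trans ((σ.sumCongr τ).trans finSumFinEquiv)

@[simp] theorem finSum_castAdd {m m' n n' : ℕ} (σ : Fin m ≃ Fin m') (τ : Fin n ≃ Fin n')
    (i : Fin m) : finSum σ τ (Fin.castAdd n i) = Fin.castAdd n' (σ i) := by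
  simp [finSum]

@[simp] theorem finSum_natAdd {m m' n n' : ℕ} (σ : Fin m ≃ Fin m') (τ : Fin n ≃ Fin n')
    (i : Fin n) : finSum σ τ (Fin.natAdd m i) = Fin.natAdd m' (τ i) := by
  simp [finSum]

theorem cast_append {m n : ℕ} (deg : Fin m → ℤ) (deg' : Fin n → ℤ) :
    (fun i => ((Fin.append deg deg' i : ℤ) : ZMod 2)) =
      Fin.append (fun i => (deg i : ZMod 2)) fun i => (deg' i : ZMod 2) := by
  funext i
  induction i using Fin.addCases <;> simp

/-- No inversion involves elements of both blocks. -/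
theorem inversionSum_finSum {m m' n n' : ℕ} (σ : Fin m ≃ Fin m') (τ : Fin n ≃ Fin n')
    (e : Fin m → ZMod 2) (e' : Fin n → ZMod 2) :
    inversionSum (finSum σ τ) (Fin.append e e') = inversionSum σ e + inversionSum τ e' := by
  simp [inversionSum, Fin.sum_univ_add, castAdd_lt_castAdd,
    castAdd_lt_natAdd, not_natAdd_lt_castAdd]

@[simp] theorem finSum_symm {m m' n n' : ℕ} (σ : Fin m ≃ Fin m') (τ : Fin n ≃ Fin n') :
    (finSum σ τ).symm = finSum σ.symm τ.symm := rfl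

theorem bijAct_finSum_conc {m m' n n' : ℕ} (σ : Fin m ≃ Fin m') (τ : Fin n ≃ Fin n')
    (x : ⨂[k]^m (Tot X)) (y : ⨂[k]^n (Tot X)) :
    bijAct X (finSum σ τ) (conc X m n x y) = conc X m' n' (bijAct X σ x) (bijAct X τ y) := by
  suffices (conc X m n).compr₂ (bijAct X (finSum σ τ)) =
      (conc X m' n').compl₁₂ (bijAct X σ) (bijAct X τ) from
    LinearMap.congr_fun₂ this x y
  refine ext_homog₂ fun deg deg' a b ha hb => ?_
  rw [LinearMap.compr₂_apply, LinearMap.compl₁₂_apply, conc_tprod,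
    bijAct_tprod _ (append_mem_homog ha hb), bijAct_tprod _ ha, bijAct_tprod _ hb, cast_append,
    inversionSum_finSum, paritySign_add, map_smul, map_smul, LinearMap.smul_apply, conc_tprod,
    smul_smul, mul_comm]
  congr 2
  funext i
  induction i using Fin.addCases <;> simp

/-- The inversions are exactly the pairs with one element in each block, so the sum factors. -/
theorem inversionSum_finAddFlip {m n : ℕ} (e : Fin m → ZMod 2) (e' : Fin n → ZMod 2) :
    inversionSum finAddFlip (Fin.append e e') = (∑ i, e i) * ∑ j, e' j := by
  simp [inversionSum, Fin.sum_univ_add, castAdd_lt_castAdd,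
    castAdd_lt_natAdd, not_natAdd_lt_castAdd, Finset.sum_mul_sum]
  have h1 : ∀ i j : Fin m, ¬ (i < j ∧ j < i) := fun i j h => h.1.not_gt h.2
  have h2 : ∀ i j : Fin n, ¬ (i < j ∧ j < i) := fun i j h => h.1.not_gt h.2
  simp [h1, h2]

/-! ### Homogeneous tensors -/

theorem tprod_mem_powGr {n : ℕ} {deg : Fin n → ℤ} {m : Fin n → Tot X}
    (hm : ∀ i, m i ∈ homog X (deg i)) :
    PiTensorProduct.tprod k m ∈ powGr X n (∑ i, deg i) := by
  choose x hx using hm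
  exact Submodule.subset_span ⟨deg, x, rfl, by simp only [hx]⟩

theorem powGr_le {n : ℕ} {r : ℤ} {N : Submodule k (⨂[k]^n (Tot X))}
    (h : ∀ (deg : Fin n → ℤ) (m : Fin n → Tot X), (∀ i, m i ∈ homog X (deg i)) →
      ∑ i, deg i = r → PiTensorProduct.tprod k m ∈ N) : powGr X n r ≤ N := by
  refine Submodule.span_le.2 ?_
  rintro _ ⟨deg, x, hr, rfl⟩
  exact h deg _ (fun i => lof_mem_homog _ _) hr

theorem bijAct_mem_powGr {m n : ℕ} (σ : Fin m ≃ Fin n) {r : ℤ} {x : ⨂[k]^m (Tot X)}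
    (hx : x ∈ powGr X m r) : bijAct X σ x ∈ powGr X n r := by
  suffices powGr X m r ≤ (powGr X n r).comap (bijAct X σ) from this hx
  refine powGr_le fun deg a ha hr => ?_
  rw [Submodule.mem_comap, bijAct_tprod σ ha]
  refine Submodule.smul_mem _ _ ?_
  rw [← hr, ← σ.symm.sum_comp]
  exact tprod_mem_powGr (deg := fun i => deg (σ.symm i)) fun i => ha _

theorem conc_mem_powGr {m n : ℕ} {r s : ℤ} {x : ⨂[k]^m (Tot X)} {y : ⨂[k]^n (Tot X)}
    (hx : x ∈ powGr X m r) (hy : y ∈ powGr X n s) : conc X m n x y ∈ powGr X (m + n) (r + s) := by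
  suffices powGr X m r ≤ (powGr X (m + n) (r + s)).comap ((conc X m n).flip y) from this hx
  refine powGr_le fun deg a ha hr => ?_
  suffices powGr X n s ≤ (powGr X (m + n) (r + s)).comap
    (conc X m n (PiTensorProduct.tprod k a)) from this hy
  refine powGr_le fun deg' b hb hs => ?_
  rw [Submodule.mem_comap, conc_tprod]
  convert tprod_mem_powGr (append_mem_homog ha hb) using 1
  simp [Fin.sum_univ_add, hr, hs]

theorem bijAct_finAddFlip_conc {m n : ℕ} {r s : ℤ} {x : ⨂[k]^m (Tot X)} {y : ⨂[k]^n (Tot X)}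
    (hx : x ∈ powGr X m r) (hy : y ∈ powGr X n s) :
    bijAct X finAddFlip (conc X m n x y) =
      paritySign k ((r * s : ℤ) : ZMod 2) • conc X n m y x := by
  suffices powGr X m r ≤ LinearMap.eqLocus (bijAct X finAddFlip ∘ₗ (conc X m n).flip y)
    (paritySign k ((r * s : ℤ) : ZMod 2) • conc X n m y) from this hx
  refine powGr_le fun deg a ha hr => ?_
  suffices powGr X n s ≤ LinearMap.eqLocus
    (bijAct X finAddFlip ∘ₗ conc X m n (PiTensorProduct.tprod k a))
    (paritySign k ((r * s : ℤ) : ZMod 2) • (conc X n m).flip (PiTensorProduct.tprod k a)) from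
      this hy
  refine powGr_le fun deg' b hb hs => ?_
  rw [LinearMap.mem_eqLocus]
  simp only [LinearMap.comp_apply, LinearMap.smul_apply, LinearMap.flip_apply, conc_tprod]
  rw [bijAct_tprod _ (append_mem_homog ha hb), cast_append, inversionSum_finAddFlip, ← hr, ← hs]
  push_cast
  congr 2
  funext i
  have h : (finAddFlip (m := m) (n := n)).symm = finAddFlip (m := n) (n := m) := by
    refine Equiv.ext fun i => (Equiv.symm_apply_eq _).2 ?_
    induction i using Fin.addCases <;> simp
  rw [h]
  induction i using Fin.addCases <;> simp

/-! ### The differential -/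

variable (X) in
/-- The summand of the differential which applies `d` to the factor `i`. -/
def powDTerm {n : ℕ} (i : Fin n) : (⨂[k]^n (Tot X)) →ₗ[k] (⨂[k]^n (Tot X)) :=
  PiTensorProduct.map fun j =>
    if j < i then totSign X else if j = i then totD X else LinearMap.id

theorem powD_eq_sum (n : ℕ) : powD X n = ∑ i, powDTerm X i := rfl

theorem powDTerm_tprod {n : ℕ} (i : Fin n) {deg : Fin n → ℤ} {m : Fin n → Tot X}
    (hm : ∀ i, m i ∈ homog X (deg i)) :
    powDTerm X i (PiTensorProduct.tprod k m) =
      paritySign k (∑ j, if j < i then (deg j : ZMod 2) else 0) •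
        PiTensorProduct.tprod k (Function.update m i (totD X (m i))) := by
  rw [powDTerm, PiTensorProduct.map_tprod, paritySign_sum, ← MultilinearMap.map_smul_univ]
  congr 1
  funext j
  rcases lt_trichotomy j i with h | rfl | h
  · simp [h, h.ne, totSign_of_mem (hm j)]
  · simp
  · simp [h.not_gt, h.ne']

theorem update_totD_mem {n : ℕ} (i : Fin n) {deg : Fin n → ℤ} {m : Fin n → Tot X}
    (hm : ∀ i, m i ∈ homog X (deg i)) (j : Fin n) :
    Function.update m i (totD X (m i)) j ∈ homog X (Function.update deg i (deg i + 1) j) := by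
  by_cases h : j = i
  · subst h; simpa using totD_mem (hm j)
  · simpa [h] using hm j

theorem cast_update {n : ℕ} (i : Fin n) (deg : Fin n → ℤ) :
    (fun j => ((Function.update deg i (deg i + 1) j : ℤ) : ZMod 2)) =
      Function.update (fun j => (deg j : ZMod 2)) i ((deg i : ZMod 2) + 1) := by
  funext j
  by_cases h : j = i
  · subst h; simp
  · simp [h]

/-- Applying d at i raises the parity there and brings the sign of the factors preceding i; after
moving, the sign comes from the factors preceding `σ i`. `inversionSum_update` is exactly this
balance. -/
theorem bijAct_powDTerm {m n : ℕ} (σ : Fin m ≃ Fin n) (i : Fin m) (x : ⨂[k]^m (Tot X)) :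
    bijAct X σ (powDTerm X i x) = powDTerm X (σ i) (bijAct X σ x) := by
  suffices bijAct X σ ∘ₗ powDTerm X i = powDTerm X (σ i) ∘ₗ bijAct X σ from
    LinearMap.congr_fun this x
  refine ext_homog fun deg a ha => ?_
  rw [LinearMap.comp_apply, LinearMap.comp_apply, powDTerm_tprod i ha, map_smul,
    bijAct_tprod σ (update_totD_mem i ha), bijAct_tprod σ ha, map_smul,
    powDTerm_tprod (deg := deg ∘ σ.symm) (m := a ∘ σ.symm) _ (fun i => ha _), smul_smul, smul_smul,
    ← paritySign_add, ← paritySign_add, cast_update, add_comm, inversionSum_update,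
    ← σ.sum_comp (fun j => if j < σ i then (((deg ∘ σ.symm) j : ℤ) : ZMod 2) else 0)]
  simp only [Function.comp_apply, Equiv.symm_apply_apply]
  congr 2
  funext j
  obtain ⟨j, rfl⟩ := σ.surjective j
  by_cases h : j = i
  · subst h; simp
  · simp [h]

theorem bijAct_powD {m n : ℕ} (σ : Fin m ≃ Fin n) (x : ⨂[k]^m (Tot X)) :
    bijAct X σ (powD X m x) = powD X n (bijAct X σ x) := by
  simp only [powD_eq_sum, LinearMap.sum_apply, map_sum, bijAct_powDTerm]
  exact σ.sum_comp fun i => powDTerm X i (bijAct X σ x)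

theorem powD_mem_powGr {n : ℕ} {r : ℤ} {x : ⨂[k]^n (Tot X)} (hx : x ∈ powGr X n r) :
    powD X n x ∈ powGr X n (r + 1) := by
  suffices powGr X n r ≤ (powGr X n (r + 1)).comap (powD X n) from this hx
  refine powGr_le fun deg a ha hr => ?_
  rw [Submodule.mem_comap, powD_eq_sum, LinearMap.sum_apply]
  refine Submodule.sum_mem _ fun i _ => ?_
  rw [powDTerm_tprod i ha]
  refine Submodule.smul_mem _ _ ?_
  convert tprod_mem_powGr (update_totD_mem i ha) using 2
  rw [Finset.sum_update_of_mem (Finset.mem_univ i), ← hr,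
    ← Finset.add_sum_erase _ _ (Finset.mem_univ i), Finset.erase_eq]
  exact add_right_comm _ _ _

/-- Diagonal terms vanish by d² = 0. Off the diagonal, applying d at j first changes the sign picked
up at i exactly when j < i, so the two orders are opposite. -/
theorem powD_powD {n : ℕ} (x : ⨂[k]^n (Tot X)) : powD X n (powD X n x) = 0 := by
  suffices powD X n ∘ₗ powD X n = 0 from LinearMap.congr_fun this x
  refine ext_homog fun deg a ha => ?_
  simp only [powD_eq_sum, LinearMap.comp_apply, LinearMap.sum_apply, map_sum, LinearMap.zero_apply]
  have key : ∀ i j, powDTerm X i (powDTerm X j (PiTensorProduct.tprod k a)) =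
      paritySign k ((∑ l, if l < i then (deg l : ZMod 2) else 0) +
        (∑ l, if l < j then (deg l : ZMod 2) else 0) + if j < i then 1 else 0) •
      PiTensorProduct.tprod k (Function.update (Function.update a j (totD X (a j))) i
        (totD X (Function.update a j (totD X (a j)) i))) := by
    intro i j
    -- The inner d raised the degree at j by one, which the outer sign sees only for j < i.
    have h : (∑ l, if l < i then ((Function.update deg j (deg j + 1) l : ℤ) : ZMod 2) else 0) =
        (∑ l, if l < i then (deg l : ZMod 2) else 0) + if j < i then 1 else 0 := by
      rw [← Finset.sum_ite_eq' Finset.univ j (fun l => if l < i then (1 : ZMod 2) else 0) |>.trans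
        (if_pos (Finset.mem_univ j)), ← Finset.sum_add_distrib]
      refine Finset.sum_congr rfl fun l _ => ?_
      by_cases hl : l = j
      · subst hl; by_cases h : l < i <;> simp [h]
      · simp [hl]
    rw [powDTerm_tprod j ha, map_smul, powDTerm_tprod i (update_totD_mem j ha), smul_smul,
      ← paritySign_add, h]
    congr 2
    abel
  refine sum_sum_eq_zero_of_symm _ (fun i => ?_) fun i j => ?_
  · rw [key]
    simp only [Function.update_self, totD_totD, Function.update_idem]
    rw [MultilinearMap.map_update_zero, smul_zero]
  · rw [key, key]
    by_cases hij : i = j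
    · subst hij
      simp only [Function.update_self, totD_totD, Function.update_idem]
      rw [MultilinearMap.map_update_zero, smul_zero, add_zero]
    · rw [Function.update_of_ne hij, Function.update_of_ne (Ne.symm hij),
        Function.update_comm hij, ← add_smul]
      rcases lt_or_gt_of_ne hij with h | h
      · simp [h, h.not_gt, paritySign_add, mul_comm]
      · simp [h, h.not_gt, paritySign_add, mul_comm]

theorem append_update_left {α : Type*} {m n : ℕ} (a : Fin m → α) (b : Fin n → α) (i : Fin m)
    (c : α) : Fin.append (Function.update a i c) b =
      Function.update (Fin.append a b) (Fin.castAdd n i) c := by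
  funext j
  induction j using Fin.addCases with
  | left j =>
    by_cases h : j = i
    · subst h; simp
    · have h' : Fin.castAdd n j ≠ Fin.castAdd n i := by simpa using h
      simp [h, h']
  | right j =>
    have h' : Fin.natAdd m j ≠ Fin.castAdd n i := (castAdd_lt_natAdd i j).ne'
    simp [h']

theorem append_update_right {α : Type*} {m n : ℕ} (a : Fin m → α) (b : Fin n → α) (i : Fin n)
    (c : α) : Fin.append a (Function.update b i c) =
      Function.update (Fin.append a b) (Fin.natAdd m i) c := by
  funext j
  induction j using Fin.addCases with
  | left j =>
    have h' : Fin.castAdd n j ≠ Fin.natAdd m i := (castAdd_lt_natAdd j i).ne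
    simp [h']
  | right j =>
    by_cases h : j = i
    · subst h; simp
    · have h' : Fin.natAdd m j ≠ Fin.natAdd m i := by simpa using h
      simp [h, h']

/-- The summands acting on `y` have all of `x` in front of them, whence the sign (-1)^r. -/
theorem powD_conc {m n : ℕ} {r : ℤ} {x : ⨂[k]^m (Tot X)} (hx : x ∈ powGr X m r)
    (y : ⨂[k]^n (Tot X)) :
    powD X (m + n) (conc X m n x y) = conc X m n (powD X m x) y +
      paritySign k (r : ZMod 2) • conc X m n x (powD X n y) := by
  suffices powGr X m r ≤ LinearMap.eqLocus (powD X (m + n) ∘ₗ (conc X m n).flip y)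
    ((conc X m n).flip y ∘ₗ powD X m +
      paritySign k (r : ZMod 2) • (conc X m n).flip (powD X n y)) from this hx
  refine powGr_le fun deg a ha hr => ?_
  suffices powD X (m + n) ∘ₗ (conc X m n (PiTensorProduct.tprod k a)) =
    conc X m n (powD X m (PiTensorProduct.tprod k a)) +
      paritySign k (r : ZMod 2) • conc X m n (PiTensorProduct.tprod k a) ∘ₗ powD X n from
    LinearMap.congr_fun this y
  refine ext_homog fun deg' b hb => ?_
  simp only [LinearMap.comp_apply, LinearMap.add_apply, LinearMap.smul_apply, conc_tprod,
    powD_eq_sum, LinearMap.sum_apply, map_sum, Fin.sum_univ_add, Finset.smul_sum]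
  congr 1
  · refine Finset.sum_congr rfl fun i _ => ?_
    rw [powDTerm_tprod _ ha, powDTerm_tprod _ (append_mem_homog ha hb), map_smul,
      LinearMap.smul_apply, conc_tprod, append_update_left, Fin.append_left]
    congr 2
    simp [Fin.sum_univ_add, castAdd_lt_castAdd, not_natAdd_lt_castAdd]
  · refine Finset.sum_congr rfl fun i _ => ?_
    rw [powDTerm_tprod _ hb, powDTerm_tprod _ (append_mem_homog ha hb), map_smul, conc_tprod,
      append_update_right, Fin.append_right, smul_smul, ← paritySign_add]
    congr 2
    simp [Fin.sum_univ_add, castAdd_lt_natAdd, ← hr]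

end

end ShuffleAlg

namespace ShuffleAlg

noncomputable section

/-! ### Permutations which are increasing on the fibres of a map -/

/-- `σ` is increasing on every fibre of `f`. -/
def FiberMono {N M : ℕ} {L : Type*} (f : Fin N → L) (σ : Fin N ≃ Fin M) : Prop :=
  ∀ i j, i < j → f i = f j → σ i < σ j

theorem FiberMono.lt_iff {N M : ℕ} {L : Type*} {f : Fin N → L} {σ : Fin N ≃ Fin M}
    (h : FiberMono f σ) {i j : Fin N} (hij : f i = f j) : σ i < σ j ↔ i < j := by
  refine ⟨fun H => ?_, fun H => h i j H hij⟩
  rcases lt_trichotomy i j with h' | rfl | h'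
  · exact h'
  · exact absurd H (lt_irrefl _)
  · exact absurd H (h j i h' hij.symm).not_gt

/-- Such a permutation restricts to an increasing self-bijection of each finite fibre. -/
theorem eq_one_of_fiberMono {N : ℕ} {L : Type*} {f : Fin N → L} {σ : Equiv.Perm (Fin N)}
    (h : FiberMono f σ) (hf : ∀ i, f (σ i) = f i) : σ = 1 := by
  refine Equiv.ext fun i => ?_
  induction i using WellFoundedLT.induction with
  | ind i ih =>
    by_contra hne
    obtain ⟨l, hl⟩ := σ.surjective i
    rcases lt_trichotomy (σ i) i with h' | h' | h'
    · exact h'.ne (σ.injective (ih _ h'))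
    · exact hne h'
    · rcases lt_trichotomy l i with h'' | rfl | h''
      · exact h''.ne (((ih _ h'').symm.trans hl))
      · exact h'.ne' hl
      · exact (h i l h'' (by rw [← hf l, hl])).not_gt (hl ▸ h')

/-- Choose in the coset of `σ` the element whose word of values is lexicographically smallest. A
descent inside a fibre could be swapped away, giving a smaller word in the same coset. -/
theorem exists_fiberMono_mul {N : ℕ} {L : Type*} (f : Fin N → L) (σ : Equiv.Perm (Fin N)) :
    ∃ α β : Equiv.Perm (Fin N), σ = α * β ∧ FiberMono f α ∧ ∀ i, f (β i) = f i := by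
  classical
  obtain ⟨β, hβ, hmin⟩ := Finset.exists_min_image
    {β : Equiv.Perm (Fin N) | ∀ i, f (β i) = f i} (fun β => toLex (⇑(σ * β)))
    ⟨1, by simp⟩
  simp only [Finset.mem_filter, Finset.mem_univ, true_and] at hβ hmin
  refine ⟨σ * β, β⁻¹, by simp, fun i j hij hf => ?_, fun i => ?_⟩
  · by_contra! hle
    have hlt : (σ * β) j < (σ * β) i := lt_of_le_of_ne hle fun h => hij.ne' ((σ * β).injective h)
    refine (hmin (β * Equiv.swap i j) fun l => ?_).not_gt (Pi.lex_desc hij.le hlt)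
    rw [Equiv.Perm.mul_apply, hβ]
    by_cases h1 : l = i
    · subst h1; simpa using hf.symm
    · by_cases h2 : l = j
      · subst h2; simpa using hf
      · rw [Equiv.swap_apply_of_ne_of_ne h1 h2]
  · rw [← hβ]; simp

/-- The two representatives differ by a permutation preserving the fibres; comparing orders through
`α'` shows that it is increasing on them, hence trivial. -/
theorem fiberMono_mul_unique {N : ℕ} {L : Type*} {f : Fin N → L} {α α' β β' : Equiv.Perm (Fin N)}
    (hα : FiberMono f α) (hα' : FiberMono f α') (hβ : ∀ i, f (β i) = f i)
    (hβ' : ∀ i, f (β' i) = f i) (h : α * β = α' * β') : α = α' ∧ β = β' := by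
  have hinv : ∀ i, f (β⁻¹ i) = f i := fun i => by rw [← hβ]; simp
  have hδ : ∀ i, f ((β' * β⁻¹) i) = f i := fun i => by
    rw [Equiv.Perm.mul_apply, hβ', hinv]
  have hα2 : α = α' * (β' * β⁻¹) := by rw [← mul_assoc, ← h]; simp
  have h1 : β' * β⁻¹ = 1 := by
    refine eq_one_of_fiberMono (f := f) (fun i j hij hf => ?_) hδ
    rw [← hα'.lt_iff (by rw [hδ, hδ, hf])]
    have := hα i j hij hf
    rwa [hα2] at this
  have h2 : β' = β := mul_inv_eq_one.1 h1
  subst h2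
  exact ⟨mul_right_cancel h, rfl⟩

/-! ### Shuffles of two blocks and the Young subgroup -/

/-- The side of the element `i` of a sum of two blocks. -/
def side (m n : ℕ) : Fin (m + n) → Bool := Fin.append (fun _ => false) fun _ => true

@[simp] theorem side_castAdd {m n : ℕ} (i : Fin m) : side m n (Fin.castAdd n i) = false := by
  simp [side]

@[simp] theorem side_natAdd {m n : ℕ} (i : Fin n) : side m n (Fin.natAdd m i) = true := by
  simp [side]

theorem isShuffle_iff {m n : ℕ} (σ : Equiv.Perm (Fin (m + n))) :
    IsShuffle m n σ ↔ FiberMono (side m n) σ := by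
  constructor
  · rintro ⟨h1, h2⟩ i j hij hf
    induction i using Fin.addCases with
    | left i =>
      induction j using Fin.addCases with
      | left j => exact h1 hij
      | right j => simp at hf
    | right i =>
      induction j using Fin.addCases with
      | left j => simp at hf
      | right j => exact h2 (by simpa using hij)
  · intro h
    exact ⟨fun i j hij => h _ _ hij (by simp), fun i j hij => h _ _ (by simpa using hij) (by simp)⟩

theorem fiberMono_finAddFlip (m n : ℕ) :
    FiberMono (side m n) (finAddFlip : Fin (m + n) ≃ Fin (n + m)) := by
  intro i j hij hf
  induction i using Fin.addCases <;> induction j using Fin.addCases <;>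
    simp_all [castAdd_lt_castAdd]

theorem side_finAddFlip {m n : ℕ} (i : Fin (m + n)) :
    side n m (finAddFlip i) = !side m n i := by
  induction i using Fin.addCases <;> simp

theorem finAddFlip_finAddFlip {m n : ℕ} (i : Fin (m + n)) : finAddFlip (finAddFlip i) = i := by
  induction i using Fin.addCases <;> simp

theorem side_finSum {m n : ℕ} (α : Equiv.Perm (Fin m)) (β : Equiv.Perm (Fin n)) (i : Fin (m + n)) :
    side m n (finSum α β i) = side m n i := by
  induction i using Fin.addCases <;> simp

/-- Only the left block has to be checked: a permutation of a finite set that maps it into itself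
also preserves its complement. -/
theorem exists_finSum {m n : ℕ} (β : Equiv.Perm (Fin (m + n)))
    (h : ∀ i, side m n (β i) = side m n i) :
    ∃ (β₁ : Equiv.Perm (Fin m)) (β₂ : Equiv.Perm (Fin n)), β = finSum β₁ β₂ := by
  have hr := Equiv.Perm.mem_sumCongrHom_range_of_perm_mapsTo_inl
    (σ := (finSumFinEquiv.trans β).trans finSumFinEquiv.symm) (by
      rintro _ ⟨i, rfl⟩
      have := h (Fin.castAdd n i)
      simp only [Equiv.trans_apply, finSumFinEquiv_apply_left]
      generalize β (Fin.castAdd n i) = j at this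
      induction j using Fin.addCases with
      | left j => simp
      | right j => simp at this)
  obtain ⟨⟨β₁, β₂⟩, hβ⟩ := hr
  refine ⟨β₁, β₂, Equiv.ext fun i => ?_⟩
  have := Equiv.congr_fun hβ (finSumFinEquiv.symm i)
  simp only [Equiv.trans_apply, Equiv.apply_symm_apply] at this
  rw [Equiv.eq_symm_apply] at this
  rw [← this]
  rfl

theorem finSum_injective {m n : ℕ} {α α' : Equiv.Perm (Fin m)} {β β' : Equiv.Perm (Fin n)}
    (h : finSum α β = finSum α' β') : α = α' ∧ β = β' := by
  constructor
  · refine Equiv.ext fun i => ?_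
    have := Equiv.congr_fun h (Fin.castAdd n i)
    simpa using this
  · refine Equiv.ext fun i => ?_
    have := Equiv.congr_fun h (Fin.natAdd m i)
    simpa using this

/-- The labelling of a sum of two labelled blocks. -/
def sumLabel {m n : ℕ} {L L' : Type*} (f : Fin m → L) (g : Fin n → L') : Fin (m + n) → L ⊕ L' :=
  Fin.append (Sum.inl ∘ f) (Sum.inr ∘ g)

@[simp] theorem sumLabel_castAdd {m n : ℕ} {L L' : Type*} (f : Fin m → L) (g : Fin n → L')
    (i : Fin m) : sumLabel f g (Fin.castAdd n i) = Sum.inl (f i) := by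
  simp [sumLabel]

@[simp] theorem sumLabel_natAdd {m n : ℕ} {L L' : Type*} (f : Fin m → L) (g : Fin n → L')
    (i : Fin n) : sumLabel f g (Fin.natAdd m i) = Sum.inr (g i) := by
  simp [sumLabel]

theorem side_eq_of_sumLabel_eq {m n : ℕ} {L L' : Type*} {f : Fin m → L} {g : Fin n → L'}
    {i j : Fin (m + n)} (h : sumLabel f g i = sumLabel f g j) : side m n i = side m n j := by
  induction i using Fin.addCases <;> induction j using Fin.addCases <;> simp_all

theorem fiberMono_sumLabel_finSum {m n : ℕ} {L L' : Type*} {f : Fin m → L} {g : Fin n → L'}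
    {α : Equiv.Perm (Fin m)} {β : Equiv.Perm (Fin n)} :
    FiberMono (sumLabel f g) (finSum α β) ↔ FiberMono f α ∧ FiberMono g β := by
  constructor
  · intro h
    refine ⟨fun i j hij hf => ?_, fun i j hij hf => ?_⟩
    · simpa [castAdd_lt_castAdd] using
        h (Fin.castAdd n i) (Fin.castAdd n j) hij (by simp [hf])
    · simpa using h (Fin.natAdd m i) (Fin.natAdd m j) (by simpa using hij) (by simp [hf])
  · rintro ⟨h1, h2⟩ i j hij hf
    induction i using Fin.addCases with
    | left i =>
      induction j using Fin.addCases with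
      | left j => simpa [castAdd_lt_castAdd] using h1 i j hij (by simpa using hf)
      | right j => simp at hf
    | right i =>
      induction j using Fin.addCases with
      | left j => simp at hf
      | right j => simpa using h2 i j (by simpa using hij) (by simpa using hf)

/-- The permutations increasing on the fibres of a labelling of a sum of two blocks are uniquely
products of a shuffle and of such permutations of the two blocks. -/
theorem sum_fiberMono_sumLabel {m n : ℕ} {L L' : Type*} (f : Fin m → L) (g : Fin n → L')
    {A : Type*} [AddCommMonoid A] (F : Equiv.Perm (Fin (m + n)) → A)
    [DecidablePred fun α : Equiv.Perm (Fin m) => FiberMono f α]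
    [DecidablePred fun α : Equiv.Perm (Fin n) => FiberMono g α]
    [DecidablePred fun α : Equiv.Perm (Fin (m + n)) => FiberMono (side m n) α]
    [DecidablePred fun α : Equiv.Perm (Fin (m + n)) => FiberMono (sumLabel f g) α] :
    ∑ α : Equiv.Perm (Fin m) with FiberMono f α, ∑ β : Equiv.Perm (Fin n) with FiberMono g β,
      ∑ σ : Equiv.Perm (Fin (m + n)) with FiberMono (side m n) σ, F (σ * finSum α β) =
    ∑ τ : Equiv.Perm (Fin (m + n)) with FiberMono (sumLabel f g) τ, F τ := by
  simp_rw [← Finset.sum_product']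
  refine Finset.sum_bij (fun p _ => p.2.2 * finSum p.1 p.2.1) ?_ ?_ ?_ fun _ _ => rfl
  · rintro ⟨α, β, σ⟩ h
    simp only [Finset.mem_product, Finset.mem_filter, Finset.mem_univ, true_and] at h ⊢
    intro i j hij hf
    refine h.2.2 _ _ (fiberMono_sumLabel_finSum.2 ⟨h.1, h.2.1⟩ i j hij hf) ?_
    rw [side_finSum, side_finSum, side_eq_of_sumLabel_eq hf]
  · rintro ⟨α, β, σ⟩ h ⟨α', β', σ'⟩ h' heq
    simp only [Finset.mem_product, Finset.mem_filter, Finset.mem_univ, true_and] at h h'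
    obtain ⟨h1, h2⟩ := fiberMono_mul_unique h.2.2 h'.2.2 (side_finSum _ _) (side_finSum _ _) heq
    obtain ⟨h3, h4⟩ := finSum_injective h2
    exact Prod.ext h3 (Prod.ext h4 h1)
  · intro τ hτ
    simp only [Finset.mem_filter, Finset.mem_univ, true_and] at hτ
    -- Factor through the coarser labelling by sides; the Young subgroup part splits into two
    -- permutations, and it inherits monotonicity on the finer fibres because `σ` is increasing on
    -- each side.
    obtain ⟨σ, δ, rfl, hσ, hδ⟩ := exists_fiberMono_mul (side m n) τ
    obtain ⟨α, β, rfl⟩ := exists_finSum δ hδ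
    have : FiberMono (sumLabel f g) (finSum α β) := fun i j hij hf =>
      (hσ.lt_iff (by rw [hδ, hδ, side_eq_of_sumLabel_eq hf])).1 (hτ i j hij hf)
    rw [fiberMono_sumLabel_finSum] at this
    exact ⟨(α, β, σ), by simp [this, hσ], rfl⟩

/-! ### Sums over permutations which are increasing on fibres -/

variable {k : Type u} [CommRing k] {X : CochainComplex (ModuleCat.{v} k) ℤ}

variable (X) in
/-- The inclusion of `Tⁿ(X)` into `T(X)`. -/
abbrev incl (n : ℕ) : (⨂[k]^n (Tot X)) →ₗ[k] T X := DirectSum.lof k ℕ (fun n => ⨂[k]^n (Tot X)) n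

open Classical in
/-- The sum of `σ x` over the permutations `σ` which are increasing on the fibres of `f`. -/
def shuffleSum {N : ℕ} {L : Type*} (f : Fin N → L) (x : ⨂[k]^N (Tot X)) : T X :=
  ∑ σ : Equiv.Perm (Fin N) with FiberMono f σ, incl X N (bijAct X σ x)

/-- Right multiplication by `φ'` maps the permutations increasing for `g` bijectively onto those
increasing for `f`. Only the partition defined by a labelling matters, not the labels. -/
theorem shuffleSum_reindex {N M : ℕ} {L L' : Type*} {f : Fin N → L} {g : Fin M → L'}
    (φ' : Fin N ≃ Fin M) (hφ : FiberMono f φ') (h : ∀ i j, g (φ' i) = g (φ' j) ↔ f i = f j)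
    (x : ⨂[k]^N (Tot X)) : shuffleSum f x = shuffleSum g (bijAct X φ' x) := by
  obtain rfl : N = M := by simpa using Fintype.card_congr φ'
  refine (Finset.sum_equiv (Equiv.mulRight (φ' : Equiv.Perm (Fin N))) (fun σ => ?_)
    fun σ _ => ?_).symm
  · simp only [Finset.mem_filter, Finset.mem_univ, true_and, Equiv.coe_mulRight]
    constructor
    · exact fun hσ i j hij hf => hσ _ _ (hφ i j hij hf) ((h i j).2 hf)
    · intro hσ i j hij hg
      obtain ⟨a, rfl⟩ := φ'.surjective i
      obtain ⟨b, rfl⟩ := φ'.surjective j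
      have hf := (h a b).1 hg
      exact hσ a b ((hφ.lt_iff hf).1 hij) hf
  · rw [Equiv.coe_mulRight, bijAct_mul]

theorem shuffle_incl {m n : ℕ} (x : ⨂[k]^m (Tot X)) (y : ⨂[k]^n (Tot X)) :
    shuffle X (incl X m x) (incl X n y) = shuffleSum (side m n) (conc X m n x y) := by
  classical
  have h1 : shuffle X (incl X m x) (incl X n y) = incl X (m + n) (powShuffle X m n x y) := by
    rw [shuffle, DirectSum.toModule_lof, LinearMap.flip_apply, DirectSum.toModule_lof]
    rfl
  rw [h1, powShuffle, shuffleSum, LinearMap.compr₂_apply, LinearMap.sum_apply, map_sum]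
  refine Finset.sum_congr (Finset.filter_congr fun σ _ => isShuffle_iff σ) fun σ _ => ?_
  rw [permAct_eq_bijAct]
  rfl

/-- Moving `α` and `β` past the concatenation turns the triple sum into one over σ (α ⊕ β), and
these products run once through the permutations increasing for the joint labelling. -/
theorem shuffle_shuffleSum {m n : ℕ} {L L' : Type*} (f : Fin m → L) (g : Fin n → L')
    (x : ⨂[k]^m (Tot X)) (y : ⨂[k]^n (Tot X)) :
    shuffle X (shuffleSum f x) (shuffleSum g y) = shuffleSum (sumLabel f g) (conc X m n x y) := by
  classical
  simp only [shuffleSum, map_sum, LinearMap.sum_apply]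
  rw [← sum_fiberMono_sumLabel f g, Finset.sum_comm]
  refine Finset.sum_congr rfl fun α _ => Finset.sum_congr rfl fun β _ => ?_
  rw [shuffle_incl, shuffleSum]
  refine Finset.sum_congr rfl fun σ _ => ?_
  rw [bijAct_mul, bijAct_finSum_conc]

/-- With a single label only the identity is increasing. This lets every tensor enter
`shuffle_shuffleSum`. -/
theorem incl_eq_shuffleSum {n : ℕ} (x : ⨂[k]^n (Tot X)) :
    incl X n x = shuffleSum (fun _ => ()) x := by
  classical
  rw [shuffleSum, Finset.sum_eq_single_of_mem 1, bijAct_one]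
  · simp only [Finset.mem_filter, Finset.mem_univ, true_and]
    exact fun i j hij _ => hij
  · intro σ hσ hne
    simp only [Finset.mem_filter, Finset.mem_univ, true_and] at hσ
    exact absurd (eq_one_of_fiberMono hσ fun _ => rfl) hne

theorem shuffleSum_cast {N M : ℕ} {L L' : Type*} {f : Fin N → L} {g : Fin M → L'}
    (hNM : N = M) (h : ∀ i j, g (Fin.cast hNM i) = g (Fin.cast hNM j) ↔ f i = f j)
    (x : ⨂[k]^N (Tot X)) :
    shuffleSum f x = shuffleSum g (TensorPower.cast k (Tot X) hNM x) := by
  rw [shuffleSum_reindex (finCongr hNM) (fun i j hij _ => hij) h, bijAct_finCongr]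

/-! ### The algebra laws on tensors -/

/-- Both sides are sums over the permutations increasing on three consecutive blocks; the label
types differ only by reassociating a disjoint union. -/
theorem shuffle_assoc_incl {l m n : ℕ} (x : ⨂[k]^l (Tot X)) (y : ⨂[k]^m (Tot X))
    (z : ⨂[k]^n (Tot X)) :
    shuffle X (shuffle X (incl X l x) (incl X m y)) (incl X n z) =
      shuffle X (incl X l x) (shuffle X (incl X m y) (incl X n z)) := by
  rw [incl_eq_shuffleSum, incl_eq_shuffleSum, incl_eq_shuffleSum, shuffle_shuffleSum,
    shuffle_shuffleSum, shuffle_shuffleSum, shuffle_shuffleSum, ← conc_assoc]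
  refine shuffleSum_cast _ ?_ _
  have h : ∀ i : Fin (l + m + n), Equiv.sumAssoc _ _ _ (sumLabel (sumLabel
      (fun _ : Fin l => ()) fun _ : Fin m => ()) (fun _ : Fin n => ()) i) =
      sumLabel (fun _ : Fin l => ()) (sumLabel (fun _ : Fin m => ()) fun _ : Fin n => ())
        (Fin.cast (add_assoc l m n) i) := by
    intro i
    induction i using Fin.addCases with
    | left i =>
      induction i using Fin.addCases with
      | left i =>
        have : Fin.cast (add_assoc l m n) (Fin.castAdd n (Fin.castAdd m i)) =
          Fin.castAdd (m + n) i := rfl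
        simp [this]
      | right i =>
        have : Fin.cast (add_assoc l m n) (Fin.castAdd n (Fin.natAdd l i)) =
          Fin.natAdd l (Fin.castAdd n i) := rfl
        simp [this]
    | right i =>
      have : Fin.cast (add_assoc l m n) (Fin.natAdd (l + m) i) =
          Fin.natAdd l (Fin.natAdd m i) := Fin.ext (Nat.add_assoc _ _ _)
      simp [this]
  intro i j
  rw [← h, ← h, (Equiv.sumAssoc _ _ _).apply_eq_iff_eq]

theorem shuffle_comm_incl {m n : ℕ} {r s : ℤ} {x : ⨂[k]^m (Tot X)} {y : ⨂[k]^n (Tot X)}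
    (hx : x ∈ powGr X m r) (hy : y ∈ powGr X n s) :
    shuffle X (incl X m x) (incl X n y) =
      paritySign k ((r * s : ℤ) : ZMod 2) • shuffle X (incl X n y) (incl X m x) := by
  rw [shuffle_incl, shuffle_incl, shuffleSum_reindex (g := side n m) finAddFlip,
    bijAct_finAddFlip_conc hx hy]
  · simp only [shuffleSum, map_smul, Finset.smul_sum]
  · exact fiberMono_finAddFlip m n
  · intro i j
    simp [side_finAddFlip]

/-- Cancellation phrased through the scalar -1, for modules whose additive structure is only given
as a monoid. -/
theorem add_neg_one_smul {R M : Type*} [Ring R] [AddCommMonoid M] [Module R M] (x : M) :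
    x + (-1 : R) • x = 0 := by
  nth_rewrite 1 [← one_smul R x]
  rw [← add_smul, add_neg_cancel, zero_smul]

theorem powGr_zero {r : ℤ} (hr : r ≠ 0) : powGr X 0 r = ⊥ := by
  rw [eq_bot_iff]
  refine powGr_le fun deg m _ h => absurd ?_ hr
  simpa using h.symm

/-- Composing a shuffle with the flip of the two equal blocks is an involution without fixed points
for n > 0, and it changes the sign because r² is odd. For n = 0 there are no nonzero elements of odd
degree. -/
theorem shuffle_self_incl {n : ℕ} {r : ℤ} (hr : Odd r) {x : ⨂[k]^n (Tot X)}
    (hx : x ∈ powGr X n r) : shuffle X (incl X n x) (incl X n x) = 0 := by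
  classical
  rcases Nat.eq_zero_or_pos n with rfl | hn
  · rw [powGr_zero (by rintro rfl; simp at hr), Submodule.mem_bot] at hx
    simp [hx]
  · rw [shuffle_incl, shuffleSum]
    refine Finset.sum_involution (fun σ _ => σ * (finAddFlip : Fin (n + n) ≃ Fin (n + n)))
      ?_ ?_ ?_ ?_
    · intro σ _
      rw [bijAct_mul, bijAct_finAddFlip_conc hx hx, ZMod.intCast_eq_one_iff_odd.2 (hr.mul hr),
        paritySign_one,
        map_smul, map_smul, add_neg_one_smul]
    · intro σ _ _ h
      have := Equiv.congr_fun h (Fin.castAdd n ⟨0, hn⟩)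
      rw [Equiv.Perm.mul_apply, finAddFlip_apply_castAdd] at this
      exact (castAdd_lt_natAdd (n := n) ⟨0, hn⟩ ⟨0, hn⟩).ne' (σ.injective this)
    · intro σ hσ
      simp only [Finset.mem_filter, Finset.mem_univ, true_and] at hσ ⊢
      intro i j hij hf
      rw [Equiv.Perm.mul_apply, Equiv.Perm.mul_apply]
      exact hσ _ _ (fiberMono_finAddFlip n n i j hij hf) (by simp [side_finAddFlip, hf])
    · intro σ _
      refine Equiv.ext fun i => ?_
      simp only [Equiv.Perm.mul_apply, finAddFlip_finAddFlip]

theorem d_incl {n : ℕ} (x : ⨂[k]^n (Tot X)) : d X (incl X n x) = incl X n (powD X n x) := by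
  simp [d]

theorem d_shuffleSum {N : ℕ} {L : Type*} (f : Fin N → L) (x : ⨂[k]^N (Tot X)) :
    d X (shuffleSum f x) = shuffleSum f (powD X N x) := by
  simp only [shuffleSum, map_sum, d_incl, bijAct_powD]

theorem leibniz_incl {m n : ℕ} {r : ℤ} {x : ⨂[k]^m (Tot X)} (hx : x ∈ powGr X m r)
    (y : ⨂[k]^n (Tot X)) :
    d X (shuffle X (incl X m x) (incl X n y)) = shuffle X (d X (incl X m x)) (incl X n y) +
      paritySign k (r : ZMod 2) • shuffle X (incl X m x) (d X (incl X n y)) := by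
  simp only [d_incl, shuffle_incl, d_shuffleSum, powD_conc hx]
  simp only [shuffleSum, map_add, map_smul, Finset.sum_add_distrib, Finset.smul_sum]

end

end ShuffleAlg

namespace DGAlg

section

variable {k A : Type*} [CommRing k] [AddCommMonoid A] [Module k A]

/-! ### Gradings given by projections -/

/-- The linear maps `π i` are the projections of a grading of `A` by the submodules `gr i`. -/
structure IsGradingProj {ι : Type*} (gr : ι → Submodule k A) (π : ι → A →ₗ[k] A) : Prop where
  eq_self : ∀ i, ∀ x ∈ gr i, π i x = x
  eq_zero : ∀ i j, i ≠ j → ∀ x ∈ gr j, π i x = 0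
  iSup_eq_top : ⨆ i, gr i = ⊤

namespace IsGradingProj

variable {ι : Type*} {gr : ι → Submodule k A} {π : ι → A →ₗ[k] A}

theorem exists_sum (h : IsGradingProj gr π) (x : A) :
    (∀ i, π i x ∈ gr i) ∧ ∃ s : Finset ι, x = ∑ i ∈ s, π i x := by
  classical
  have hx : x ∈ ⨆ i, gr i := h.iSup_eq_top ▸ Submodule.mem_top
  obtain ⟨f, hf, rfl⟩ := (Submodule.mem_iSup_iff_exists_finsupp gr x).1 hx
  have key : ∀ i, π i (f.sum fun _ a => a) = f i := by
    intro i
    rw [Finsupp.sum, map_sum]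
    by_cases hi : i ∈ f.support
    · rw [Finset.sum_eq_single_of_mem i hi fun j _ hj => h.eq_zero i j hj.symm _ (hf j),
        h.eq_self i _ (hf i)]
    · rw [Finsupp.notMem_support_iff.1 hi]
      exact Finset.sum_eq_zero fun j hj => h.eq_zero i j (fun e => hi (e ▸ hj)) _ (hf j)
  exact ⟨fun i => (key i).symm ▸ hf i, f.support, Finset.sum_congr rfl fun i _ => (key i).symm⟩

theorem proj_mem (h : IsGradingProj gr π) (i : ι) (x : A) : π i x ∈ gr i := (h.exists_sum x).1 i

theorem isInternal [DecidableEq ι] (h : IsGradingProj gr π) : DirectSum.IsInternal gr := by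
  constructor
  · intro a b hab
    have key : ∀ (a : ⨁ i, gr i) (i : ι), π i (DirectSum.coeAddMonoidHom gr a) = a i := by
      intro a i
      induction a using DirectSum.induction_on with
      | zero => simp
      | of j x =>
        rw [DirectSum.coeAddMonoidHom_of]
        by_cases hij : i = j
        · subst hij
          rw [h.eq_self _ _ x.2, DirectSum.of_eq_same]
        · rw [h.eq_zero i j hij _ x.2, DirectSum.of_eq_of_ne _ _ _ hij]
          rfl
      | add x y hx hy => rw [map_add, map_add, hx, hy]; rfl
    refine DFinsupp.ext fun i => Subtype.ext ?_
    rw [← key, ← key, hab]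
  · intro x
    obtain ⟨hm, s, hs⟩ := h.exists_sum x
    refine ⟨∑ i ∈ s, DirectSum.of (fun i => gr i) i ⟨π i x, hm i⟩, ?_⟩
    rw [map_sum]
    simp only [DirectSum.coeAddMonoidHom_of]
    exact hs.symm

/-- Stability under the projections is the practical form of homogeneity, used for the ideals, for
TS and for the tensor degrees. -/
theorem le_iSup_inf (h : IsGradingProj gr π) {S : Submodule k A} (hS : ∀ i, ∀ x ∈ S, π i x ∈ S) :
    S ≤ ⨆ i, S ⊓ gr i := by
  intro x hx
  obtain ⟨hm, s, hs⟩ := h.exists_sum x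
  rw [hs]
  exact Submodule.sum_mem _ fun i _ => Submodule.mem_iSup_of_mem i ⟨hS i x hx, hm i⟩

theorem subGr (h : IsGradingProj gr π) {S : Submodule k A} (hS : ∀ i, ∀ x ∈ S, π i x ∈ S) :
    IsGradingProj (subGr gr S) fun i => (π i).restrict (hS i) where
  eq_self i x hx := Subtype.ext (h.eq_self i x hx)
  eq_zero i j hij x hx := Subtype.ext (h.eq_zero i j hij x hx)
  iSup_eq_top := by
    rw [eq_top_iff]
    intro x _
    obtain ⟨hm, s, hs⟩ := h.exists_sum (x : A)
    have : x = ∑ i ∈ s, (π i).restrict (hS i) x := Subtype.ext (by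
      rw [AddSubmonoidClass.coe_finsetSum]
      exact hs)
    rw [this]
    exact Submodule.sum_mem _ fun i _ => Submodule.mem_iSup_of_mem i (hm i)

end IsGradingProj

theorem mem_evenPart_of_mem {gr : ℤ → Submodule k A} {i : ℤ} (hi : Even i) {x : A}
    (hx : x ∈ gr i) : x ∈ evenPart gr :=
  Submodule.mem_iSup_of_mem i (Submodule.mem_iSup_of_mem hi hx)

theorem evenPart_le {gr : ℤ → Submodule k A} {N : Submodule k A} (h : ∀ i, Even i → gr i ≤ N) :
    evenPart gr ≤ N := iSup_le fun i => iSup_le fun hi => h i hi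

theorem IsGradingProj.mem_evenPart_iff {gr : ℤ → Submodule k A} {π : ℤ → A →ₗ[k] A}
    (h : IsGradingProj gr π) {x : A} : x ∈ evenPart gr ↔ ∀ i, Odd i → π i x = 0 := by
  constructor
  · intro hx i hi
    suffices evenPart gr ≤ LinearMap.ker (π i) from this hx
    refine evenPart_le fun j hj y hy => h.eq_zero i j ?_ y hy
    rintro rfl
    exact Int.not_even_iff_odd.2 hi hj
  · intro hx
    obtain ⟨hm, s, hs⟩ := h.exists_sum x
    rw [hs]
    refine Submodule.sum_mem _ fun i _ => ?_
    rcases Int.even_or_odd i with hi | hi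
    · exact mem_evenPart_of_mem hi (hm i)
    · rw [hx i hi]; exact zero_mem _

/-- Evenness means that the odd projections vanish, and these are computed in `A` as well as in `S`.
-/
theorem IsGradingProj.mem_evenPart_subGr_iff {gr : ℤ → Submodule k A} {π : ℤ → A →ₗ[k] A}
    (h : IsGradingProj gr π) {S : Submodule k A} (hS : ∀ i, ∀ x ∈ S, π i x ∈ S) {x : S} :
    x ∈ evenPart (DGAlg.subGr gr S) ↔ (x : A) ∈ evenPart gr := by
  rw [h.mem_evenPart_iff, (h.subGr hS).mem_evenPart_iff]
  simp only [Subtype.ext_iff]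
  rfl

end

end DGAlg

namespace ShuffleAlg

open DGAlg

noncomputable section

variable {k : Type u} [CommRing k] {X : CochainComplex (ModuleCat.{v} k) ℤ}

/-! ### The gradings of `T(X)` -/

variable (X) in
/-- The component of tensor degree `n`. -/
abbrev comp (n : ℕ) : T X →ₗ[k] (⨂[k]^n (Tot X)) :=
  DirectSum.component k ℕ (fun n => ⨂[k]^n (Tot X)) n

theorem comp_incl (n : ℕ) (x : ⨂[k]^n (Tot X)) : comp X n (incl X n x) = x :=
  DirectSum.component.lof_self k (M := fun n => ⨂[k]^n (Tot X)) n x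

theorem comp_incl_of_ne {m n : ℕ} (h : m ≠ n) (x : ⨂[k]^m (Tot X)) :
    comp X n (incl X m x) = 0 := by
  rw [DirectSum.component.of, dif_neg h]

theorem T_ext {x y : T X} (h : ∀ n, comp X n x = comp X n y) : x = y := DFinsupp.ext h

theorem incl_injective (n : ℕ) : Function.Injective (incl X n) :=
  Function.LeftInverse.injective (comp_incl n)

theorem exists_sum_incl (x : T X) : ∃ s : Finset ℕ, x = ∑ n ∈ s, incl X n (comp X n x) := by
  classical
  exact ⟨DFinsupp.support x, (DirectSum.sum_support_of x).symm⟩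

theorem comp_lmap (f : ∀ n, (⨂[k]^n (Tot X)) →ₗ[k] (⨂[k]^n (Tot X))) (n : ℕ) (x : T X) :
    comp X n (DirectSum.lmap f x) = f n (comp X n x) := rfl

@[elab_as_elim]
theorem incl_induction {p : T X → Prop} (x : T X) (zero : p 0)
    (incl : ∀ n (x : ⨂[k]^n (Tot X)), p (incl X n x))
    (add : ∀ x y, p x → p y → p (x + y)) : p x := by
  induction x using DirectSum.induction_on with
  | zero => exact zero
  | of n x => exact incl n x
  | add x y hx hy => exact add x y hx hy

variable (X) in
/-- The projection of `Tⁿ(X)` onto its part of degree `r`. -/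
def powProj (n : ℕ) (r : ℤ) : (⨂[k]^n (Tot X)) →ₗ[k] (⨂[k]^n (Tot X)) :=
  (PiTensorProduct.ofDirectSumEquiv (R := k) (ι := Fin n) (κ := fun _ => ℤ)
    (M := fun _ i => X.X i)).symm.toLinearMap ∘ₗ
  (DirectSum.toModule k (Fin n → ℤ) _ fun deg => if ∑ i, deg i = r then
    DirectSum.lof k (Fin n → ℤ) (fun deg => ⨂[k] i, X.X (deg i)) deg else 0) ∘ₗ
  (PiTensorProduct.ofDirectSumEquiv (R := k) (ι := Fin n) (κ := fun _ => ℤ)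
    (M := fun _ i => X.X i)).toLinearMap

theorem powProj_tprod {n : ℕ} {r : ℤ} {deg : Fin n → ℤ} {m : Fin n → Tot X}
    (hm : ∀ i, m i ∈ homog X (deg i)) :
    powProj X n r (PiTensorProduct.tprod k m) =
      if ∑ i, deg i = r then PiTensorProduct.tprod k m else 0 := by
  choose x hx using hm
  obtain rfl : (fun i => DirectSum.lof k ℤ (fun i => X.X i) (deg i) (x i)) = m := funext hx
  simp only [powProj, LinearMap.comp_apply, LinearEquiv.coe_coe,
    PiTensorProduct.ofDirectSumEquiv_tprod_lof, DirectSum.toModule_lof]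
  split_ifs
  · rw [PiTensorProduct.ofDirectSumEquiv_symm_lof_tprod]
  · simp

theorem powProj_of_mem {n : ℕ} {r : ℤ} {x : ⨂[k]^n (Tot X)} (hx : x ∈ powGr X n r) :
    powProj X n r x = x := by
  suffices powGr X n r ≤ LinearMap.eqLocus (powProj X n r) LinearMap.id from this hx
  refine powGr_le fun deg m hm hr => ?_
  rw [LinearMap.mem_eqLocus, powProj_tprod hm, if_pos hr]; rfl

theorem powProj_of_mem_ne {n : ℕ} {r s : ℤ} (h : r ≠ s) {x : ⨂[k]^n (Tot X)}
    (hx : x ∈ powGr X n s) : powProj X n r x = 0 := by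
  suffices powGr X n s ≤ LinearMap.ker (powProj X n r) from this hx
  refine powGr_le fun deg m hm hr => ?_
  rw [LinearMap.mem_ker, powProj_tprod hm, if_neg fun h' => h (h'.symm.trans hr)]

theorem span_tprod_homog (n : ℕ) : Submodule.span k (Set.range
    fun j : Fin n → Σ r : ℤ, homog X r => PiTensorProduct.tprod k fun i => ((j i).2 : Tot X)) = ⊤ :=
  PiTensorProduct.submodule_span_eq_top (g := fun _ (p : Σ r : ℤ, homog X r) => (p.2 : Tot X))
    (fun _ => span_homog)

/-- Permuting factors preserves the total degree; this makes the symmetric tensors a graded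
submodule. -/
theorem bijAct_powProj {m n : ℕ} (σ : Fin m ≃ Fin n) (r : ℤ) (x : ⨂[k]^m (Tot X)) :
    bijAct X σ (powProj X m r x) = powProj X n r (bijAct X σ x) := by
  suffices bijAct X σ ∘ₗ powProj X m r = powProj X n r ∘ₗ bijAct X σ from
    LinearMap.congr_fun this x
  refine ext_homog fun deg a ha => ?_
  rw [LinearMap.comp_apply, LinearMap.comp_apply, powProj_tprod ha, bijAct_tprod σ ha, map_smul,
    powProj_tprod (deg := deg ∘ σ.symm) (m := a ∘ σ.symm) fun i => ha _]
  have : ∑ i, (deg ∘ σ.symm) i = ∑ i, deg i := σ.symm.sum_comp deg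
  rw [this]
  split_ifs
  · rw [bijAct_tprod σ ha]
  · simp

variable (X) in
/-- The projection of `T(X)` onto its part of degree `r`. -/
def grProj (r : ℤ) : T X →ₗ[k] T X := DirectSum.lmap fun n => powProj X n r

theorem mem_gr_iff {r : ℤ} {x : T X} : x ∈ gr X r ↔ ∀ n, comp X n x ∈ powGr X n r := by
  simp [gr, Submodule.mem_iInf]

theorem incl_mem_gr {n : ℕ} {r : ℤ} {x : ⨂[k]^n (Tot X)} (hx : x ∈ powGr X n r) :
    incl X n x ∈ gr X r := by
  rw [mem_gr_iff]
  intro m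
  by_cases h : n = m
  · subst h; rwa [comp_incl]
  · rw [comp_incl_of_ne h]; exact zero_mem _

theorem gr_le {r : ℤ} {N : Submodule k (T X)}
    (h : ∀ n, ∀ x ∈ powGr X n r, incl X n x ∈ N) : gr X r ≤ N := by
  intro x hx
  obtain ⟨s, hs⟩ := exists_sum_incl x
  rw [hs]
  exact Submodule.sum_mem _ fun n _ => h n _ (mem_gr_iff.1 hx n)

variable (X) in
theorem isGradingProj_gr : IsGradingProj (gr X) (grProj X) where
  eq_self r x hx := T_ext fun n => powProj_of_mem (mem_gr_iff.1 hx n)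
  eq_zero r s h x hx := T_ext fun n => powProj_of_mem_ne h (mem_gr_iff.1 hx n)
  iSup_eq_top := by
    rw [eq_top_iff]
    intro x _
    refine incl_induction x (zero_mem _) (fun n x => ?_) fun x y hx hy => add_mem hx hy
    suffices (⊤ : Submodule k (⨂[k]^n (Tot X))) ≤ (⨆ r, gr X r).comap (incl X n) from
      this Submodule.mem_top
    rw [← span_tprod_homog n, Submodule.span_le]
    rintro _ ⟨j, rfl⟩
    exact Submodule.mem_iSup_of_mem _ (incl_mem_gr (tprod_mem_powGr fun i => (j i).2.2))

variable (X) in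
theorem isGradingProj_tensorGr : IsGradingProj (tensorGr X) fun n => incl X n ∘ₗ comp X n where
  eq_self n := by
    rintro _ ⟨x, rfl⟩
    rw [LinearMap.comp_apply, comp_incl]
  eq_zero m n h := by
    rintro _ ⟨x, rfl⟩
    rw [LinearMap.comp_apply, comp_incl_of_ne h.symm, map_zero]
  iSup_eq_top := by
    rw [eq_top_iff]
    intro x _
    exact incl_induction x (zero_mem _) (fun n x => Submodule.mem_iSup_of_mem n ⟨x, rfl⟩)
      fun x y hx hy => add_mem hx hy

/-! ### `T(X)` as a dg algebra -/

theorem shuffle_assoc (x y z : T X) :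
    shuffle X (shuffle X x y) z = shuffle X x (shuffle X y z) := by
  induction x using incl_induction with
  | zero => simp
  | add x x' h h' => simp only [map_add, LinearMap.add_apply, h, h']
  | incl l x =>
    induction y using incl_induction with
    | zero => simp
    | add x x' h h' => simp only [map_add, LinearMap.add_apply, h, h']
    | incl m y =>
      induction z using incl_induction with
      | zero => simp
      | add x x' h h' => simp only [map_add, h, h']
      | incl n z => exact shuffle_assoc_incl x y z

theorem one_eq_incl : one X = incl X 0 (PiTensorProduct.tprod k Fin.elim0) := rfl

theorem one_shuffle (x : T X) : shuffle X (one X) x = x := by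
  induction x using incl_induction with
  | zero => simp
  | add x y h h' => rw [map_add, h, h']
  | incl n x =>
    rw [one_eq_incl, shuffle_incl, shuffleSum_cast (g := fun _ : Fin n => ()) (zero_add n),
      one_conc, ← incl_eq_shuffleSum]
    intro i j
    induction i using Fin.addCases with
    | left i => exact i.elim0
    | right i =>
      induction j using Fin.addCases with
      | left i => exact i.elim0
      | right i => rw [side_natAdd, side_natAdd]; simp

theorem shuffle_one (x : T X) : shuffle X x (one X) = x := by
  induction x using incl_induction with
  | zero => simp
  | add x y h h' => rw [map_add, LinearMap.add_apply, h, h']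
  | incl n x =>
    rw [one_eq_incl, shuffle_incl, shuffleSum_cast (g := fun _ : Fin n => ()) (add_zero n),
      conc_one, ← incl_eq_shuffleSum]
    intro i j
    induction i using Fin.addCases with
    | right i => exact i.elim0
    | left i =>
      induction j using Fin.addCases with
      | right i => exact i.elim0
      | left i => rw [side_castAdd, side_castAdd]; simp

theorem one_mem_gr : one X ∈ gr X 0 := by
  refine incl_mem_gr ?_
  simpa using tprod_mem_powGr (X := X) (deg := Fin.elim0) (m := Fin.elim0) fun i => i.elim0

theorem shuffleSum_mem_gr {N : ℕ} {L : Type*} (f : Fin N → L) {r : ℤ} {x : ⨂[k]^N (Tot X)}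
    (hx : x ∈ powGr X N r) : shuffleSum f x ∈ gr X r :=
  Submodule.sum_mem _ fun _ _ => incl_mem_gr (bijAct_mem_powGr _ hx)

theorem shuffle_mem_gr {i j : ℤ} {x y : T X} (hx : x ∈ gr X i) (hy : y ∈ gr X j) :
    shuffle X x y ∈ gr X (i + j) := by
  suffices gr X i ≤ (gr X (i + j)).comap ((shuffle X).flip y) from this hx
  refine gr_le fun m x hx => ?_
  suffices gr X j ≤ (gr X (i + j)).comap (shuffle X (incl X m x)) from this hy
  refine gr_le fun n y hy => ?_
  rw [Submodule.mem_comap, shuffle_incl]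
  exact shuffleSum_mem_gr _ (conc_mem_powGr hx hy)

theorem shuffleSum_mem_tensorGr {N : ℕ} {L : Type*} (f : Fin N → L) (x : ⨂[k]^N (Tot X)) :
    shuffleSum f x ∈ tensorGr X N :=
  Submodule.sum_mem _ fun _ _ => ⟨_, rfl⟩

theorem leibniz {i : ℤ} {x : T X} (hx : x ∈ gr X i) (y : T X) :
    d X (shuffle X x y) = shuffle X (d X x) y +
      paritySign k (i : ZMod 2) • shuffle X x (d X y) := by
  suffices gr X i ≤ LinearMap.eqLocus (d X ∘ₗ (shuffle X).flip y)
    ((shuffle X).flip y ∘ₗ d X + paritySign k (i : ZMod 2) • (shuffle X).flip (d X y)) from this hx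
  refine gr_le fun m x hx => ?_
  simp only [LinearMap.mem_eqLocus, LinearMap.comp_apply, LinearMap.add_apply,
    LinearMap.smul_apply, LinearMap.flip_apply]
  induction y using incl_induction with
  | zero => simp
  | incl n y => exact leibniz_incl hx y
  | add y y' h h' =>
    simp only [map_add, h, h', smul_add]
    abel

variable (X) in
theorem isDGAlgebra : IsDGAlgebra (shuffle X) (one X) (gr X) (d X) where
  isInternal := (isGradingProj_gr X).isInternal
  mul_assoc := shuffle_assoc
  one_mul := one_shuffle
  mul_one := shuffle_one
  one_mem := one_mem_gr
  mul_mem _ _ _ hx _ hy := shuffle_mem_gr hx hy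
  d_mem i x hx := mem_gr_iff.2 fun n => powD_mem_powGr (mem_gr_iff.1 hx n)
  d_d x := T_ext fun n => powD_powD _
  leibniz i x hx y := by rw [negOnePow_eq_paritySign]; exact leibniz hx y

theorem shuffle_comm {i j : ℤ} {x y : T X} (hx : x ∈ gr X i) (hy : y ∈ gr X j) :
    shuffle X x y = paritySign k ((i * j : ℤ) : ZMod 2) • shuffle X y x := by
  suffices gr X i ≤ LinearMap.eqLocus ((shuffle X).flip y)
    (paritySign k ((i * j : ℤ) : ZMod 2) • shuffle X y) from this hx
  refine gr_le fun m x hx => ?_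
  suffices gr X j ≤ LinearMap.eqLocus (shuffle X (incl X m x))
    (paritySign k ((i * j : ℤ) : ZMod 2) • (shuffle X).flip (incl X m x)) from this hy
  exact gr_le fun n y hy => shuffle_comm_incl hx hy

theorem shuffle_self {i : ℤ} (hi : Odd i) {x : T X} (hx : x ∈ gr X i) : shuffle X x x = 0 := by
  obtain ⟨s, hs⟩ := exists_sum_incl x
  rw [hs]
  have hmem : ∀ n, incl X n (comp X n x) ∈ gr X i := fun n => incl_mem_gr (mem_gr_iff.1 hx n)
  clear hs
  induction s using Finset.induction_on with
  | empty => simp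
  | insert n s hn ih =>
    rw [Finset.sum_insert hn]
    simp only [map_add, LinearMap.add_apply]
    -- The squares vanish, and the two cross terms between the component `n` and the rest cancel by
    -- anticommutativity in odd degree.
    rw [ih, shuffle_self_incl hi (mem_gr_iff.1 hx n), zero_add, add_zero,
      shuffle_comm (hmem n) (Submodule.sum_mem _ fun m _ => hmem m),
      ZMod.intCast_eq_one_iff_odd.2 (hi.mul hi), paritySign_one, add_neg_one_smul]

variable (X) in
theorem isStrictlyGradedCommutative : IsStrictlyGradedCommutative (shuffle X) (gr X) where
  comm i j x hx y hy := by rw [negOnePow_eq_paritySign]; exact shuffle_comm hx hy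
  sq_eq_zero i hi x hx := shuffle_self hi hx

variable (X) in
theorem isConnectedNGrading :
    IsConnectedNGrading (shuffle X) (one X) (gr X) (d X) (tensorGr X) where
  isInternal := (isGradingProj_tensorGr X).isInternal
  homogeneous n := (isGradingProj_gr X).le_iSup_inf fun r => by
    rintro _ ⟨x, rfl⟩
    exact ⟨powProj X n r x, (DirectSum.lmap_lof (fun n => powProj X n r) n x).symm⟩
  one_mem := ⟨_, rfl⟩
  mul_mem m n := by
    rintro _ ⟨x, rfl⟩ _ ⟨y, rfl⟩
    rw [shuffle_incl]
    exact shuffleSum_mem_tensorGr _ _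
  d_mem n := by
    rintro _ ⟨x, rfl⟩
    exact ⟨powD X n x, (d_incl x).symm⟩
  smul_one_injective a b h := by
    simp only [one_eq_incl, ← map_smul] at h
    have h' := incl_injective 0 h
    -- The zeroth tensor power is `k` itself, through `algebraMap₀`.
    refine (TensorPower.algebraMap₀ (R := k) (M := Tot X)).injective ?_
    rwa [TensorPower.algebraMap₀_eq_smul_one, TensorPower.algebraMap₀_eq_smul_one]
  exists_smul_one := by
    rintro _ ⟨x, rfl⟩
    obtain ⟨a, rfl⟩ := (TensorPower.algebraMap₀ (R := k) (M := Tot X)).surjective x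
    refine ⟨a, ?_⟩
    rw [TensorPower.algebraMap₀_eq_smul_one, map_smul]
    rfl

end

end ShuffleAlg

namespace ShuffleAlg

open DGAlg

noncomputable section

/-! ### Block shuffles -/

theorem divNat_finProd {n p : ℕ} (a : Fin n) (b : Fin p) :
    (finProdFinEquiv (a, b)).divNat = a :=
  congrArg Prod.fst (finProdFinEquiv.symm_apply_apply (a, b))

theorem modNat_finProd {n p : ℕ} (a : Fin n) (b : Fin p) :
    (finProdFinEquiv (a, b)).modNat = b :=
  congrArg Prod.snd (finProdFinEquiv.symm_apply_apply (a, b))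

theorem finProd_lt_iff {n p : ℕ} {a a' : Fin n} {b b' : Fin p} :
    finProdFinEquiv (a, b) < finProdFinEquiv (a', b') ↔ a < a' ∨ a = a' ∧ b < b' := by
  simp only [Fin.lt_def, finProdFinEquiv_apply_val]
  have hb := b.2
  have hb' := b'.2
  rcases lt_trichotomy a a' with h | rfl | h
  · have : p * (a + 1 : ℕ) ≤ p * a' := Nat.mul_le_mul_left p h
    have h' : (a : ℕ) < a' := h
    rw [Nat.mul_succ] at this
    constructor
    · exact fun _ => Or.inl h
    · intro _; omega
  · simp
  · have : p * (a' + 1 : ℕ) ≤ p * a := Nat.mul_le_mul_left p h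
    have h' : (a' : ℕ) < a := h
    rw [Nat.mul_succ] at this
    constructor
    · intro _; omega
    · rintro (h | ⟨h, -⟩)
      · omega
      · subst h; omega

/-- The permutation of `n` blocks of size `p` given by a permutation of the blocks. -/
def blockPerm {n : ℕ} (p : ℕ) (π : Equiv.Perm (Fin n)) : Equiv.Perm (Fin (n * p)) :=
  finProdFinEquiv.symm.trans ((π.prodCongr (Equiv.refl (Fin p))).trans finProdFinEquiv)

theorem blockPerm_finProd {n p : ℕ} (π : Equiv.Perm (Fin n)) (a : Fin n) (b : Fin p) :
    blockPerm p π (finProdFinEquiv (a, b)) = finProdFinEquiv (π a, b) := by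
  simp [blockPerm]

theorem fiberMono_divNat_iff {n p M : ℕ} {σ : Fin (n * p) ≃ Fin M} :
    FiberMono Fin.divNat σ ↔
      ∀ a : Fin n, StrictMono fun b : Fin p => σ (finProdFinEquiv (a, b)) := by
  constructor
  · intro h a b b' hb
    exact h _ _ (finProd_lt_iff.2 (Or.inr ⟨rfl, hb⟩)) (by rw [divNat_finProd, divNat_finProd])
  · intro h i j hij hf
    obtain ⟨⟨a, b⟩, rfl⟩ := finProdFinEquiv.surjective i
    obtain ⟨⟨a', b'⟩, rfl⟩ := finProdFinEquiv.surjective j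
    rw [divNat_finProd, divNat_finProd] at hf
    subst hf
    rw [finProd_lt_iff] at hij
    exact h a (by simpa using hij)

theorem strictMono_perm_eq_one {n : ℕ} {π : Equiv.Perm (Fin n)} (h : StrictMono π) : π = 1 :=
  eq_one_of_fiberMono (f := fun _ => ()) (fun _ _ hij _ => h hij) fun _ => rfl

/-- Every permutation which is increasing on the blocks is a block shuffle up to a permutation of
the blocks. -/
theorem exists_isBlockShuffle_mul {n p : ℕ} (hp : 1 ≤ p) {τ : Equiv.Perm (Fin (n * p))}
    (hτ : FiberMono Fin.divNat τ) :
    ∃ (σ : Equiv.Perm (Fin (n * p))) (π : Equiv.Perm (Fin n)),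
      IsBlockShuffle n p σ ∧ τ = σ * blockPerm p π := by
  rw [fiberMono_divNat_iff] at hτ
  -- The last position of a block; `hp` is what makes it exist.
  let l : Fin p := ⟨p - 1, by omega⟩
  let g : Fin n → Fin (n * p) := fun a => τ (finProdFinEquiv (a, l))
  have hg : Function.Injective g := fun a a' h => by simpa using τ.injective h
  -- Sorting the blocks by the images of their last elements yields the block shuffle.
  let ρ := Tuple.sort g
  refine ⟨τ * blockPerm p ρ, ρ⁻¹, ⟨fun a b b' hb => ?_, fun b hb a a' ha => ?_⟩, ?_⟩
  · simp only [Equiv.Perm.mul_apply, blockPerm_finProd]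
    exact hτ _ hb
  · obtain rfl : b = l := Fin.ext (by simp only [l]; omega)
    simp only [Equiv.Perm.mul_apply, blockPerm_finProd]
    exact (Tuple.monotone_sort g).strictMono_of_injective (hg.comp ρ.injective) ha
  · refine Equiv.ext fun i => ?_
    obtain ⟨⟨a, b⟩, rfl⟩ := finProdFinEquiv.surjective i
    simp only [Equiv.Perm.mul_apply, blockPerm_finProd]
    simp

/-- The two block shuffles differ by the block permutation π' π⁻¹. Both order the blocks by last
elements, so π' π⁻¹ is increasing and therefore trivial. -/
theorem isBlockShuffle_mul_unique {n p : ℕ} (hp : 1 ≤ p) {σ σ' : Equiv.Perm (Fin (n * p))}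
    {π π' : Equiv.Perm (Fin n)} (hσ : IsBlockShuffle n p σ) (hσ' : IsBlockShuffle n p σ')
    (h : σ * blockPerm p π = σ' * blockPerm p π') : σ = σ' ∧ π = π' := by
  have hab : ∀ a b, σ (finProdFinEquiv (a, b)) = σ' (finProdFinEquiv (π' (π⁻¹ a), b)) := by
    intro a b
    have := Equiv.congr_fun h (finProdFinEquiv (π⁻¹ a, b))
    simpa [Equiv.Perm.mul_apply, blockPerm_finProd] using this
  let l : Fin p := ⟨p - 1, by omega⟩
  have hl : (l : ℕ) + 1 = p := by simp only [l]; omega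
  have h1 : π' * π⁻¹ = 1 := by
    refine strictMono_perm_eq_one fun a a' ha => ?_
    have := hσ.2 l hl ha
    simp only [hab] at this
    exact (hσ'.2 l hl).lt_iff_lt.1 this
  have h2 : π' = π := mul_inv_eq_one.1 h1
  subst h2
  exact ⟨mul_right_cancel h, rfl⟩

theorem sum_fiberMono_divNat {n p : ℕ} (hp : 1 ≤ p) {A : Type*} [AddCommMonoid A]
    (F : Equiv.Perm (Fin (n * p)) → A)
    [DecidablePred fun σ : Equiv.Perm (Fin (n * p)) => FiberMono Fin.divNat σ]
    [DecidablePred fun σ : Equiv.Perm (Fin (n * p)) => IsBlockShuffle n p σ] :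
    ∑ τ : Equiv.Perm (Fin (n * p)) with FiberMono Fin.divNat τ, F τ =
      ∑ π : Equiv.Perm (Fin n), ∑ σ : Equiv.Perm (Fin (n * p)) with IsBlockShuffle n p σ,
        F (σ * blockPerm p π) := by
  rw [← Finset.sum_product']
  refine (Finset.sum_bij (fun q _ => q.2 * blockPerm p q.1) ?_ ?_ ?_ fun _ _ => rfl).symm
  · rintro ⟨π, σ⟩ h
    simp only [Finset.mem_product, Finset.mem_filter, Finset.mem_univ, true_and] at h ⊢
    rw [fiberMono_divNat_iff]
    intro a b b' hb
    simp only [Equiv.Perm.mul_apply, blockPerm_finProd]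
    exact h.1 _ hb
  · rintro ⟨π, σ⟩ h ⟨π', σ'⟩ h' heq
    simp only [Finset.mem_product, Finset.mem_filter, Finset.mem_univ, true_and] at h h'
    obtain ⟨h1, h2⟩ := isBlockShuffle_mul_unique hp h h' heq
    exact Prod.ext h2 h1
  · intro τ hτ
    simp only [Finset.mem_filter, Finset.mem_univ, true_and] at hτ
    obtain ⟨σ, π, hσ, rfl⟩ := exists_isBlockShuffle_mul hp hτ
    exact ⟨(π, σ), by simpa using hσ, rfl⟩

/-! ### Tensor powers of tensors -/

variable {k : Type u} [CommRing k] {X : CochainComplex (ModuleCat.{v} k) ℤ}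

theorem cast_eq_of_mk_eq {m n : ℕ} {x : ⨂[k]^m (Tot X)} {y : ⨂[k]^n (Tot X)}
    (h : GradedMonoid.mk (A := fun n => ⨂[k]^n (Tot X)) m x = GradedMonoid.mk n y) (hmn : m = n) :
    TensorPower.cast k (Tot X) hmn x = y := by
  cases h
  simp

theorem tensorPow_zero {p : ℕ} (x : ⨂[k]^p (Tot X)) :
    TensorPower.cast k (Tot X) (zero_mul p) (tensorPow X 0 x) =
      PiTensorProduct.tprod k Fin.elim0 :=
  cast_eq_of_mk_eq (GradedMonoid.GMonoid.gnpow_zero'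
    (A := fun n => ⨂[k]^n (Tot X)) (GradedMonoid.mk p x)) _

theorem tensorPow_succ (n : ℕ) {p : ℕ} (x : ⨂[k]^p (Tot X)) :
    TensorPower.cast k (Tot X) (Nat.succ_mul n p) (tensorPow X (n + 1) x) =
      conc X (n * p) p (tensorPow X n x) x :=
  cast_eq_of_mk_eq (GradedMonoid.GMonoid.gnpow_succ'
    (A := fun n => ⨂[k]^n (Tot X)) n (GradedMonoid.mk p x)) _

theorem cast_injective {m n : ℕ} (h : m = n) :
    Function.Injective (TensorPower.cast k (Tot X) h) := (TensorPower.cast k (Tot X) h).injective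

theorem tensorPow_mem_powGr (n : ℕ) {p : ℕ} {r : ℤ} {x : ⨂[k]^p (Tot X)} (hx : x ∈ powGr X p r) :
    tensorPow X n x ∈ powGr X (n * p) (n * r) := by
  have key : ∀ {m l : ℕ} (h : m = l) (s : ℤ) (y : ⨂[k]^m (Tot X)),
      TensorPower.cast k (Tot X) h y ∈ powGr X l s → y ∈ powGr X m s := by
    intro m l h s y hy
    subst h; simpa using hy
  induction n with
  | zero =>
    refine key (zero_mul p) _ _ ?_
    rw [tensorPow_zero]
    simpa using tprod_mem_powGr (X := X) (deg := Fin.elim0) (m := Fin.elim0) fun i => i.elim0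
  | succ n ih =>
    refine key (Nat.succ_mul n p) _ _ ?_
    rw [tensorPow_succ, Nat.cast_succ, add_mul, one_mul]
    exact conc_mem_powGr ih hx

theorem divNat_cast_castAdd {n p : ℕ} (i : Fin (n * p)) :
    (Fin.cast (Nat.succ_mul n p).symm (Fin.castAdd p i)).divNat = i.divNat.castSucc := rfl

theorem modNat_cast_castAdd {n p : ℕ} (i : Fin (n * p)) :
    (Fin.cast (Nat.succ_mul n p).symm (Fin.castAdd p i)).modNat = i.modNat := rfl

theorem divNat_cast_natAdd {n p : ℕ} (i : Fin p) :
    (Fin.cast (Nat.succ_mul n p).symm (Fin.natAdd (n * p) i)).divNat = Fin.last n := by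
  refine Fin.ext ?_
  have hp : 0 < p := i.pos
  change (n * p + i) / p = n
  rw [Nat.mul_comm, Nat.mul_add_div hp, Nat.div_eq_of_lt i.2, add_zero]

theorem modNat_cast_natAdd {n p : ℕ} (i : Fin p) :
    (Fin.cast (Nat.succ_mul n p).symm (Fin.natAdd (n * p) i)).modNat = i := by
  refine Fin.ext ?_
  change (n * p + i) % p = i
  rw [Nat.mul_comm, Nat.mul_add_mod, Nat.mod_eq_of_lt i.2]

/-- The expansion of a tensor power of a sum of pure tensors. -/
theorem tensorPow_sum (n : ℕ) {p : ℕ} {ι : Type*} [Fintype ι] (a : ι → k) (m : ι → Fin p → Tot X) :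
    tensorPow X n (∑ s, a s • PiTensorProduct.tprod k (m s)) =
      ∑ c : Fin n → ι, (∏ i, a (c i)) •
        PiTensorProduct.tprod k fun i : Fin (n * p) => m (c i.divNat) i.modNat := by
  induction n with
  | zero =>
    refine cast_injective (zero_mul p) ?_
    rw [tensorPow_zero, Fintype.sum_unique, Finset.univ_eq_empty, Finset.prod_empty, one_smul,
      TensorPower.cast_tprod]
    congr 1
    funext i
    exact i.elim0
  | succ n ih =>
    refine cast_injective (Nat.succ_mul n p) ?_
    -- A choice of summands for n + 1 factors is a choice for the first n together with one for the
    -- last.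
    rw [tensorPow_succ, ih, map_sum, ← (Fin.snocEquiv fun _ : Fin (n + 1) => ι).sum_comp,
      Fintype.sum_prod_type]
    simp only [map_sum, LinearMap.sum_apply]
    refine Finset.sum_congr rfl fun s _ => Finset.sum_congr rfl fun c _ => ?_
    rw [map_smul, map_smul, map_smul, LinearMap.smul_apply, smul_smul, conc_tprod,
      TensorPower.cast_tprod, Fin.prod_univ_castSucc]
    simp only [Fin.snocEquiv_apply, Fin.snoc_castSucc, Fin.snoc_last]
    rw [mul_comm (a s)]
    congr 2
    funext i
    induction i using Fin.addCases with
    | left i =>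
      rw [Fin.append_left, Function.comp_apply, divNat_cast_castAdd, modNat_cast_castAdd,
        Fin.snoc_castSucc]
    | right i =>
      rw [Fin.append_right, Function.comp_apply, divNat_cast_natAdd, modNat_cast_natAdd,
        Fin.snoc_last]

/-- Two blocks exchanged by `π` contribute the product of their total parities, which is zero, and
there are no inversions inside a block. -/
theorem inversionSum_blockPerm {n p : ℕ} (π : Equiv.Perm (Fin n)) (e : Fin n → Fin p → ZMod 2)
    (he : ∀ a, ∑ b, e a b = 0) :
    inversionSum (blockPerm p π) (fun i => e i.divNat i.modNat) = 0 := by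
  rw [inversionSum, ← finProdFinEquiv.sum_comp, Fintype.sum_prod_type]
  refine Finset.sum_eq_zero fun a _ => ?_
  simp only [← finProdFinEquiv.sum_comp (fun j : Fin (n * p) => _), Fintype.sum_prod_type,
    divNat_finProd, modNat_finProd, blockPerm_finProd, finProd_lt_iff]
  rw [Finset.sum_comm]
  refine Finset.sum_eq_zero fun a' _ => ?_
  have h : ∀ b b' : Fin p, ((a < a' ∨ a = a' ∧ b < b') ∧ (π a' < π a ∨ π a' = π a ∧ b' < b)) ↔
      (a < a' ∧ π a' < π a) := by
    intro b b'
    constructor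
    · rintro ⟨h1 | ⟨rfl, h1⟩, h2 | ⟨h2, h3⟩⟩
      · exact ⟨h1, h2⟩
      · exact absurd (π.injective h2) h1.ne'
      · exact absurd h2 (lt_irrefl _)
      · exact absurd h3 h1.not_gt
    · exact fun h => ⟨Or.inl h.1, Or.inl h.2⟩
  simp only [h]
  by_cases hc : a < a' ∧ π a' < π a
  · simp only [if_pos hc]
    rw [← Finset.sum_mul_sum, he, zero_mul]
  · simp [hc]

theorem evenPart_powGr_le {n : ℕ} {N : Submodule k (⨂[k]^n (Tot X))}
    (h : ∀ (deg : Fin n → ℤ) (m : Fin n → Tot X), (∀ i, m i ∈ homog X (deg i)) →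
      Even (∑ i, deg i) → PiTensorProduct.tprod k m ∈ N) : evenPart (powGr X n) ≤ N :=
  evenPart_le fun _ hr => powGr_le fun deg m hm h' => h deg m hm (h' ▸ hr)

/-- Permutations of the factors fix a tensor power of a tensor of even degree. -/
theorem bijAct_blockPerm_tensorPow {n p : ℕ} (π : Equiv.Perm (Fin n)) {x : ⨂[k]^p (Tot X)}
    (hx : x ∈ evenPart (powGr X p)) :
    bijAct X (blockPerm p π) (tensorPow X n x) = tensorPow X n x := by
  have hspan : evenPart (powGr X p) ≤ Submodule.span k {t | ∃ (deg : Fin p → ℤ) (m : Fin p → Tot X),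
      (∀ i, m i ∈ homog X (deg i)) ∧ Even (∑ i, deg i) ∧ t = PiTensorProduct.tprod k m} :=
    evenPart_powGr_le fun deg m hm he => Submodule.subset_span ⟨deg, m, hm, he, rfl⟩
  -- Write x as a finite sum of pure homogeneous tensors of even degree. A block permutation does
  -- not fix the individual terms of the expanded power; it permutes them without sign.
  obtain ⟨N, a, g, rfl⟩ := Submodule.mem_span_set'.1 (hspan hx)
  choose deg m hm he hg using fun i => (g i).2
  simp only [hg]
  rw [tensorPow_sum, map_sum]
  refine Fintype.sum_equiv (π.arrowCongr (Equiv.refl (Fin N))) _ _ fun c => ?_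
  rw [map_smul, bijAct_tprod (deg := fun i => deg (c i.divNat) i.modNat) _ (fun i => hm _ _),
    inversionSum_blockPerm π (fun a b => (deg (c a) b : ZMod 2)), paritySign_zero, one_smul]
  · congr 1
    · exact (π.symm.prod_comp fun i => a (c i)).symm
    · congr 1
      funext i
      obtain ⟨⟨b, j⟩, rfl⟩ := finProdFinEquiv.surjective i
      have : (blockPerm p π).symm (finProdFinEquiv (b, j)) = finProdFinEquiv (π.symm b, j) := by
        rw [Equiv.symm_apply_eq, blockPerm_finProd, Equiv.apply_symm_apply]
      simp only [Function.comp_apply, this, divNat_finProd, modNat_finProd]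
      rfl
  · intro b
    rw [← Int.cast_sum, ZMod.intCast_eq_zero_iff_even]
    exact he (c b)

/-- Each block shuffle is counted once for every permutation of the `n` blocks. -/
theorem shuffleSum_divNat_tensorPow {n p : ℕ} (hp : 1 ≤ p) {x : ⨂[k]^p (Tot X)}
    (hx : x ∈ evenPart (powGr X p)) :
    shuffleSum (Fin.divNat : Fin (n * p) → Fin n) (tensorPow X n x) =
      n ! • incl X (n * p) (powGamma X n x) := by
  classical
  rw [shuffleSum, sum_fiberMono_divNat hp]
  simp only [bijAct_mul, bijAct_blockPerm_tensorPow _ hx, Finset.sum_const, Finset.card_univ,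
    Fintype.card_perm, Fintype.card_fin]
  rw [powGamma, map_sum]
  simp only [permAct_eq_bijAct]

/-! ### `T(X)` as a semiring -/

variable (X) in
/-- `T(X)` with the shuffle product. -/
def Sh : Type (max u v) := T X

/-- An element of `T(X)` as an element of `Sh X`. -/
def toSh (x : T X) : Sh X := x

instance : AddCommMonoid (Sh X) := inferInstanceAs (AddCommMonoid (T X))

instance : Module k (Sh X) := inferInstanceAs (Module k (T X))

instance : Semiring (Sh X) :=
  { (inferInstance : AddCommMonoid (Sh X)) with
    mul := fun x y => shuffle X x y
    one := one X
    left_distrib := fun x _ _ => map_add (shuffle X x) _ _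
    right_distrib := fun _ _ z => LinearMap.map_add₂ (shuffle X) _ _ z
    zero_mul := fun z => LinearMap.map_zero₂ (shuffle X) z
    mul_zero := fun x => map_zero (shuffle X x)
    mul_assoc := shuffle_assoc
    one_mul := one_shuffle
    mul_one := shuffle_one }

instance : IsScalarTower k (Sh X) (Sh X) :=
  ⟨fun a x y => LinearMap.map_smul₂ (shuffle X) a x y⟩

variable (X) in
/-- The inclusion of `Tⁿ(X)` into `T(X)` with the shuffle product. -/
def shIncl (n : ℕ) : (⨂[k]^n (Tot X)) →ₗ[k] Sh X := incl X n

theorem npow_shuffle (a : T X) (n : ℕ) :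
    npow (shuffle X) (one X) a n = (toSh a ^ n : Sh X) := by
  induction n with
  | zero => rw [pow_zero]; rfl
  | succ n ih =>
    rw [pow_succ', ← ih, npow, Function.iterate_succ_apply']
    rfl

/-- Iterating `shuffle_shuffleSum` labels each factor by the number of its block, so the power is a
sum over permutations increasing on the `n` blocks. -/
theorem shIncl_pow {p : ℕ} (x : ⨂[k]^p (Tot X)) (n : ℕ) :
    shIncl X p x ^ n = shuffleSum (Fin.divNat : Fin (n * p) → Fin n) (tensorPow X n x) := by
  induction n with
  | zero =>
    rw [pow_zero, shuffleSum_cast (g := fun _ : Fin 0 => ()) (zero_mul p), tensorPow_zero,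
      ← incl_eq_shuffleSum]
    · rfl
    · exact fun i => (Fin.cast (zero_mul p) i).elim0
  | succ n ih =>
    rw [pow_succ, ih]
    change shuffle X _ (incl X p x) = _
    rw [incl_eq_shuffleSum, shuffle_shuffleSum, ← tensorPow_succ]
    symm
    refine shuffleSum_cast _ ?_ _
    intro i j
    obtain ⟨i, rfl⟩ := (finCongr (Nat.succ_mul n p)).symm.surjective i
    obtain ⟨j, rfl⟩ := (finCongr (Nat.succ_mul n p)).symm.surjective j
    simp only [finCongr_symm, finCongr_apply, Fin.cast_cast, Fin.cast_eq_self]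
    induction i using Fin.addCases <;> induction j using Fin.addCases <;>
      simp only [sumLabel_castAdd, sumLabel_natAdd, divNat_cast_castAdd, divNat_cast_natAdd,
        Sum.inl.injEq, Fin.castSucc_inj, reduceCtorEq, Fin.castSucc_ne_last, false_iff]
    · exact (Fin.castSucc_ne_last _).symm

/-- `n! γₙ(x) = xⁿ` for a tensor `x` of even degree. -/
theorem factorial_smul_powGamma {p : ℕ} (hp : 1 ≤ p) (n : ℕ) {x : ⨂[k]^p (Tot X)}
    (hx : x ∈ evenPart (powGr X p)) :
    n ! • shIncl X (n * p) (powGamma X n x) = shIncl X p x ^ n := by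
  rw [shIncl_pow, shuffleSum_divNat_tensorPow hp hx]
  rfl

end

end ShuffleAlg

namespace ShuffleAlg

open DGAlg

noncomputable section

variable {k : Type u} [CommRing k] {X : CochainComplex (ModuleCat.{v} k) ℤ}

/-! ### Elements of even degree -/

theorem comp_mem_evenPart {x : T X} (hx : x ∈ evenPart (gr X)) (n : ℕ) :
    comp X n x ∈ evenPart (powGr X n) := by
  suffices evenPart (gr X) ≤ (evenPart (powGr X n)).comap (comp X n) from this hx
  exact evenPart_le fun i hi y hy => mem_evenPart_of_mem hi (mem_gr_iff.1 hy n)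

theorem incl_mem_evenPart {n : ℕ} {x : ⨂[k]^n (Tot X)} (hx : x ∈ evenPart (powGr X n)) :
    incl X n x ∈ evenPart (gr X) := by
  suffices evenPart (powGr X n) ≤ (evenPart (gr X)).comap (incl X n) from this hx
  exact evenPart_le fun i hi y hy => mem_evenPart_of_mem hi (incl_mem_gr hy)

theorem incl_mem_evenPart_iff {n : ℕ} {x : ⨂[k]^n (Tot X)} :
    incl X n x ∈ evenPart (gr X) ↔ x ∈ evenPart (powGr X n) :=
  ⟨fun h => by simpa only [comp_incl] using comp_mem_evenPart h n, incl_mem_evenPart⟩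

theorem gr_iSup_induction {N : Submodule k (T X)} (h : ∀ i, gr X i ≤ N) (x : T X) : x ∈ N := by
  have : x ∈ ⨆ i, gr X i := (isGradingProj_gr X).iSup_eq_top ▸ Submodule.mem_top
  exact (iSup_le h : ⨆ i, gr X i ≤ N) this

theorem one_mem_evenPart : one X ∈ evenPart (gr X) := mem_evenPart_of_mem (by simp) one_mem_gr

theorem shuffle_mem_evenPart {x y : T X} (hx : x ∈ evenPart (gr X)) (hy : y ∈ evenPart (gr X)) :
    shuffle X x y ∈ evenPart (gr X) := by
  suffices evenPart (gr X) ≤ (evenPart (gr X)).comap ((shuffle X).flip y) from this hx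
  refine evenPart_le fun i hi x hx => ?_
  suffices evenPart (gr X) ≤ (evenPart (gr X)).comap (shuffle X x) from this hy
  exact evenPart_le fun j hj y hy => mem_evenPart_of_mem (hi.add hj) (shuffle_mem_gr hx hy)

/-- Elements of even degree are central. -/
theorem shuffle_comm_of_even {x : T X} (hx : x ∈ evenPart (gr X)) (y : T X) :
    shuffle X x y = shuffle X y x := by
  suffices evenPart (gr X) ≤ LinearMap.eqLocus ((shuffle X).flip y) (shuffle X y) from this hx
  refine evenPart_le fun i hi x hx => ?_
  suffices y ∈ LinearMap.eqLocus (shuffle X x) ((shuffle X).flip x) from this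
  refine gr_iSup_induction (fun j y hy => ?_) y
  rw [LinearMap.mem_eqLocus, shuffle_comm hx hy, ZMod.intCast_eq_zero_iff_even.2 (hi.mul_right j),
    paritySign_zero, one_smul]
  rfl

theorem commute_of_even {x : Sh X} (hx : (x : T X) ∈ evenPart (gr X)) (y : Sh X) : Commute x y :=
  shuffle_comm_of_even hx y

theorem leibniz_of_even {x : T X} (hx : x ∈ evenPart (gr X)) (y : T X) :
    d X (shuffle X x y) = shuffle X (d X x) y + shuffle X x (d X y) := by
  suffices evenPart (gr X) ≤ LinearMap.eqLocus (d X ∘ₗ (shuffle X).flip y)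
    ((shuffle X).flip y ∘ₗ d X + (shuffle X).flip (d X y)) from this hx
  refine evenPart_le fun i hi x hx => ?_
  have := leibniz hx y
  rwa [ZMod.intCast_eq_zero_iff_even.2 hi, paritySign_zero, one_smul] at this

theorem pow_mem_evenPart {x : Sh X} (hx : (x : T X) ∈ evenPart (gr X)) (n : ℕ) :
    (x ^ n : T X) ∈ evenPart (gr X) := by
  induction n with
  | zero => rw [pow_zero]; exact one_mem_evenPart
  | succ n ih => rw [pow_succ]; exact shuffle_mem_evenPart ih hx

variable (X) in
/-- The differential as a map on `Sh X`. -/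
def shD : Sh X →ₗ[k] Sh X := d X

theorem shD_one : shD X 1 = 0 := by
  have h : (1 : Sh X) = shIncl X 0 (PiTensorProduct.tprod k Fin.elim0) := rfl
  rw [h]
  change d X (incl X 0 _) = 0
  rw [d_incl, powD_eq_sum, Finset.univ_eq_empty, Finset.sum_empty, LinearMap.zero_apply, map_zero]

theorem shD_mul {x : Sh X} (hx : (x : T X) ∈ evenPart (gr X)) (y : Sh X) :
    shD X (x * y) = shD X x * y + x * shD X y := leibniz_of_even hx y

theorem shD_pow {x : Sh X} (hx : (x : T X) ∈ evenPart (gr X)) (n : ℕ) :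
    shD X (x ^ n) = n • (x ^ (n - 1) * shD X x) := by
  induction n with
  | zero => rw [pow_zero, shD_one, zero_smul]
  | succ n ih =>
    rw [pow_succ', shD_mul hx, ih, (commute_of_even (pow_mem_evenPart hx n) (shD X x)).eq.symm,
      Nat.add_sub_cancel, succ_nsmul']
    congr 1
    -- For n = 0 the truncated exponent n - 1 is harmless, as its coefficient is 0.
    rcases n with _ | n
    · simp
    · rw [Nat.add_sub_cancel, mul_smul_comm, ← mul_assoc, ← pow_succ']

/-! ### The ideal `T⁺(X)` -/

theorem mem_TPlus_iff {x : T X} : x ∈ TPlus X ↔ comp X 0 x = 0 := Iff.rfl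

theorem incl_mem_TPlus {n : ℕ} (hn : n ≠ 0) (x : ⨂[k]^n (Tot X)) : incl X n x ∈ TPlus X :=
  comp_incl_of_ne hn x

theorem TPlus_le {N : Submodule k (T X)} (h : ∀ n, n ≠ 0 → ∀ x, incl X n x ∈ N) :
    TPlus X ≤ N := by
  intro x hx
  obtain ⟨s, hs⟩ := exists_sum_incl x
  rw [hs]
  refine Submodule.sum_mem _ fun n _ => ?_
  rcases eq_or_ne n 0 with rfl | hn
  · rw [mem_TPlus_iff.1 hx, map_zero]; exact zero_mem _
  · exact h n hn _

theorem mem_TPlus_of_mem_tensorGr {n : ℕ} (hn : n ≠ 0) {x : T X} (hx : x ∈ tensorGr X n) :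
    x ∈ TPlus X := by
  obtain ⟨y, rfl⟩ := hx
  exact incl_mem_TPlus hn y

variable (X) in
theorem isDGIdeal_TPlus : IsDGIdeal (shuffle X) (gr X) (d X) (TPlus X) where
  homogeneous := (isGradingProj_gr X).le_iSup_inf fun r x hx => by
    rw [mem_TPlus_iff] at hx ⊢
    rw [grProj, comp_lmap, hx, map_zero]
  mul_mem_left a x hx := by
    suffices TPlus X ≤ (TPlus X).comap (shuffle X a) from this hx
    refine TPlus_le fun n hn x => ?_
    induction a using incl_induction with
    | zero => rw [Submodule.mem_comap, map_zero, LinearMap.zero_apply]; exact zero_mem _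
    | add a b ha hb =>
      rw [Submodule.mem_comap, map_add, LinearMap.add_apply]; exact add_mem ha hb
    | incl m a =>
      rw [Submodule.mem_comap, shuffle_incl]
      exact mem_TPlus_of_mem_tensorGr (by omega) (shuffleSum_mem_tensorGr _ _)
  mul_mem_right a x hx := by
    suffices TPlus X ≤ (TPlus X).comap ((shuffle X).flip a) from this hx
    refine TPlus_le fun n hn x => ?_
    rw [Submodule.mem_comap, LinearMap.flip_apply]
    induction a using incl_induction with
    | zero => rw [map_zero]; exact zero_mem _
    | add a b ha hb => rw [map_add]; exact add_mem ha hb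
    | incl m a =>
      rw [shuffle_incl]
      exact mem_TPlus_of_mem_tensorGr (by omega) (shuffleSum_mem_tensorGr _ _)
  d_mem x hx := by
    rw [mem_TPlus_iff] at hx ⊢
    rw [d, comp_lmap, hx, map_zero]

/-! ### The divided powers -/

theorem powGamma_eq {n p : ℕ} (x : ⨂[k]^p (Tot X)) [DecidablePred (IsBlockShuffle n p)] :
    powGamma X n x = ∑ σ : Equiv.Perm (Fin (n * p)) with IsBlockShuffle n p σ,
      bijAct X σ (tensorPow X n x) := by
  rw [powGamma]
  simp only [permAct_eq_bijAct]
  congr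

theorem shIncl_powGamma_zero {p : ℕ} (x : ⨂[k]^p (Tot X)) :
    shIncl X (0 * p) (powGamma X 0 x) = 1 := by
  classical
  have he : IsEmpty (Fin (0 * p)) := by rw [zero_mul]; infer_instance
  have hs :
      (Finset.univ.filter fun σ : Equiv.Perm (Fin (0 * p)) => IsBlockShuffle 0 p σ) = {1} := by
    ext σ
    simp only [Finset.mem_filter, Finset.mem_univ, true_and, Finset.mem_singleton]
    exact ⟨fun _ => Subsingleton.elim _ _, fun _ => ⟨fun a => a.elim0, fun _ _ a => a.elim0⟩⟩
  rw [powGamma_eq, hs, Finset.sum_singleton, bijAct_one]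
  change incl X (0 * p) _ = _
  rw [← lof_cast (zero_mul p), tensorPow_zero]
  rfl

theorem powGamma_of_zero {n : ℕ} (hn : n ≠ 0) (p : ℕ) :
    powGamma X n (0 : ⨂[k]^p (Tot X)) = 0 := by
  classical
  obtain ⟨n, rfl⟩ := Nat.exists_eq_succ_of_ne_zero hn
  have : tensorPow X (n + 1) (0 : ⨂[k]^p (Tot X)) = 0 :=
    cast_injective (Nat.succ_mul n p) (by rw [tensorPow_succ, map_zero, map_zero])
  rw [powGamma_eq, this]
  simp

theorem powGamma_mem_powGr (n : ℕ) {p : ℕ} {r : ℤ} {x : ⨂[k]^p (Tot X)} (hx : x ∈ powGr X p r) :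
    powGamma X n x ∈ powGr X (n * p) (n * r) := by
  classical
  rw [powGamma_eq]
  exact Submodule.sum_mem _ fun σ _ => bijAct_mem_powGr σ (tensorPow_mem_powGr n hx)

theorem bijAct_mem_evenPart {m n : ℕ} (σ : Fin m ≃ Fin n) {x : ⨂[k]^m (Tot X)}
    (hx : x ∈ evenPart (powGr X m)) : bijAct X σ x ∈ evenPart (powGr X n) := by
  suffices evenPart (powGr X m) ≤ (evenPart (powGr X n)).comap (bijAct X σ) from this hx
  exact evenPart_le fun i hi y hy => mem_evenPart_of_mem hi (bijAct_mem_powGr σ hy)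

theorem conc_mem_evenPart {m n : ℕ} {x : ⨂[k]^m (Tot X)} {y : ⨂[k]^n (Tot X)}
    (hx : x ∈ evenPart (powGr X m)) (hy : y ∈ evenPart (powGr X n)) :
    conc X m n x y ∈ evenPart (powGr X (m + n)) := by
  suffices evenPart (powGr X m) ≤ (evenPart (powGr X (m + n))).comap ((conc X m n).flip y) from
    this hx
  refine evenPart_le fun i hi x hx => ?_
  suffices evenPart (powGr X n) ≤ (evenPart (powGr X (m + n))).comap (conc X m n x) from this hy
  exact evenPart_le fun j hj y hy => mem_evenPart_of_mem (hi.add hj) (conc_mem_powGr hx hy)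

theorem tensorPow_mem_evenPart (n : ℕ) {p : ℕ} {x : ⨂[k]^p (Tot X)}
    (hx : x ∈ evenPart (powGr X p)) : tensorPow X n x ∈ evenPart (powGr X (n * p)) := by
  have key : ∀ {m l : ℕ} (h : m = l) (y : ⨂[k]^m (Tot X)),
      TensorPower.cast k (Tot X) h y ∈ evenPart (powGr X l) → y ∈ evenPart (powGr X m) := by
    intro m l h y hy
    subst h; simpa using hy
  induction n with
  | zero =>
    refine key (zero_mul p) _ ?_
    rw [tensorPow_zero, ← incl_mem_evenPart_iff]
    exact one_mem_evenPart
  | succ n ih =>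
    refine key (Nat.succ_mul n p) _ ?_
    rw [tensorPow_succ]
    exact conc_mem_evenPart ih hx

theorem powGamma_mem_evenPart (n : ℕ) {p : ℕ} {x : ⨂[k]^p (Tot X)}
    (hx : x ∈ evenPart (powGr X p)) : powGamma X n x ∈ evenPart (powGr X (n * p)) := by
  classical
  rw [powGamma_eq]
  exact Submodule.sum_mem _ fun σ _ => bijAct_mem_evenPart σ (tensorPow_mem_evenPart n hx)

/-! ### Extension of the divided powers to sums of tensors of different tensor degrees -/

variable (X) in
/-- The divided powers of the sum of the components of `x` of tensor degrees `1, …, N`. -/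
def truncGamma : ℕ → ℕ → T X → Sh X
  -- These are the divided powers of 0; the recursion then imposes the addition formula for
  -- adjoining the component of tensor degree N + 1.
  | 0, n, _ => if n = 0 then 1 else 0
  | N + 1, n, x => ∑ i ∈ Finset.range (n + 1),
      truncGamma N i x * shIncl X ((n - i) * (N + 1)) (powGamma X (n - i) (comp X (N + 1) x))

theorem truncGamma_succ_of_comp_eq_zero {N : ℕ} {x : T X} (h : comp X (N + 1) x = 0) (n : ℕ) :
    truncGamma X (N + 1) n x = truncGamma X N n x := by
  rw [truncGamma, Finset.sum_range_succ, Finset.sum_eq_zero, zero_add, Nat.sub_self,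
    shIncl_powGamma_zero, mul_one]
  intro i hi
  rw [h, powGamma_of_zero (by simp only [Finset.mem_range] at hi; omega), map_zero, mul_zero]

/-- Zero components do not contribute, so the value of `gamma` is independent of the chosen bound.
-/
theorem truncGamma_eq_of_le {N M : ℕ} (hNM : N ≤ M) {x : T X}
    (h : ∀ m, N < m → m ≤ M → comp X m x = 0) (n : ℕ) :
    truncGamma X M n x = truncGamma X N n x := by
  induction M, hNM using Nat.le_induction with
  | base => rfl
  | succ M hM ih => rw [truncGamma_succ_of_comp_eq_zero (h _ (by omega) le_rfl),
    ih fun m hm hM => h m hm (by omega)]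

variable (X) in
theorem exists_comp_eq_zero (x : T X) : ∃ N, ∀ m, N < m → comp X m x = 0 := by
  classical
  refine ⟨(DFinsupp.support x).sup id, fun m hm => ?_⟩
  by_contra hne
  have : m ∈ DFinsupp.support x := DFinsupp.mem_support_iff.2 hne
  exact hm.not_ge (Finset.le_sup (f := id) this)

variable (X) in
/-- The divided powers on `T⁺(X)`. -/
def gamma (n : ℕ) (x : T X) : T X := truncGamma X (exists_comp_eq_zero X x).choose n x

theorem gamma_eq_truncGamma {N : ℕ} {x : T X} (h : ∀ m, N < m → comp X m x = 0) (n : ℕ) :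
    gamma X n x = truncGamma X N n x := by
  have h' := (exists_comp_eq_zero X x).choose_spec
  rw [gamma, ← truncGamma_eq_of_le (le_max_left _ N) fun m hm _ => h' m hm,
    truncGamma_eq_of_le (le_max_right _ N) fun m hm _ => h m hm]

theorem truncGamma_zero (N : ℕ) (x : T X) : truncGamma X N 0 x = 1 := by
  induction N with
  | zero => simp [truncGamma]
  | succ N ih =>
    rw [truncGamma, Finset.sum_range_one, ih, one_mul, shIncl_powGamma_zero]

theorem gamma_zero (x : T X) : gamma X 0 x = one X := truncGamma_zero _ x

theorem gamma_incl (n : ℕ) {p : ℕ} (hp : 1 ≤ p) (x : ⨂[k]^p (Tot X)) :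
    gamma X n (incl X p x) = incl X (n * p) (powGamma X n x) := by
  obtain ⟨q, rfl⟩ := Nat.exists_eq_add_of_le' hp
  rw [gamma_eq_truncGamma (N := q + 1) fun m hm => comp_incl_of_ne (by omega) x, truncGamma]
  have h : ∀ i, truncGamma X q i (incl X (q + 1) x) = if i = 0 then 1 else 0 := fun i => by
    rw [truncGamma_eq_of_le (Nat.zero_le q) fun m _ hm => comp_incl_of_ne (by omega) x, truncGamma]
  rw [Finset.sum_eq_single_of_mem 0 (by simp), h, if_pos rfl, one_mul, comp_incl, Nat.sub_zero]
  · rfl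
  · intro i _ hi
    rw [h, if_neg hi, zero_mul]

variable (X) in
/-- The sum of the components of tensor degrees `1, …, N`. -/
def trunc (N : ℕ) (x : T X) : Sh X := ∑ p ∈ Finset.range N, shIncl X (p + 1) (comp X (p + 1) x)

theorem trunc_mem_evenPart (N : ℕ) {x : T X} (hx : x ∈ evenPart (gr X)) :
    (trunc X N x : T X) ∈ evenPart (gr X) :=
  Submodule.sum_mem (evenPart (gr X)) fun p _ => incl_mem_evenPart (comp_mem_evenPart hx (p + 1))

theorem trunc_eq {N : ℕ} {x : T X} (h0 : x ∈ TPlus X) (h : ∀ m, N < m → comp X m x = 0) :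
    trunc X N x = x := by
  refine T_ext fun m => ?_
  have hsum : comp X m (trunc X N x) =
      ∑ p ∈ Finset.range N, comp X m (incl X (p + 1) (comp X (p + 1) x)) :=
    map_sum (comp X m) (fun p => incl X (p + 1) (comp X (p + 1) x)) _
  rw [hsum]
  by_cases hm : m ∈ Finset.Icc 1 N
  · obtain ⟨q, rfl⟩ := Nat.exists_eq_add_of_le' (Finset.mem_Icc.1 hm).1
    rw [Finset.sum_eq_single_of_mem q, comp_incl]
    · simp only [Finset.mem_Icc] at hm
      simp only [Finset.mem_range]; omega
    · exact fun p _ hp => comp_incl_of_ne (by omega) _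
  · have hx : comp X m x = 0 := by
      rcases eq_or_ne m 0 with rfl | hm0
      · exact h0
      · refine h m ?_
        simp only [Finset.mem_Icc] at hm
        omega
    rw [hx]
    refine Finset.sum_eq_zero fun p hp => comp_incl_of_ne ?_ _
    rintro rfl
    simp only [Finset.mem_Icc, Finset.mem_range] at hm hp
    omega

/-- Multiplied by n!, the recursion becomes the binomial theorem, which applies because the even
truncation is central. -/
theorem factorial_smul_truncGamma (N n : ℕ) {x : T X} (hx : x ∈ evenPart (gr X)) :
    n ! • truncGamma X N n x = trunc X N x ^ n := by
  induction N generalizing n with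
  | zero =>
    rw [truncGamma, trunc, Finset.sum_range_zero]
    rcases n with _ | n
    · simp
    · simp
  | succ N ih =>
    have hc := commute_of_even (trunc_mem_evenPart N hx) (shIncl X (N + 1) (comp X (N + 1) x))
    rw [trunc, Finset.sum_range_succ, ← trunc, hc.add_pow, truncGamma, Finset.smul_sum]
    refine Finset.sum_congr rfl fun i hi => ?_
    have hin : i ≤ n := Nat.lt_succ_iff.1 (Finset.mem_range.1 hi)
    rw [← ih, ← factorial_smul_powGamma (by omega) _ (comp_mem_evenPart hx (N + 1)),
      ← Nat.choose_mul_factorial_mul_factorial hin, smul_mul_smul_comm, ← nsmul_eq_mul',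
      smul_smul, mul_assoc]

/-- `n! γₙ(x) = xⁿ` for `x ∈ T⁺(X)` of even degree. -/
theorem factorial_smul_gamma (n : ℕ) {x : T X} (hx : x ∈ TPlus X ⊓ evenPart (gr X)) :
    n ! • toSh (gamma X n x) = toSh x ^ n := by
  obtain ⟨N, hN⟩ := exists_comp_eq_zero X x
  rw [gamma_eq_truncGamma hN]
  have := factorial_smul_truncGamma N n hx.2
  rwa [trunc_eq hx.1 hN] at this

theorem truncGamma_mem_evenPart (N n : ℕ) {x : T X} (hx : x ∈ evenPart (gr X)) :
    (truncGamma X N n x : T X) ∈ evenPart (gr X) := by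
  induction N generalizing n with
  | zero =>
    rw [truncGamma]
    split_ifs
    · exact one_mem_evenPart
    · exact zero_mem _
  | succ N ih =>
    rw [truncGamma]
    exact Submodule.sum_mem (evenPart (gr X)) fun i _ => shuffle_mem_evenPart (ih i)
      (incl_mem_evenPart (powGamma_mem_evenPart _ (comp_mem_evenPart hx _)))

theorem truncGamma_mem_TPlus (N : ℕ) {n : ℕ} (hn : n ≠ 0) (x : T X) :
    (truncGamma X N n x : T X) ∈ TPlus X := by
  induction N generalizing n with
  | zero =>
    rw [truncGamma, if_neg hn]
    exact zero_mem _
  | succ N ih =>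
    rw [truncGamma]
    refine Submodule.sum_mem (TPlus X) fun i _ => ?_
    rcases eq_or_ne i 0 with rfl | hi
    · exact (isDGIdeal_TPlus X).mul_mem_left _ _
        (incl_mem_TPlus (Nat.mul_ne_zero (by omega) (by omega)) _)
    · exact (isDGIdeal_TPlus X).mul_mem_right _ _ (ih hi)

theorem gamma_mem {n : ℕ} (hn : 1 ≤ n) {x : T X} (hx : x ∈ evenPart (gr X)) :
    gamma X n x ∈ TPlus X ⊓ evenPart (gr X) :=
  ⟨truncGamma_mem_TPlus _ (by omega) x, truncGamma_mem_evenPart _ n hx⟩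

theorem truncGamma_mem_gr (N n : ℕ) {r : ℤ} {x : T X} (hx : x ∈ gr X r) :
    (truncGamma X N n x : T X) ∈ gr X (n * r) := by
  induction N generalizing n with
  | zero =>
    rw [truncGamma]
    split_ifs with h
    · subst h
      rw [Nat.cast_zero, zero_mul]
      exact one_mem_gr
    · exact zero_mem _
  | succ N ih =>
    rw [truncGamma]
    refine Submodule.sum_mem (gr X (n * r)) fun i hi => ?_
    have hin : i ≤ n := Nat.lt_succ_iff.1 (Finset.mem_range.1 hi)
    have h : (n * r : ℤ) = i * r + ((n - i : ℕ) : ℤ) * r := by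
      rw [Nat.cast_sub hin]; ring
    rw [h]
    exact shuffle_mem_gr (ih i) (incl_mem_gr (powGamma_mem_powGr _ (mem_gr_iff.1 hx _)))

theorem gamma_mem_gr (n : ℕ) {r : ℤ} {x : T X} (hx : x ∈ gr X r) : gamma X n x ∈ gr X (n * r) :=
  truncGamma_mem_gr _ n hx

end

end ShuffleAlg

namespace ShuffleAlg

open DGAlg

noncomputable section

variable {k : Type u} [CommRing k] {X : CochainComplex (ModuleCat.{v} k) ℤ}

/-! ### The divided powers in the torsion-free case -/

variable (X) in
/-- `T⁺(X)_ev` as a set of elements of `Sh X`. -/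
def plusEven : Set (Sh X) := ((TPlus X ⊓ evenPart (gr X) : Submodule k (T X)) : Set (T X))

variable (X) in
/-- The divided powers as maps on `Sh X`. -/
def shGamma (n : ℕ) (x : Sh X) : Sh X := gamma X n x

variable (X) in
/-- `T(X)` has no torsion as an abelian group. -/
def IsTorsionFree : Prop := ∀ n : ℕ, n ≠ 0 → ∀ x y : Sh X, n • x = n • y → x = y

theorem factorial_smul_shGamma (n : ℕ) {x : Sh X} (hx : x ∈ plusEven X) :
    n ! • shGamma X n x = x ^ n := factorial_smul_gamma n hx

namespace IsTorsionFree

/-- Multiply by n! m! and compare powers of x; the other identities of this section follow the same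
pattern. -/
theorem gamma_mul (htf : IsTorsionFree X) (n m : ℕ) {x : Sh X} (hx : x ∈ plusEven X) :
    shGamma X n x * shGamma X m x = (n + m).choose m • shGamma X (n + m) x := by
  refine htf (n ! * m !) (by positivity) _ _ ?_
  rw [← smul_mul_smul_comm, factorial_smul_shGamma n hx, factorial_smul_shGamma m hx, smul_smul,
    ← pow_add, ← factorial_smul_shGamma (n + m) hx, ← Nat.add_choose_mul_factorial_mul_factorial]
  congr 1
  ring

theorem mul_mem_plusEven {a x : Sh X} (ha : (a : T X) ∈ evenPart (gr X))
    (hx : x ∈ plusEven X) : a * x ∈ plusEven X :=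
  ⟨(isDGIdeal_TPlus X).mul_mem_left _ _ hx.1, shuffle_mem_evenPart ha hx.2⟩

theorem gamma_smul (htf : IsTorsionFree X) (n : ℕ) {a x : Sh X}
    (ha : (a : T X) ∈ evenPart (gr X)) (hx : x ∈ plusEven X) :
    shGamma X n (a * x) = a ^ n * shGamma X n x := by
  refine htf n ! (by positivity) _ _ ?_
  rw [factorial_smul_shGamma n (mul_mem_plusEven ha hx), ← mul_smul_comm,
    factorial_smul_shGamma n hx, (commute_of_even (x := a) ha x).mul_pow]

theorem gamma_add (htf : IsTorsionFree X) (n : ℕ) {x y : Sh X} (hx : x ∈ plusEven X)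
    (hy : y ∈ plusEven X) :
    shGamma X n (x + y) = ∑ i ∈ Finset.range (n + 1), shGamma X i x * shGamma X (n - i) y := by
  refine htf n ! (by positivity) _ _ ?_
  have hxy : x + y ∈ plusEven X := (TPlus X ⊓ evenPart (gr X)).add_mem hx hy
  rw [factorial_smul_shGamma n hxy, (commute_of_even (x := x) hx.2 y).add_pow, Finset.smul_sum]
  refine Finset.sum_congr rfl fun i hi => ?_
  have hin : i ≤ n := Nat.lt_succ_iff.1 (Finset.mem_range.1 hi)
  rw [← factorial_smul_shGamma i hx, ← factorial_smul_shGamma (n - i) hy,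
    ← Nat.choose_mul_factorial_mul_factorial hin, smul_mul_smul_comm, ← nsmul_eq_mul',
    smul_smul, mul_assoc]

theorem gamma_comp (htf : IsTorsionFree X) (p : ℕ) {q : ℕ} (hq : 1 ≤ q) {x : Sh X}
    (hx : x ∈ plusEven X) :
    shGamma X p (shGamma X q x) = ((p * q)! / (p ! * q ! ^ p)) • shGamma X (p * q) x := by
  refine htf (p ! * q ! ^ p) (by positivity) _ _ ?_
  -- The quotient counts partitions of pq elements into p blocks of size q, so the natural-number
  -- division is exact.
  have hdvd : p ! * q ! ^ p ∣ (p * q)! :=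
    ⟨p.uniformBell q, by rw [← Nat.uniformBell_mul_eq p (Nat.one_le_iff_ne_zero.1 hq)]; ring⟩
  rw [smul_smul, Nat.mul_div_cancel' hdvd, factorial_smul_shGamma (p * q) hx, mul_comm (p !),
    mul_smul, factorial_smul_shGamma p (x := shGamma X q x) (gamma_mem hq hx.2), ← smul_pow,
    factorial_smul_shGamma q hx, ← pow_mul, mul_comm]

theorem gamma_odd (htf : IsTorsionFree X) {n : ℕ} (hn : 2 ≤ n) {i j : ℤ} (hi : Odd i) (hj : Odd j)
    {x y : Sh X} (hx : (x : T X) ∈ gr X i)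
    (hy : (y : T X) ∈ TPlus X ⊓ gr X j) : shGamma X n (x * y) = 0 := by
  refine htf n ! (by positivity) _ _ ?_
  have hmem : x * y ∈ plusEven X := ⟨(isDGIdeal_TPlus X).mul_mem_left _ _ hy.1,
    mem_evenPart_of_mem (hi.add_odd hj) (shuffle_mem_gr hx hy.2)⟩
  have hyx : y * x = paritySign k ((j * i : ℤ) : ZMod 2) • (x * y) := shuffle_comm hy.2 hx
  have hyy : y * y = 0 := shuffle_self hj hy.2
  -- Moving the inner x past y up to sign isolates y y = 0; hence all powers of x y from the second
  -- on vanish.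
  have hsq : (x * y) * (x * y) = 0 := by
    rw [mul_assoc, ← mul_assoc y, hyx, smul_mul_assoc, mul_assoc x y y, hyy]
    simp
  obtain ⟨m, rfl⟩ := Nat.exists_eq_add_of_le hn
  rw [factorial_smul_shGamma _ hmem, pow_add, pow_two, hsq, zero_mul, smul_zero]

theorem d_gamma (htf : IsTorsionFree X) {n : ℕ} (hn : 1 ≤ n) {x : Sh X} (hx : x ∈ plusEven X) :
    shD X (shGamma X n x) = shGamma X (n - 1) x * shD X x := by
  refine htf n ! (by positivity) _ _ ?_
  obtain ⟨m, rfl⟩ := Nat.exists_eq_add_of_le' hn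
  rw [← map_nsmul, factorial_smul_shGamma _ hx, shD_pow (x := x) hx.2, Nat.add_sub_cancel,
    Nat.factorial_succ, mul_smul, ← smul_mul_assoc (m !), factorial_smul_shGamma m hx]

end IsTorsionFree

theorem gamma_one {x : T X} (hx : x ∈ TPlus X ⊓ evenPart (gr X)) : gamma X 1 x = x := by
  have : 1 ! • toSh (gamma X 1 x) = toSh x ^ 1 := factorial_smul_gamma 1 hx
  rwa [Nat.factorial_one, one_smul, pow_one] at this

end

end ShuffleAlg

universe w

namespace ShuffleAlg

open DGAlg

noncomputable section

/-! ### Functoriality -/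

section Functoriality

variable {k : Type u} [CommRing k] {X : CochainComplex (ModuleCat.{v} k) ℤ}
  {K : Type*} [CommRing K] {ρ : K →+* k} {Y : CochainComplex (ModuleCat.{w} K) ℤ}
  (f : ∀ i, Y.X i →ₛₗ[ρ] X.X i)

/-- The map `⨁ i, Yⁱ → ⨁ i, Xⁱ` induced by semilinear maps. -/
def totMap : Tot Y →ₛₗ[ρ] Tot X :=
  { DirectSum.map fun i => (f i).toAddMonoidHom with
    map_smul' := fun c y => DFinsupp.ext fun i => (f i).map_smulₛₗ c (y i) }

theorem totMap_lof (i : ℤ) (y : Y.X i) :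
    totMap f (DirectSum.lof K ℤ (fun i => Y.X i) i y) =
      DirectSum.lof k ℤ (fun i => X.X i) i (f i y) :=
  DirectSum.map_of (fun i => (f i).toAddMonoidHom) i y

theorem totMap_mem_homog {r : ℤ} {y : Tot Y} (hy : y ∈ homog Y r) : totMap f y ∈ homog X r := by
  obtain ⟨z, rfl⟩ := hy
  rw [totMap_lof]
  exact lof_mem_homog _ _

theorem totMap_comp_update {n : ℕ} [DecidableEq (Fin n)] (m : Fin n → Tot Y) (i : Fin n)
    (a : Tot Y) : (fun j => totMap f (Function.update m i a j)) =
      Function.update (fun j => totMap f (m j)) i (totMap f a) := by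
  funext j
  by_cases h : j = i
  · subst h; simp
  · simp [h]

/-- The additive map `Tⁿ(Y) → Tⁿ(X)` underlying `powMap`. -/
def powAddMap (n : ℕ) : (⨂[K]^n (Tot Y)) →+ (⨂[k]^n (Tot X)) :=
  PiTensorProduct.liftAddHom
    (fun p => ρ p.1 • PiTensorProduct.tprod k fun i => totMap f (p.2 i))
    (fun r m i h => by
      rw [MultilinearMap.map_coord_zero _ i (by simp only [h, map_zero]), smul_zero])
    (fun m => by simp)
    (fun r m i a b => by
      simp only [totMap_comp_update, map_add, MultilinearMap.map_update_add, smul_add])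
    (fun r r' m => by simp only [map_add, add_smul])
    (fun r m i r' => by
      simp only [totMap_comp_update, map_smulₛₗ, MultilinearMap.map_update_smul,
        Function.update_eq_self, smul_smul, map_mul, mul_comm])

/-- The map `Tⁿ(Y) → Tⁿ(X)`. -/
def powMap (n : ℕ) : (⨂[K]^n (Tot Y)) →ₛₗ[ρ] (⨂[k]^n (Tot X)) :=
  { powAddMap f n with
    map_smul' := fun c x => by
      induction x using PiTensorProduct.induction_on' with
      | tprodCoeff r m =>
        change (powAddMap f n) (PiTensorProduct.tprodCoeff K (c * r) m) =
          ρ c • (powAddMap f n) (PiTensorProduct.tprodCoeff K r m)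
        change ρ (c * r) • (PiTensorProduct.tprod k fun i => totMap f (m i)) =
          ρ c • ρ r • PiTensorProduct.tprod k fun i => totMap f (m i)
        rw [map_mul, mul_smul]
      | add x y hx hy =>
        change powAddMap f n _ = _ • powAddMap f n _ at hx hy
        change powAddMap f n _ = _ • powAddMap f n _
        rw [smul_add, map_add, map_add, hx, hy, smul_add] }

theorem powMap_tprod {n : ℕ} (m : Fin n → Tot Y) :
    powMap f n (PiTensorProduct.tprod K m) = PiTensorProduct.tprod k fun i => totMap f (m i) := by
  rw [PiTensorProduct.tprod_eq_tprodCoeff_one]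
  change ρ 1 • (PiTensorProduct.tprod k fun i => totMap f (m i)) = _
  rw [map_one, one_smul]

theorem map_paritySign {R S : Type*} [Ring R] [Ring S] (g : R →+* S) (e : ZMod 2) :
    g (paritySign R e) = paritySign S e := by
  rcases zmod_two_cases e with rfl | rfl <;> simp

/-- Signs are integers, so a change of base ring respects them. -/
theorem powMap_paritySign_smul {n : ℕ} (e : ZMod 2) (x : ⨂[K]^n (Tot Y)) :
    powMap f n (paritySign K e • x) = paritySign k e • powMap f n x := by
  rw [map_smulₛₗ, map_paritySign]

/-- Semilinear maps on `Tⁿ(Y)` agree if they agree on tensors of homogeneous elements. -/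
theorem ext_homog_semilinear {n : ℕ} {N : Type*} [AddCommMonoid N] [Module k N]
    {F G : (⨂[K]^n (Tot Y)) →ₛₗ[ρ] N}
    (h : ∀ (deg : Fin n → ℤ) (m : Fin n → Tot Y), (∀ i, m i ∈ homog Y (deg i)) →
      F (PiTensorProduct.tprod K m) = G (PiTensorProduct.tprod K m)) : F = G := by
  refine LinearMap.ext_on (span_tprod_homog (X := Y) n) ?_
  rintro _ ⟨j, rfl⟩
  exact h (fun i => (j i).1) _ fun i => (j i).2.2

theorem powMap_bijAct {m n : ℕ} (σ : Fin m ≃ Fin n) (y : ⨂[K]^m (Tot Y)) :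
    powMap f n (bijAct Y σ y) = bijAct X σ (powMap f m y) := by
  suffices (powMap f n).comp (bijAct Y σ) = (bijAct X σ).comp (powMap f m) from
    LinearMap.congr_fun this y
  refine ext_homog_semilinear fun deg a ha => ?_
  rw [LinearMap.comp_apply, LinearMap.comp_apply, bijAct_tprod σ ha, powMap_paritySign_smul,
    powMap_tprod, powMap_tprod, bijAct_tprod σ fun i => totMap_mem_homog f (ha i)]
  rfl

theorem powMap_conc {m n : ℕ} (x : ⨂[K]^m (Tot Y)) (y : ⨂[K]^n (Tot Y)) :
    powMap f (m + n) (conc Y m n x y) = conc X m n (powMap f m x) (powMap f n y) := by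
  suffices (powMap f (m + n)).comp ((conc Y m n).flip y) =
      ((conc X m n).flip (powMap f n y)).comp (powMap f m) from LinearMap.congr_fun this x
  refine ext_homog_semilinear fun deg a ha => ?_
  suffices (powMap f (m + n)).comp (conc Y m n (PiTensorProduct.tprod K a)) =
      (conc X m n (powMap f m (PiTensorProduct.tprod K a))).comp (powMap f n) from
    LinearMap.congr_fun this y
  refine ext_homog_semilinear fun deg' b hb => ?_
  rw [LinearMap.comp_apply, LinearMap.comp_apply, conc_tprod, powMap_tprod, powMap_tprod,
    powMap_tprod, conc_tprod]
  congr 1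
  funext i
  induction i using Fin.addCases <;> simp

theorem powMap_cast {m n : ℕ} (h : m = n) (y : ⨂[K]^m (Tot Y)) :
    powMap f n (TensorPower.cast K (Tot Y) h y) = TensorPower.cast k (Tot X) h (powMap f m y) := by
  subst h; simp

theorem powMap_tensorPow (n : ℕ) {p : ℕ} (y : ⨂[K]^p (Tot Y)) :
    powMap f (n * p) (tensorPow Y n y) = tensorPow X n (powMap f p y) := by
  induction n with
  | zero =>
    refine cast_injective (zero_mul p) ?_
    rw [← powMap_cast, tensorPow_zero, tensorPow_zero, powMap_tprod]
    congr 1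
    funext i
    exact i.elim0
  | succ n ih =>
    refine cast_injective (Nat.succ_mul n p) ?_
    rw [← powMap_cast, tensorPow_succ, tensorPow_succ, powMap_conc, ih]

theorem powMap_powGamma (n : ℕ) {p : ℕ} (y : ⨂[K]^p (Tot Y)) :
    powMap f (n * p) (powGamma Y n y) = powGamma X n (powMap f p y) := by
  classical
  simp only [powGamma_eq, map_sum, powMap_bijAct, powMap_tensorPow]

theorem totMap_totD (hf : ∀ i (y : Y.X i), f (i + 1) ((Y.d i (i + 1)).hom y) =
      (X.d i (i + 1)).hom (f i y)) (y : Tot Y) : totMap f (totD Y y) = totD X (totMap f y) := by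
  induction y using DirectSum.induction_on with
  | zero => simp only [map_zero]
  | of i y =>
    change totMap f (totD Y (DirectSum.lof K ℤ (fun i => Y.X i) i y)) =
      totD X (totMap f (DirectSum.lof K ℤ (fun i => Y.X i) i y))
    rw [totD_lof, totMap_lof, totMap_lof, totD_lof, hf]
  | add x y hx hy => simp only [map_add, hx, hy]

theorem powMap_powD (hf : ∀ i (y : Y.X i), f (i + 1) ((Y.d i (i + 1)).hom y) =
      (X.d i (i + 1)).hom (f i y)) (n : ℕ) (y : ⨂[K]^n (Tot Y)) :
    powMap f n (powD Y n y) = powD X n (powMap f n y) := by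
  suffices (powMap f n).comp (powD Y n) = (powD X n).comp (powMap f n) from
    LinearMap.congr_fun this y
  refine ext_homog_semilinear fun deg a ha => ?_
  rw [LinearMap.comp_apply, LinearMap.comp_apply, powD_eq_sum, powD_eq_sum, LinearMap.sum_apply,
    map_sum, LinearMap.sum_apply]
  refine Finset.sum_congr rfl fun i _ => ?_
  rw [powDTerm_tprod i ha, powMap_paritySign_smul, powMap_tprod, powMap_tprod,
    powDTerm_tprod i fun i => totMap_mem_homog f (ha i), totMap_comp_update, totMap_totD f hf]

/-- Pure homogeneous tensors lift factor by factor, scalars through `ρ`. Surjectivity of `ρ` matters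
already for the zeroth tensor power, which is the base ring. -/
theorem exists_powMap_eq (hρ : Function.Surjective ρ) (hs : ∀ i, Function.Surjective (f i)) {n : ℕ}
    {r : ℤ} {x : ⨂[k]^n (Tot X)} (hx : x ∈ powGr X n r) : ∃ y ∈ powGr Y n r, powMap f n y = x := by
  induction hx using Submodule.span_induction with
  | zero => exact ⟨0, zero_mem _, map_zero _⟩
  | add x y _ _ hx hy =>
    obtain ⟨x', hx', rfl⟩ := hx
    obtain ⟨y', hy', rfl⟩ := hy
    exact ⟨x' + y', add_mem hx' hy', map_add _ _ _⟩
  | smul a x _ hx =>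
    obtain ⟨x', hx', rfl⟩ := hx
    obtain ⟨c, rfl⟩ := hρ a
    exact ⟨c • x', Submodule.smul_mem _ c hx', map_smulₛₗ _ _ _⟩
  | mem x hx =>
    obtain ⟨deg, x, hr, rfl⟩ := hx
    choose g hg using hs
    refine ⟨PiTensorProduct.tprod K fun i => DirectSum.lof K ℤ (fun i => Y.X i) (deg i)
      (g (deg i) (x i)), ?_, ?_⟩
    · rw [← hr]
      exact tprod_mem_powGr fun i => lof_mem_homog _ _
    · rw [powMap_tprod]
      simp only [totMap_lof, hg]

/-- The additive map `T(Y) → T(X)`. -/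
def tMap : T Y →+ T X := DirectSum.map fun n => (powMap f n).toAddMonoidHom

theorem tMap_incl (n : ℕ) (y : ⨂[K]^n (Tot Y)) : tMap f (incl Y n y) = incl X n (powMap f n y) :=
  DirectSum.map_of (fun n => (powMap f n).toAddMonoidHom) n y

theorem comp_tMap (n : ℕ) (y : T Y) : comp X n (tMap f y) = powMap f n (comp Y n y) := rfl

theorem tMap_one : tMap f (one Y) = one X := by
  change tMap f (incl Y 0 _) = _
  rw [tMap_incl, powMap_tprod]
  change incl X 0 _ = incl X 0 _
  congr 2
  funext i
  exact i.elim0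

theorem tMap_shuffle (x y : T Y) :
    tMap f (shuffle Y x y) = shuffle X (tMap f x) (tMap f y) := by
  induction x using incl_induction with
  | zero => simp only [map_zero, LinearMap.zero_apply]
  | add x x' hx hx' => simp only [map_add, LinearMap.add_apply, hx, hx']
  | incl m x =>
    induction y using incl_induction with
    | zero => simp only [map_zero]
    | add y y' hy hy' => simp only [map_add, hy, hy']
    | incl n y =>
      simp only [shuffle_incl, tMap_incl, shuffleSum, map_sum, powMap_bijAct, powMap_conc]

theorem tMap_d (hf : ∀ i (y : Y.X i), f (i + 1) ((Y.d i (i + 1)).hom y) =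
      (X.d i (i + 1)).hom (f i y)) (y : T Y) : tMap f (d Y y) = d X (tMap f y) := by
  induction y using incl_induction with
  | zero => simp only [map_zero]
  | add x y hx hy => simp only [map_add, hx, hy]
  | incl n y => rw [d_incl, tMap_incl, tMap_incl, d_incl, powMap_powD f hf]

/-- The map `T(Y) → T(X)` as a homomorphism for the shuffle products. -/
def shMap : Sh Y →+* Sh X :=
  { (tMap f : T Y →+ T X) with
    toFun := tMap f
    map_one' := tMap_one f
    map_mul' := tMap_shuffle f }

theorem shMap_shIncl (n : ℕ) (y : ⨂[K]^n (Tot Y)) :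
    shMap f (shIncl Y n y) = shIncl X n (powMap f n y) := tMap_incl f n y

theorem shMap_truncGamma (N n : ℕ) (y : T Y) :
    shMap f (truncGamma Y N n y) = truncGamma X N n (tMap f y) := by
  induction N generalizing n with
  | zero =>
    rw [truncGamma, truncGamma]
    split_ifs
    · exact map_one _
    · exact map_zero _
  | succ N ih =>
    rw [truncGamma, truncGamma, map_sum]
    refine Finset.sum_congr rfl fun i _ => ?_
    rw [map_mul, ih, shMap_shIncl, powMap_powGamma, comp_tMap]

/-- The map preserves vanishing of components, so one bound serves on both sides; block shuffle sums
and products are natural. -/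
theorem tMap_gamma (n : ℕ) (y : T Y) : tMap f (gamma Y n y) = gamma X n (tMap f y) := by
  obtain ⟨N, hN⟩ := exists_comp_eq_zero Y y
  rw [gamma_eq_truncGamma hN,
    gamma_eq_truncGamma (N := N) fun m hm => by rw [comp_tMap, hN m hm, map_zero]]
  exact shMap_truncGamma f N n y

theorem shMap_shGamma (n : ℕ) (y : Sh Y) : shMap f (shGamma Y n y) = shGamma X n (shMap f y) :=
  tMap_gamma f n y

theorem shMap_shD (hf : ∀ i (y : Y.X i), f (i + 1) ((Y.d i (i + 1)).hom y) =
      (X.d i (i + 1)).hom (f i y)) (y : Sh Y) : shMap f (shD Y y) = shD X (shMap f y) :=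
  tMap_d f hf y

theorem exists_tMap_eq_of_mem_gr (hρ : Function.Surjective ρ)
    (hs : ∀ i, Function.Surjective (f i)) {r : ℤ} {x : T X} (hx : x ∈ gr X r) :
    ∃ y ∈ gr Y r, tMap f y = x ∧ (x ∈ TPlus X → y ∈ TPlus Y) := by
  have h : ∀ n, ∃ y ∈ gr Y r, tMap f y = incl X n (comp X n x) ∧ (x ∈ TPlus X → y ∈ TPlus Y) := by
    intro n
    -- A vanishing component of tensor degree 0 must be lifted by 0, so that the lift stays in T⁺.
    by_cases hn : n = 0 ∧ x ∈ TPlus X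
    · obtain ⟨rfl, hx⟩ := hn
      exact ⟨0, zero_mem _, by rw [mem_TPlus_iff.1 hx, map_zero, map_zero], fun _ => zero_mem _⟩
    · obtain ⟨y, hy, he⟩ := exists_powMap_eq f hρ hs (mem_gr_iff.1 hx n)
      exact ⟨incl Y n y, incl_mem_gr hy, by rw [tMap_incl, he],
        fun h => incl_mem_TPlus (fun h0 => hn ⟨h0, h⟩) y⟩
  choose y hy he hplus using h
  obtain ⟨s, hsum⟩ := exists_sum_incl x
  refine ⟨∑ n ∈ s, y n, Submodule.sum_mem _ fun n _ => hy n, ?_,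
    fun h => Submodule.sum_mem _ fun n _ => hplus n h⟩
  rw [map_sum, Finset.sum_congr rfl fun n _ => he n]
  exact hsum.symm

theorem exists_tMap_eq_of_mem_evenPart (hρ : Function.Surjective ρ)
    (hs : ∀ i, Function.Surjective (f i)) {x : T X} (hx : x ∈ evenPart (gr X)) :
    ∃ y ∈ evenPart (gr Y), tMap f y = x ∧ (x ∈ TPlus X → y ∈ TPlus Y) := by
  have h : ∀ i, ∃ y ∈ evenPart (gr Y), tMap f y = grProj X i x ∧ (x ∈ TPlus X → y ∈ TPlus Y) := by
    intro i
    rcases Int.even_or_odd i with hi | hi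
    · obtain ⟨y, hy, he, hp⟩ :=
        exists_tMap_eq_of_mem_gr f hρ hs ((isGradingProj_gr X).proj_mem i x)
      refine ⟨y, mem_evenPart_of_mem hi hy, he, fun h => hp ?_⟩
      rw [mem_TPlus_iff] at h ⊢
      rw [grProj, comp_lmap, h, map_zero]
    · exact ⟨0, zero_mem _, by rw [(isGradingProj_gr X).mem_evenPart_iff.1 hx i hi, map_zero],
        fun _ => zero_mem _⟩
  choose y hy he hplus using h
  obtain ⟨-, s, hsum⟩ := (isGradingProj_gr X).exists_sum x
  refine ⟨∑ i ∈ s, y i, Submodule.sum_mem _ fun n _ => hy n, ?_,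
    fun h => Submodule.sum_mem _ fun n _ => hplus n h⟩
  rw [map_sum, Finset.sum_congr rfl fun n _ => he n]
  exact hsum.symm

end Functoriality

end

end ShuffleAlg

namespace ShuffleAlg

open DGAlg

noncomputable section

/-! ### A free cover of a complex -/

section FreeCover

variable {k : Type u} [CommRing k] (X : CochainComplex (ModuleCat.{v} k) ℤ)

/-- The base change to the polynomial ring over `ℤ` with one variable for each element of `k`. -/
def evalHom (k : Type u) [CommRing k] : MvPolynomial k ℤ →+* k :=
  MvPolynomial.eval₂Hom (Int.castRingHom k) id

theorem evalHom_surjective : Function.Surjective (evalHom k) := fun c =>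
  ⟨MvPolynomial.X c, by simp [evalHom]⟩

/-- The generators in degree `i` of the free cover: a generator for each element of `Xⁱ`, and the
differential of a generator for each element of `Xⁱ⁻¹`. -/
abbrev coverGen (i : ℤ) : Type v := X.X i ⊕ {p : Σ j : ℤ, X.X j // p.1 + 1 = i}

/-- The differential of the free cover. -/
def coverD (i : ℤ) : (coverGen X i →₀ MvPolynomial k ℤ) →ₗ[MvPolynomial k ℤ]
    (coverGen X (i + 1) →₀ MvPolynomial k ℤ) :=
  Finsupp.linearCombination (MvPolynomial k ℤ)
    (Sum.elim (fun x => Finsupp.single (Sum.inr ⟨⟨i, x⟩, rfl⟩) 1) fun _ => 0)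

theorem coverD_comp_coverD (i : ℤ) : coverD X (i + 1) ∘ₗ coverD X i = 0 := by
  refine Finsupp.lhom_ext' fun g => LinearMap.ext_ring ?_
  rcases g with x | p <;> simp [coverD]

/-- A complex of free modules over a polynomial ring with a surjection onto `X`. -/
def cover : CochainComplex (ModuleCat.{max u v} (MvPolynomial k ℤ)) ℤ :=
  CochainComplex.of (fun i => ModuleCat.of _ (coverGen X i →₀ MvPolynomial k ℤ))
    (fun i => ModuleCat.ofHom (coverD X i)) fun i => by
      rw [← ModuleCat.ofHom_comp, coverD_comp_coverD]; rfl

/-- The element of `Xⁱ` corresponding to a generator. -/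
def coverVal (i : ℤ) : coverGen X i → X.X i :=
  Sum.elim id fun p => (X.d p.1.1 i).hom p.1.2

/-- The additive map underlying `coverMap`. -/
def coverAddMap (i : ℤ) : (coverGen X i →₀ MvPolynomial k ℤ) →+ X.X i :=
  Finsupp.liftAddHom fun g =>
    ((smulAddHom k (X.X i)).flip (coverVal X i g)).comp (evalHom k).toAddMonoidHom

theorem coverAddMap_single (i : ℤ) (g : coverGen X i) (a : MvPolynomial k ℤ) :
    coverAddMap X i (Finsupp.single g a) = evalHom k a • coverVal X i g :=
  Finsupp.liftAddHom_apply_single _ g a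

theorem coverAddMap_smul (i : ℤ) (c : MvPolynomial k ℤ) (x : coverGen X i →₀ MvPolynomial k ℤ) :
    coverAddMap X i (c • x) = evalHom k c • coverAddMap X i x := by
  induction x using Finsupp.induction_linear with
  | zero => simp only [smul_zero, map_zero]
  | add x y hx hy => rw [smul_add, map_add, map_add, hx, hy, smul_add]
  | single g a =>
    rw [Finsupp.smul_single, coverAddMap_single, coverAddMap_single, smul_eq_mul, map_mul, mul_smul]

/-- The surjection of the free cover onto `X`. -/
def coverMap (i : ℤ) : (coverGen X i →₀ MvPolynomial k ℤ) →ₛₗ[evalHom k] X.X i :=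
  { coverAddMap X i with map_smul' := coverAddMap_smul X i }

theorem coverMap_single (i : ℤ) (g : coverGen X i) (a : MvPolynomial k ℤ) :
    coverMap X i (Finsupp.single g a) = evalHom k a • coverVal X i g :=
  coverAddMap_single X i g a

theorem coverMap_surjective (i : ℤ) : Function.Surjective (coverMap X i) := fun x =>
  ⟨Finsupp.single (Sum.inl x) 1, by rw [coverMap_single, map_one, one_smul]; rfl⟩

theorem coverMap_coverD (i : ℤ) (y : coverGen X i →₀ MvPolynomial k ℤ) :
    coverMap X (i + 1) (coverD X i y) = (X.d i (i + 1)).hom (coverMap X i y) := by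
  induction y using Finsupp.induction_linear with
  | zero => simp only [map_zero]
  | add x y hx hy => simp only [map_add, hx, hy]
  | single g a =>
    rw [coverMap_single, coverD, Finsupp.linearCombination_single, map_smulₛₗ, map_smul]
    congr 1
    rcases g with x | ⟨⟨j, x⟩, rfl⟩
    · rw [Sum.elim_inl, coverMap_single, map_one, one_smul]
      rfl
    · rw [Sum.elim_inr, map_zero]
      -- On a generator standing for a differential, compatibility is d² = 0 in X.
      change (0 : X.X (j + 1 + 1)) = (X.d (j + 1) (j + 1 + 1)).hom ((X.d j (j + 1)).hom x)
      rw [← LinearMap.comp_apply, ← ModuleCat.hom_comp, X.d_comp_d]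
      rfl

theorem cover_d (i : ℤ) : (cover X).d i (i + 1) = ModuleCat.ofHom (coverD X i) :=
  CochainComplex.of_d (fun i => ModuleCat.of _ (coverGen X i →₀ MvPolynomial k ℤ))
    (fun i => ModuleCat.ofHom (coverD X i)) i

end FreeCover

/-- Direct sums and tensor powers of free modules are free, so T(Y) is free over a domain of
characteristic 0 and torsion can be tested on coordinates. -/
theorem isTorsionFree_of_free {K : Type u} [CommRing K] [IsDomain K] [CharZero K]
    (Y : CochainComplex (ModuleCat.{v} K) ℤ) [∀ i, Module.Free K (Y.X i)] : IsTorsionFree Y := by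
  intro n hn x y hxy
  have h1 : ∀ m, Module.Free K (⨂[K]^m (Tot Y)) := fun m =>
    Module.Free.of_basis (Basis.piTensorProduct fun _ : Fin m => Module.Free.chooseBasis K (Tot Y))
  let b := Module.Free.chooseBasis K (T Y)
  refine b.repr.injective (Finsupp.ext fun i => ?_)
  have h := congrArg (fun z : T Y => b.repr z i) hxy
  have h' : n • b.repr x i = n • b.repr y i := by
    have e : ∀ z : T Y, b.repr (n • z) i = n • b.repr z i := fun z => by
      rw [map_nsmul, Finsupp.smul_apply]
    exact (e x).symm.trans (h.trans (e y))
  exact smul_right_injective K hn h'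

variable {k : Type u} [CommRing k] {X : CochainComplex (ModuleCat.{v} k) ℤ}

theorem isTorsionFree_cover (X : CochainComplex (ModuleCat.{v} k) ℤ) : IsTorsionFree (cover X) := by
  have : ∀ i, Module.Free (MvPolynomial k ℤ) ((cover X).X i) := fun i =>
    inferInstanceAs (Module.Free (MvPolynomial k ℤ) (coverGen X i →₀ MvPolynomial k ℤ))
  exact isTorsionFree_of_free _

variable (X) in
/-- `coverMap` as a map on the terms of the complex `cover X`. -/
def coverHom (i : ℤ) : (cover X).X i →ₛₗ[evalHom k] X.X i := coverMap X i

theorem coverHom_surjective (i : ℤ) : Function.Surjective (coverHom X i) := coverMap_surjective X i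

theorem coverHom_d (i : ℤ) (y : (cover X).X i) :
    coverHom X (i + 1) (((cover X).d i (i + 1)).hom y) = (X.d i (i + 1)).hom (coverHom X i y) := by
  rw [cover_d]
  exact coverMap_coverD X i y

variable (X) in
/-- The homomorphism from the shuffle algebra of the free cover. -/
def shCover : Sh (cover X) →+* Sh X := shMap (coverHom X)

theorem shCover_shGamma (n : ℕ) (y : Sh (cover X)) :
    shCover X (shGamma (cover X) n y) = shGamma X n (shCover X y) := shMap_shGamma (coverHom X) n y

theorem shCover_shD (y : Sh (cover X)) : shCover X (shD (cover X) y) = shD X (shCover X y) :=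
  shMap_shD (coverHom X) coverHom_d y

theorem exists_shCover_eq_of_mem_gr {r : ℤ} {x : Sh X} (hx : (x : T X) ∈ gr X r) :
    ∃ y : Sh (cover X), (y : T (cover X)) ∈ gr (cover X) r ∧ shCover X y = x ∧
      ((x : T X) ∈ TPlus X → (y : T (cover X)) ∈ TPlus (cover X)) :=
  exists_tMap_eq_of_mem_gr (coverHom X) evalHom_surjective coverHom_surjective hx

theorem exists_shCover_eq_of_mem_evenPart {x : Sh X} (hx : (x : T X) ∈ evenPart (gr X)) :
    ∃ y : Sh (cover X), (y : T (cover X)) ∈ evenPart (gr (cover X)) ∧ shCover X y = x ∧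
      ((x : T X) ∈ TPlus X → (y : T (cover X)) ∈ TPlus (cover X)) :=
  exists_tMap_eq_of_mem_evenPart (coverHom X) evalHom_surjective coverHom_surjective hx

/-- Lifting evenness and membership in T⁺ together allows the torsion-free identities to be used
upstairs and then pushed down. -/
theorem exists_shCover_eq_of_mem_plusEven {x : Sh X} (hx : x ∈ plusEven X) :
    ∃ y ∈ plusEven (cover X), shCover X y = x := by
  obtain ⟨y, hy, he, hp⟩ := exists_shCover_eq_of_mem_evenPart (x := x) hx.2
  exact ⟨y, ⟨hp hx.1, hy⟩, he⟩

/-! ### The divided power structure -/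

/-- Lift to the torsion-free cover, use the identity there, and map it back; the same argument
serves the other axioms. -/
theorem gamma_mul (n m : ℕ) {x : Sh X} (hx : x ∈ plusEven X) :
    shGamma X n x * shGamma X m x = (n + m).choose m • shGamma X (n + m) x := by
  obtain ⟨y, hy, rfl⟩ := exists_shCover_eq_of_mem_plusEven hx
  simp only [← shCover_shGamma, ← map_mul, ← map_nsmul, (isTorsionFree_cover X).gamma_mul n m hy]

theorem gamma_smul (n : ℕ) {a x : Sh X} (ha : (a : T X) ∈ evenPart (gr X)) (hx : x ∈ plusEven X) :
    shGamma X n (a * x) = a ^ n * shGamma X n x := by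
  obtain ⟨y, hy, rfl⟩ := exists_shCover_eq_of_mem_plusEven hx
  obtain ⟨b, hb, rfl, -⟩ := exists_shCover_eq_of_mem_evenPart (x := a) ha
  simp only [← shCover_shGamma, ← map_mul, ← map_pow, (isTorsionFree_cover X).gamma_smul n hb hy]

theorem gamma_add (n : ℕ) {x y : Sh X} (hx : x ∈ plusEven X) (hy : y ∈ plusEven X) :
    shGamma X n (x + y) = ∑ i ∈ Finset.range (n + 1), shGamma X i x * shGamma X (n - i) y := by
  obtain ⟨x, hx', rfl⟩ := exists_shCover_eq_of_mem_plusEven hx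
  obtain ⟨y, hy', rfl⟩ := exists_shCover_eq_of_mem_plusEven hy
  simp only [← shCover_shGamma, ← map_mul, ← map_add, ← map_sum,
    (isTorsionFree_cover X).gamma_add n hx' hy']

theorem gamma_comp (p : ℕ) {q : ℕ} (hq : 1 ≤ q) {x : Sh X} (hx : x ∈ plusEven X) :
    shGamma X p (shGamma X q x) = ((p * q)! / (p ! * q ! ^ p)) • shGamma X (p * q) x := by
  obtain ⟨y, hy, rfl⟩ := exists_shCover_eq_of_mem_plusEven hx
  simp only [← shCover_shGamma, ← map_nsmul, (isTorsionFree_cover X).gamma_comp p hq hy]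

theorem gamma_odd {n : ℕ} (hn : 2 ≤ n) {i j : ℤ} (hi : Odd i) (hj : Odd j)
    {x y : Sh X} (hx : (x : T X) ∈ gr X i) (hy : (y : T X) ∈ TPlus X ⊓ gr X j) :
    shGamma X n (x * y) = 0 := by
  obtain ⟨x, hx', rfl, -⟩ := exists_shCover_eq_of_mem_gr (x := x) hx
  obtain ⟨z, hz, rfl, hz'⟩ := exists_shCover_eq_of_mem_gr (x := y) hy.2
  rw [← map_mul, ← shCover_shGamma,
    (isTorsionFree_cover X).gamma_odd (x := x) (y := z) hn hi hj hx' ⟨hz' hy.1, hz⟩, map_zero]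

theorem d_gamma {n : ℕ} (hn : 1 ≤ n) {x : Sh X} (hx : x ∈ plusEven X) :
    shD X (shGamma X n x) = shGamma X (n - 1) x * shD X x := by
  obtain ⟨y, hy, rfl⟩ := exists_shCover_eq_of_mem_plusEven hx
  simp only [← shCover_shGamma, ← shCover_shD, ← map_mul, (isTorsionFree_cover X).d_gamma hn hy]

variable (X) in
theorem isPDStructure :
    IsPDStructure (shuffle X) (one X) (gr X) (d X) (TPlus X) (gamma X) where
  isDGIdeal := isDGIdeal_TPlus X
  gamma_mem n hn x hx := gamma_mem hn hx.2
  gamma_zero x _ := gamma_zero x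
  gamma_one x hx := gamma_one hx
  gamma_mul n m x hx := gamma_mul n m (x := x) hx
  gamma_smul n a ha x hx := by
    rw [npow_shuffle]
    exact gamma_smul n (a := a) (x := x) ha hx
  gamma_add n x hx y hy := gamma_add n (x := x) (y := y) hx hy
  gamma_comp p q hq x hx := gamma_comp p hq (x := x) hx
  gamma_deg n r _ x hx := gamma_mem_gr n hx.2
  gamma_odd n hn i j hi hj x hx y hy := gamma_odd hn hi hj (x := x) (y := y) hx hy
  d_gamma n hn x hx := d_gamma hn (x := x) hx

end

end ShuffleAlg

namespace DGAlg

section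

variable {k A : Type*} [CommRing k] [AddCommMonoid A] [Module k A] {mul : A →ₗ[k] A →ₗ[k] A}
  {one : A} {gr : ℤ → Submodule k A} {d : A →ₗ[k] A} {S : Submodule k A} {π : ℤ → A →ₗ[k] A}

/-! ### Structures induced on dg subalgebras -/

theorem IsDGAlgebra.sub (hA : IsDGAlgebra mul one gr d) (h : IsDGSubalgebra mul one gr d S)
    (hπ : IsGradingProj gr π) (hS : ∀ i, ∀ x ∈ S, π i x ∈ S) :
    IsDGAlgebra h.subMul h.subOne (subGr gr S) h.subD where
  isInternal := (hπ.subGr hS).isInternal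
  mul_assoc x y z := Subtype.ext (hA.mul_assoc x y z)
  one_mul x := Subtype.ext (hA.one_mul x)
  mul_one x := Subtype.ext (hA.mul_one x)
  one_mem := hA.one_mem
  mul_mem i j x hx y hy := hA.mul_mem i j x hx y hy
  d_mem i x hx := hA.d_mem i x hx
  d_d x := Subtype.ext (hA.d_d x)
  leibniz i x hx y := Subtype.ext (hA.leibniz i x hx y)

theorem IsStrictlyGradedCommutative.sub (hA : IsStrictlyGradedCommutative mul gr)
    (h : IsDGSubalgebra mul one gr d S) :
    IsStrictlyGradedCommutative h.subMul (subGr gr S) where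
  comm i j x hx y hy := Subtype.ext (hA.comm i j x hx y hy)
  sq_eq_zero i hi x hx := Subtype.ext (hA.sq_eq_zero i hi x hx)

theorem IsConnectedNGrading.sub {w : ℕ → Submodule k A} {ϖ : ℕ → A →ₗ[k] A}
    (hA : IsConnectedNGrading mul one gr d w) (h : IsDGSubalgebra mul one gr d S)
    (hπ : IsGradingProj gr π) (hS : ∀ i, ∀ x ∈ S, π i x ∈ S)
    (hϖ : IsGradingProj w ϖ) (hϖS : ∀ n, ∀ x ∈ S, ϖ n x ∈ S)
    (hw : ∀ n i, ∀ x ∈ w n, π i x ∈ w n) :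
    IsConnectedNGrading h.subMul h.subOne (subGr gr S) h.subD (subGr w S) where
  isInternal := (hϖ.subGr hϖS).isInternal
  homogeneous n := (hπ.subGr hS).le_iSup_inf fun i x hx => hw n i x hx
  one_mem := hA.one_mem
  mul_mem m n x hx y hy := hA.mul_mem m n x hx y hy
  d_mem n x hx := hA.d_mem n x hx
  smul_one_injective a b hab := hA.smul_one_injective (congrArg Subtype.val hab)
  exists_smul_one x hx := by
    obtain ⟨a, ha⟩ := hA.exists_smul_one x hx
    exact ⟨a, Subtype.ext ha⟩

theorem IsDGSubalgebra.coe_npow (h : IsDGSubalgebra mul one gr d S) (a : S) (n : ℕ) :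
    ((npow h.subMul h.subOne a n : S) : A) = npow mul one a n := by
  induction n with
  | zero => rfl
  | succ n ih =>
    rw [npow, npow, Function.iterate_succ_apply', Function.iterate_succ_apply', ← npow, ← npow,
      ← ih]
    rfl

theorem mul_mem_evenPart (hmul : ∀ i j, ∀ x ∈ gr i, ∀ y ∈ gr j, mul x y ∈ gr (i + j)) {x y : A}
    (hx : x ∈ evenPart gr) (hy : y ∈ evenPart gr) : mul x y ∈ evenPart gr := by
  suffices evenPart gr ≤ (evenPart gr).comap (mul.flip y) from this hx
  refine evenPart_le fun i hi x hx => ?_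
  suffices evenPart gr ≤ (evenPart gr).comap (mul x) from this hy
  exact evenPart_le fun j hj y hy => mem_evenPart_of_mem (hi.add hj) (hmul i j x hx y hy)

/-- Each axiom is an equation or a membership that can be tested in `A`; what has to be checked is
that the arguments fed to `γ'` are again even and in the ideal, where it agrees with `γ`. -/
theorem IsPDStructure.sub {I : Submodule k A} {γ : ℕ → A → A} {γ' : ℕ → S → S}
    (hγ : IsPDStructure mul one gr d I γ) (h : IsDGSubalgebra mul one gr d S)
    (hπ : IsGradingProj gr π) (hS : ∀ i, ∀ x ∈ S, π i x ∈ S) (hI : ∀ i, ∀ x ∈ I, π i x ∈ I)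
    (hmul : ∀ i j, ∀ x ∈ gr i, ∀ y ∈ gr j, mul x y ∈ gr (i + j))
    (hγ' : ∀ n, ∀ x ∈ I.comap S.subtype ⊓ evenPart (subGr gr S), (γ' n x : A) = γ n x) :
    IsPDStructure h.subMul h.subOne (subGr gr S) h.subD (I.comap S.subtype) γ' := by
  have hev : ∀ {x : S}, x ∈ evenPart (subGr gr S) ↔ (x : A) ∈ evenPart gr :=
    hπ.mem_evenPart_subGr_iff hS
  have hmem : ∀ {x : S}, x ∈ I.comap S.subtype ⊓ evenPart (subGr gr S) ↔
      (x : A) ∈ I ⊓ evenPart gr := fun {x} => and_congr Iff.rfl hev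
  have hid : IsDGIdeal h.subMul (subGr gr S) h.subD (I.comap S.subtype) :=
    { homogeneous := (hπ.subGr hS).le_iSup_inf fun i x hx => hI i x hx
      mul_mem_left := fun a x hx => hγ.isDGIdeal.mul_mem_left a x hx
      mul_mem_right := fun a x hx => hγ.isDGIdeal.mul_mem_right a x hx
      d_mem := fun x hx => hγ.isDGIdeal.d_mem x hx }
  have hpos : ∀ n, 1 ≤ n → ∀ x ∈ I.comap S.subtype ⊓ evenPart (subGr gr S),
      γ' n x ∈ I.comap S.subtype ⊓ evenPart (subGr gr S) := fun n hn x hx => by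
    rw [hmem, hγ' n x hx]
    exact hγ.gamma_mem n hn x (hmem.1 hx)
  refine
    { isDGIdeal := hid
      gamma_mem := hpos
      gamma_zero := fun x hx => Subtype.ext ?_
      gamma_one := fun x hx => Subtype.ext ?_
      gamma_mul := fun n m x hx => Subtype.ext ?_
      gamma_smul := fun n a ha x hx => Subtype.ext ?_
      gamma_add := fun n x hx y hy => Subtype.ext ?_
      gamma_comp := fun p q hq x hx => Subtype.ext ?_
      gamma_deg := fun n r hr x hx => ?_
      gamma_odd := fun n hn i j hi hj x hx y hy => Subtype.ext ?_
      d_gamma := fun n hn x hx => Subtype.ext ?_ }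
  · rw [hγ' 0 x hx]
    exact hγ.gamma_zero x (hmem.1 hx)
  · rw [hγ' 1 x hx]
    exact hγ.gamma_one x (hmem.1 hx)
  · change mul (γ' n x) (γ' m x) = _
    rw [hγ' n x hx, hγ' m x hx, Submodule.coe_smul_of_tower, hγ' _ x hx]
    exact hγ.gamma_mul n m x (hmem.1 hx)
  · have hax : h.subMul a x ∈ I.comap S.subtype ⊓ evenPart (subGr gr S) :=
      ⟨hid.mul_mem_left a x hx.1, hev.2 (mul_mem_evenPart hmul (hev.1 ha) (hev.1 hx.2))⟩
    rw [hγ' n _ hax]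
    change γ n (mul a x) = mul (npow h.subMul h.subOne a n : S) (γ' n x)
    rw [h.coe_npow, hγ' n x hx]
    exact hγ.gamma_smul n a (hev.1 ha) x (hmem.1 hx)
  · rw [hγ' n _ (add_mem hx hy), AddSubmonoidClass.coe_finsetSum]
    refine (hγ.gamma_add n x (hmem.1 hx) y (hmem.1 hy)).trans (Finset.sum_congr rfl fun i _ => ?_)
    change _ = mul (γ' i x) (γ' (n - i) y)
    rw [hγ' i x hx, hγ' (n - i) y hy]
  · rw [hγ' p _ (hpos q hq x hx), hγ' q x hx, Submodule.coe_smul_of_tower, hγ' _ x hx]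
    exact hγ.gamma_comp p q hq x (hmem.1 hx)
  · change (γ' n x : A) ∈ gr (n * r)
    rw [hγ' n x ⟨hx.1, mem_evenPart_of_mem hr hx.2⟩]
    exact hγ.gamma_deg n r hr x hx
  · have hxy : h.subMul x y ∈ I.comap S.subtype ⊓ evenPart (subGr gr S) :=
      ⟨hid.mul_mem_left x y hy.1,
        hev.2 (mem_evenPart_of_mem (hi.add_odd hj) (hmul i j x hx y hy.2))⟩
    rw [hγ' n _ hxy]
    exact hγ.gamma_odd n hn i j hi hj x hx y hy
  · change d (γ' n x) = mul (γ' (n - 1) x) (d x)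
    rw [hγ' n x hx, hγ' _ x hx]
    exact hγ.d_gamma n hn x (hmem.1 hx)

end

end DGAlg

namespace ShuffleAlg

open DGAlg

noncomputable section

variable {k : Type u} [CommRing k] {X : CochainComplex (ModuleCat.{v} k) ℤ}

/-! ### Symmetric tensors -/

theorem mem_powTS_iff {n : ℕ} {x : ⨂[k]^n (Tot X)} :
    x ∈ powTS X n ↔ ∀ σ : Equiv.Perm (Fin n), bijAct X σ x = x := by
  simp only [powTS, Submodule.mem_iInf, LinearMap.mem_eqLocus, permAct_eq_bijAct,
    LinearMap.id_apply]

theorem mem_TS_iff {x : T X} : x ∈ TS X ↔ ∀ n, comp X n x ∈ powTS X n := by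
  simp [TS, Submodule.mem_iInf]

theorem incl_mem_TS {n : ℕ} {x : ⨂[k]^n (Tot X)} (hx : x ∈ powTS X n) : incl X n x ∈ TS X := by
  rw [mem_TS_iff]
  intro m
  by_cases h : n = m
  · subst h; rwa [comp_incl]
  · rw [comp_incl_of_ne h]; exact zero_mem _

/-- The sum of the translates of a tensor fixed by a subgroup `H` along a set of representatives of
the cosets of `H` is symmetric. -/
theorem sum_bijAct_mem_powTS {n : ℕ} (H : Subgroup (Equiv.Perm (Fin n)))
    (R : Equiv.Perm (Fin n) → Prop) [DecidablePred R]
    (hex : ∀ g, ∃ r, R r ∧ ∃ h ∈ H, g = r * h)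
    (huniq : ∀ r r', R r → R r' → ∀ h ∈ H, ∀ h' ∈ H, r * h = r' * h' → r = r')
    {x : ⨂[k]^n (Tot X)} (hx : ∀ h ∈ H, bijAct X h x = x) :
    ∑ r with R r, bijAct X r x ∈ powTS X n := by
  rw [mem_powTS_iff]
  intro g
  choose r hr h hh hg using hex
  -- Left translation by g permutes the cosets of `H`; this is the induced map on representatives,
  -- injective and hence bijective on a finite set. The elements of `H` that appear act trivially on
  -- `x`.
  have hinj : Set.InjOn (fun s => r (g * s)) ({s | R s} : Finset (Equiv.Perm (Fin n))) := by
    intro s hs s' hs' he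
    simp only [Finset.coe_filter, Finset.mem_univ, true_and, Set.mem_ofPred_eq] at hs hs'
    refine huniq s s' hs hs' _ (inv_mem (hh (g * s))) _ (inv_mem (hh (g * s'))) ?_
    refine mul_left_cancel (a := g) ?_
    rw [← mul_assoc, ← mul_assoc, mul_inv_eq_iff_eq_mul.2 (hg (g * s)),
      mul_inv_eq_iff_eq_mul.2 (hg (g * s'))]
    exact he
  have hmaps : ∀ s ∈ ({s | R s} : Finset (Equiv.Perm (Fin n))),
      r (g * s) ∈ ({s | R s} : Finset (Equiv.Perm (Fin n))) := fun s _ => by simpa using hr _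
  rw [map_sum]
  refine Finset.sum_nbij (fun s => r (g * s)) hmaps hinj
    (Finset.surjOn_of_injOn_of_card_le _ hmaps hinj le_rfl) fun s _ => ?_
  have := bijAct_mul (X := X) (r (g * s)) (h (g * s)) x
  rw [← hg, hx _ (hh _), bijAct_mul] at this
  exact this

/-- The permutations which preserve the fibres of a map. -/
def fiberSubgroup {n : ℕ} {L : Type*} (f : Fin n → L) : Subgroup (Equiv.Perm (Fin n)) where
  carrier := {β | ∀ i, f (β i) = f i}
  one_mem' := fun _ => rfl
  mul_mem' := fun {a b} ha hb i => by rw [Equiv.Perm.mul_apply, ha, hb]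
  inv_mem' := fun {a} ha i => by
    have := ha (a⁻¹ i)
    rwa [← Equiv.Perm.mul_apply, mul_inv_cancel, Equiv.Perm.one_apply, eq_comm] at this

theorem bijAct_conc_of_mem_powTS {m n : ℕ} {x : ⨂[k]^m (Tot X)} {y : ⨂[k]^n (Tot X)}
    (hx : x ∈ powTS X m) (hy : y ∈ powTS X n) {β : Equiv.Perm (Fin (m + n))}
    (hβ : β ∈ fiberSubgroup (side m n)) : bijAct X β (conc X m n x y) = conc X m n x y := by
  obtain ⟨β₁, β₂, rfl⟩ := exists_finSum β hβ
  rw [bijAct_finSum_conc, mem_powTS_iff.1 hx, mem_powTS_iff.1 hy]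

/-- On components, f ⊗ g is fixed by the Young subgroup 𝔖ₘ × 𝔖ₙ, and shuffles represent its cosets.
-/
theorem shuffle_mem_TS {x y : T X} (hx : x ∈ TS X) (hy : y ∈ TS X) : shuffle X x y ∈ TS X := by
  classical
  obtain ⟨s, hs⟩ := exists_sum_incl x
  obtain ⟨t, ht⟩ := exists_sum_incl y
  rw [hs, ht, map_sum]
  simp only [map_sum, LinearMap.sum_apply]
  refine Submodule.sum_mem _ fun n _ => Submodule.sum_mem _ fun m _ => ?_
  rw [shuffle_incl, shuffleSum, ← map_sum]
  refine incl_mem_TS (sum_bijAct_mem_powTS (fiberSubgroup (side _ _)) _ (fun g => ?_)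
    (fun r r' hr hr' h hh h' hh' he => (fiberMono_mul_unique hr hr' hh hh' he).1)
    fun h hh => bijAct_conc_of_mem_powTS (mem_TS_iff.1 hx _) (mem_TS_iff.1 hy _) hh)
  obtain ⟨α, β, he, hα, hβ⟩ := exists_fiberMono_mul (side _ _) g
  exact ⟨α, hα, β, hβ, he⟩

theorem one_mem_TS : one X ∈ TS X :=
  incl_mem_TS (mem_powTS_iff.2 fun σ => by rw [Subsingleton.elim σ 1, bijAct_one])

theorem d_mem_TS {x : T X} (hx : x ∈ TS X) : d X x ∈ TS X := by
  rw [mem_TS_iff] at hx ⊢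
  intro n
  rw [d, comp_lmap, mem_powTS_iff]
  intro σ
  rw [bijAct_powD, mem_powTS_iff.1 (hx n)]

theorem grProj_mem_TS (r : ℤ) (x : T X) (hx : x ∈ TS X) : grProj X r x ∈ TS X := by
  rw [mem_TS_iff] at hx ⊢
  intro n
  rw [grProj, comp_lmap, mem_powTS_iff]
  intro σ
  rw [bijAct_powProj, mem_powTS_iff.1 (hx n)]

/-! ### Divided powers of symmetric tensors -/

/-- The permutations of `n` blocks of size `p` which map blocks to blocks. -/
def blockSubgroup (n p : ℕ) : Subgroup (Equiv.Perm (Fin (n * p))) where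
  carrier := {β | ∃ π : Equiv.Perm (Fin n), ∀ i, (β i).divNat = π i.divNat}
  one_mem' := ⟨1, fun _ => rfl⟩
  mul_mem' := by
    rintro a b ⟨π, hπ⟩ ⟨ρ, hρ⟩
    exact ⟨π * ρ, fun i => by rw [Equiv.Perm.mul_apply, hπ, hρ, Equiv.Perm.mul_apply]⟩
  inv_mem' := by
    rintro a ⟨π, hπ⟩
    refine ⟨π⁻¹, fun i => ?_⟩
    have := hπ (a⁻¹ i)
    rw [← Equiv.Perm.mul_apply, mul_inv_cancel, Equiv.Perm.one_apply] at this
    rw [this, ← Equiv.Perm.mul_apply, inv_mul_cancel, Equiv.Perm.one_apply]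

theorem divNat_blockPerm {n p : ℕ} (π : Equiv.Perm (Fin n)) (i : Fin (n * p)) :
    (blockPerm p π i).divNat = π i.divNat := by
  obtain ⟨⟨a, b⟩, rfl⟩ := finProdFinEquiv.surjective i
  rw [blockPerm_finProd, divNat_finProd, divNat_finProd]

/-- The wreath product factorization: undo the permutation of the blocks, and what remains acts
inside them. -/
theorem exists_blockPerm_mul {n p : ℕ} {h : Equiv.Perm (Fin (n * p))}
    (hh : h ∈ blockSubgroup n p) :
    ∃ π, ∃ β ∈ fiberSubgroup (Fin.divNat : Fin (n * p) → Fin n), h = blockPerm p π * β := by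
  obtain ⟨π, hπ⟩ := hh
  refine ⟨π, (blockPerm p π)⁻¹ * h, fun i => π.injective ?_, (mul_inv_cancel_left _ _).symm⟩
  rw [← divNat_blockPerm, ← Equiv.Perm.mul_apply, mul_inv_cancel_left, hπ]

theorem IsBlockShuffle.fiberMono_mul_blockPerm {n p : ℕ} {σ : Equiv.Perm (Fin (n * p))}
    (hσ : IsBlockShuffle n p σ) (π : Equiv.Perm (Fin n)) :
    FiberMono Fin.divNat (σ * blockPerm p π) := by
  rw [fiberMono_divNat_iff]
  intro a b b' hb
  simp only [Equiv.Perm.mul_apply, blockPerm_finProd]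
  exact hσ.1 _ hb

/-- Induct by splitting off the last block: β becomes a juxtaposition, whose right part fixes `x` by
symmetry and whose left part is of the same kind. -/
theorem bijAct_tensorPow_of_mem_powTS {n p : ℕ} {x : ⨂[k]^p (Tot X)} (hx : x ∈ powTS X p)
    {β : Equiv.Perm (Fin (n * p))} (hβ : ∀ i, (β i).divNat = i.divNat) :
    bijAct X β (tensorPow X n x) = tensorPow X n x := by
  induction n with
  | zero =>
    have : IsEmpty (Fin (0 * p)) := by rw [zero_mul]; infer_instance
    rw [Subsingleton.elim β 1, bijAct_one]
  | succ n ih =>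
    let c := finCongr (Nat.succ_mul n p)
    let β' : Equiv.Perm (Fin (n * p + p)) := (c.symm.trans β).trans c
    have hside : ∀ i, side (n * p) p i = decide ((c.symm i).divNat = Fin.last n) := by
      intro i
      induction i using Fin.addCases with
      | left i =>
        rw [side_castAdd, eq_comm, decide_eq_false_iff_not]
        exact (divNat_cast_castAdd i).trans_ne (Fin.castSucc_ne_last _)
      | right i =>
        rw [side_natAdd, eq_comm, decide_eq_true_eq]
        exact divNat_cast_natAdd i
    obtain ⟨β₁, β₂, he⟩ := exists_finSum β' fun i => by
      rw [hside, hside]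
      simp only [β', Equiv.trans_apply, Equiv.symm_apply_apply, hβ]
    have hβ₁ : ∀ i, (β₁ i).divNat = i.divNat := by
      intro i
      have h1 : β' (Fin.castAdd p i) = Fin.castAdd p (β₁ i) := by rw [he]; simp
      have h2 : β (c.symm (Fin.castAdd p i)) = c.symm (Fin.castAdd p (β₁ i)) := by
        rw [← h1]; simp only [β', Equiv.trans_apply, Equiv.symm_apply_apply]
      have h3 := hβ (c.symm (Fin.castAdd p i))
      rw [h2] at h3
      exact Fin.castSucc_injective _
        ((divNat_cast_castAdd (β₁ i)).symm.trans (h3.trans (divNat_cast_castAdd i)))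
    refine cast_injective (Nat.succ_mul n p) ?_
    have hcomm : β.trans c = c.trans β' := Equiv.ext fun i => by simp [β']
    rw [← bijAct_finCongr, ← bijAct_finCongr, ← bijAct_trans]
    change bijAct X (β.trans c) _ = _
    rw [hcomm, bijAct_trans, bijAct_finCongr, tensorPow_succ, he, bijAct_finSum_conc, ih hβ₁,
      mem_powTS_iff.1 hx]

/-- Block shuffles represent the cosets of the wreath product. Inside the blocks it fixes the tensor
power because `x` is symmetric, and between the blocks because `x` has even degree. -/
theorem powGamma_mem_powTS (n : ℕ) {p : ℕ} (hp : 1 ≤ p) {x : ⨂[k]^p (Tot X)}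
    (he : x ∈ evenPart (powGr X p)) (hx : x ∈ powTS X p) : powGamma X n x ∈ powTS X (n * p) := by
  classical
  rw [powGamma_eq]
  refine sum_bijAct_mem_powTS (blockSubgroup n p) _ (fun g => ?_)
    (fun r r' hr hr' h hh h' hh' heq => ?_) fun h hh => ?_
  · obtain ⟨α, β, rfl, hα, hβ⟩ := exists_fiberMono_mul (Fin.divNat : Fin (n * p) → Fin n) g
    obtain ⟨σ, π, hσ, rfl⟩ := exists_isBlockShuffle_mul hp hα
    exact ⟨σ, hσ, blockPerm p π * β, mul_mem ⟨π, divNat_blockPerm π⟩ ⟨1, hβ⟩, mul_assoc _ _ _⟩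
  · obtain ⟨π, β, hβ, rfl⟩ := exists_blockPerm_mul hh
    obtain ⟨π', β', hβ', rfl⟩ := exists_blockPerm_mul hh'
    rw [← mul_assoc, ← mul_assoc] at heq
    exact (isBlockShuffle_mul_unique hp hr hr' (fiberMono_mul_unique
      (hr.fiberMono_mul_blockPerm π) (hr'.fiberMono_mul_blockPerm π') hβ hβ' heq).1).1
  · obtain ⟨π, β, hβ, rfl⟩ := exists_blockPerm_mul hh
    rw [bijAct_mul, bijAct_tensorPow_of_mem_powTS hx hβ, bijAct_blockPerm_tensorPow π he]

theorem gamma_mem_TS (n : ℕ) {x : T X} (he : x ∈ evenPart (gr X)) (hx : x ∈ TS X) :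
    gamma X n x ∈ TS X := by
  suffices ∀ N, (truncGamma X N n x : T X) ∈ TS X from this _
  intro N
  induction N generalizing n with
  | zero =>
    rw [truncGamma]
    split_ifs
    · exact one_mem_TS
    · exact zero_mem _
  | succ N ih =>
    rw [truncGamma]
    exact Submodule.sum_mem (TS X) fun i _ => shuffle_mem_TS (ih i)
      (incl_mem_TS (powGamma_mem_powTS _ (by omega) (comp_mem_evenPart he _) (mem_TS_iff.1 hx _)))

/-! ### The dg algebra of symmetric tensors -/

variable (X) in
theorem isDGSubalgebra_TS : IsDGSubalgebra (shuffle X) (one X) (gr X) (d X) (TS X) where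
  homogeneous := (isGradingProj_gr X).le_iSup_inf grProj_mem_TS
  one_mem := one_mem_TS
  mul_mem _ hx _ hy := shuffle_mem_TS hx hy
  d_mem _ hx := d_mem_TS hx

theorem grProj_mem_tensorGr (n : ℕ) (r : ℤ) (x : T X) (hx : x ∈ tensorGr X n) :
    grProj X r x ∈ tensorGr X n := by
  obtain ⟨x, rfl⟩ := hx
  exact ⟨powProj X n r x, (DirectSum.lmap_lof (fun n => powProj X n r) n x).symm⟩

theorem incl_comp_mem_TS (n : ℕ) (x : T X) (hx : x ∈ TS X) : (incl X n ∘ₗ comp X n) x ∈ TS X :=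
  incl_mem_TS (mem_TS_iff.1 hx n)

theorem grProj_mem_TPlus (r : ℤ) (x : T X) (hx : x ∈ TPlus X) : grProj X r x ∈ TPlus X := by
  rw [mem_TPlus_iff] at hx ⊢
  rw [grProj, comp_lmap, hx, map_zero]

end

end ShuffleAlg

/-! ### Assembly of the theorem -/

open DGAlg ShuffleAlg in
theorem mainTheorem1 {k : Type u} [CommRing k] (X : CochainComplex (ModuleCat.{v} k) ℤ) :
    -- `(T(X), ⋆)` is a connected strictly graded commutative dg algebra
    IsDGAlgebra (shuffle X) (one X) (gr X) (d X) ∧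
    IsStrictlyGradedCommutative (shuffle X) (gr X) ∧
    IsConnectedNGrading (shuffle X) (one X) (gr X) (d X) (tensorGr X) ∧
    -- `TS(X)` is a dg subalgebra, itself a connected strictly graded commutative dg algebra
    ∃ h : IsDGSubalgebra (shuffle X) (one X) (gr X) (d X) (TS X),
      IsDGAlgebra h.subMul h.subOne (subGr (gr X) (TS X)) h.subD ∧
      IsStrictlyGradedCommutative h.subMul (subGr (gr X) (TS X)) ∧
      IsConnectedNGrading h.subMul h.subOne (subGr (gr X) (TS X)) h.subD
        (subGr (tensorGr X) (TS X)) ∧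
      -- divided powers on `T⁺(X)`, restricting to divided powers on `TS⁺(X)`
      ∃ (γ : ℕ → T X → T X) (γ' : ℕ → TS X → TS X),
        IsPDStructure (shuffle X) (one X) (gr X) (d X) (TPlus X) γ ∧
        IsPDStructure h.subMul h.subOne (subGr (gr X) (TS X)) h.subD (TSPlus X) γ' ∧
        (∀ n, ∀ x ∈ TSPlus X ⊓ evenPart (subGr (gr X) (TS X)), (γ' n x : T X) = γ n x) ∧
        ∀ (n p : ℕ) (x : ⨂[k]^p (Tot X)), 1 ≤ p →
          DirectSum.lof k ℕ (fun n => ⨂[k]^n (Tot X)) p x ∈ evenPart (gr X) →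
          γ n (DirectSum.lof k ℕ (fun n => ⨂[k]^n (Tot X)) p x) =
            DirectSum.lof k ℕ (fun n => ⨂[k]^n (Tot X)) (n * p) (powGamma X n x) := by
  classical
  have hev : ∀ {x : TS X}, x ∈ evenPart (subGr (gr X) (TS X)) ↔ (x : T X) ∈ evenPart (gr X) :=
    (isGradingProj_gr X).mem_evenPart_subGr_iff grProj_mem_TS
  -- Symmetry of `gamma X n x` is known only for even x, so elsewhere the value is set to 0; a
  -- divided power structure does not see those values.
  let γ' : ℕ → TS X → TS X := fun n x =>
    if hx : (x : T X) ∈ evenPart (gr X) then ⟨gamma X n x, gamma_mem_TS n hx x.2⟩ else 0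
  have hγ' : ∀ n, ∀ x ∈ TSPlus X ⊓ evenPart (subGr (gr X) (TS X)),
      (γ' n x : T X) = gamma X n x := by
    intro n x hx
    simp only [γ', dif_pos (hev.1 hx.2)]
  exact ⟨isDGAlgebra X, isStrictlyGradedCommutative X, isConnectedNGrading X, isDGSubalgebra_TS X,
    (isDGAlgebra X).sub _ (isGradingProj_gr X) grProj_mem_TS,
    (isStrictlyGradedCommutative X).sub _,
    (isConnectedNGrading X).sub _ (isGradingProj_gr X) grProj_mem_TS (isGradingProj_tensorGr X)
      incl_comp_mem_TS grProj_mem_tensorGr,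
    gamma X, γ', isPDStructure X,
    (isPDStructure X).sub _ (isGradingProj_gr X) grProj_mem_TS grProj_mem_TPlus
      (isDGAlgebra X).mul_mem hγ',
    hγ', fun n p x hp _ => gamma_incl n hp x⟩
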